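/- Let $k$ be a field of characteristic not $2$ and let $A$ be a Hopf algebra over $k$ with coproduct $a\mapsto a_{(1)}\otimes a_{(2)}$, counit $\epsilon$ and bijective antipode $S$. Put $A^+=\ker\epsilon$ and $\pi:A\to A^+$, $\pi(a)=a-\epsilon(a)1$. A *bicovariant differential exterior algebra* over $A$ is a graded algebra $\Omega=\bigoplus_{n\ge 0}\Omega^n$ with $\Omega^0=A$, together with a degree $1$ linear map $\mathrm d:\Omega\to\Omega$ satisfying $\mathrm d(uv)=(\mathrm du)v+(-1)^n u\,\mathrm dv$ for $u\in\Omega^n$, $v\in\Omega$, and $\mathrm d^2=0$, and together with commuting left and right coactions $\Delta_L:\Omega\to A\otimes\Omega$, $\Delta_R:\Omega\to\Omega\otimes A$ that are algebra maps, respect the grading, restrict to the coproduct on $A$, and commute with $\mathrm d$. It is *strongly bicovariant* if $\Omega$ admits a graded super-Hopf algebra structure (coproduct $\Delta$ with $\Delta(\Omega^n)\subseteq\bigoplus_{i+j=n}\Omega^i\otimes\Omega^j$, multiplicative for the super tensor product; counit vanishing in positive degrees; antipode preserving degree) which extends that of $A=\Omega^0$ and induces the given coactions, i.e. $\Delta_L=(\Pi\otimes\mathrm{id})\Delta$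 and $\Delta_R=(\mathrm{id}\otimes\Pi)\Delta$ for the projection $\Pi:\Omega\to\Omega^0=A$, and such that $\Delta\circ\mathrm d=(\mathrm d\otimes\mathrm{id}+(-1)^{|\ |}\otimes\mathrm d)\Delta$, where $(-1)^{|\ |}w=(-1)^{|w|}w$. Let $\Lambda=\{\eta\in\Omega:\Delta_L\eta=1\otimes\eta\}$ be the graded algebra of left-invariant forms, $\Lambda^n=\Lambda\cap\Omega^n$, with right $A$-action $\eta\triangleleft a=(Sa_{(1)})\,\eta\, a_{(2)}$ and right $A$-coaction $\Delta_R\eta=\eta_0\otimes\eta_1$ (so that $\Omega\cong A\ltimes\Lambda$). Let $\delta:\Lambda\to\Lambda$ be the restriction of $\mathrm d$ and $\omega:A^+\to\Lambda^1$, $\omega(a)=(Sa_{(1)})\,\mathrm da_{(2)}$. Right $A$-crossed modules are right modules and right comodules with $\Delta_R(v\triangleleft a)=v_0\triangleleft a_{(2)}\otimes (Sa_{(1)})v_1a_{(3)}$, and have the braiding $\Psi(v\otimes w)=w_0\otimes v\triangleleft w_1$. **Theorem.** A bicovariant differential exterior algebra $(\Omega,\mathrm d)$ over $A$ is strongly bicovariant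 if and only if there exist $\underline\Delta:\Lambda\to\Lambda\otimes\Lambda$, written $\underline\Delta\eta=\eta^1\otimes\eta^2$, $\underline\epsilon:\Lambda\to k$ and $\underline S:\Lambda\to\Lambda$ such that: 1. $\Lambda$ with $\underline\Delta,\underline\epsilon,\underline S$ is a graded braided-super Hopf algebra in the category of right $A$-crossed modules. That is, each $\Lambda^n$ is a crossed module; the product, unit, $\underline\Delta$, $\underline\epsilon$ and $\underline S$ are morphisms of crossed modules and respect the grading; $(\underline\Delta,\underline\epsilon)$ is a coalgebra with $\underline S$ as antipode (convolution inverse of the identity); $\underline\epsilon$ is an algebra map; and $\underline\Delta$ is an algebra map into $\Lambda\otimes\Lambda$ with the product $(v\otimes v')(w\otimes w')=(-1)^{|v'||w|}\,v w_0\otimes (v'\triangleleft w_1)w'$. 2. For all $\eta\in\Lambda$, $$\underline\Delta(\delta\eta)=\delta\eta^1\otimes\eta^2+(-1)^{|\eta^1|}\eta^1\otimes\delta\eta^2+(-1)^{|\eta^1|}(\eta^1)_0\otimes\omega(\pi((\eta^1)_1))\,\eta^2 .$$ -/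

import Mathlib

open scoped TensorProduct
open HopfAlgebra (antipode)
open Coalgebra (comul counit)

noncomputable section

namespace StrongBicov

/-! ### Graded vector spaces: signs -/

section Graded

variable {k V : Type*} [Field k] [AddCommGroup V] [Module k V]
variable (𝒱 : ℕ → Submodule k V) [DirectSum.Decomposition 𝒱]

/-- The parity operator `v ↦ (-1)^{|v|} v`. -/
def parity : V →ₗ[k] V :=
  DirectSum.toModule k ℕ V (fun n => ((-1 : k) ^ n) • (𝒱 n).subtype) ∘ₗ
    (DirectSum.decomposeLinearEquiv 𝒱).toLinearMap

theorem parity_of_mem {n : ℕ} {v : V} (hv : v ∈ 𝒱 n) :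
    parity 𝒱 v = ((-1 : k) ^ n) • v := by
  lift v to 𝒱 n using hv
  rw [parity, LinearMap.comp_apply, LinearEquiv.coe_coe, DirectSum.decomposeLinearEquiv_apply_coe,
    DirectSum.toModule_lof]
  simp

/-- The Koszul sign operator `v ⊗ w ↦ (-1)^{|v||w|} v ⊗ w`. -/
def koszul : V ⊗[k] V →ₗ[k] V ⊗[k] V :=
  TensorProduct.lift
    (DirectSum.toModule k ℕ (V →ₗ[k] V ⊗[k] V)
        (fun n => (TensorProduct.mk k V V).compl₂ (parity 𝒱 ^ n) ∘ₗ (𝒱 n).subtype) ∘ₗ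
      (DirectSum.decomposeLinearEquiv 𝒱).toLinearMap)

theorem koszul_of_mem {i j : ℕ} {v w : V} (hv : v ∈ 𝒱 i) (hw : w ∈ 𝒱 j) :
    koszul 𝒱 (v ⊗ₜ w) = ((-1 : k) ^ (i * j)) • (v ⊗ₜ[k] w) := by
  have hp : ∀ n : ℕ, (parity 𝒱 ^ n) w = ((-1 : k) ^ (n * j)) • w := by
    intro n
    induction n with
    | zero => simp
    | succ n ih =>
      rw [pow_succ', Module.End.mul_apply, ih, map_smul, parity_of_mem 𝒱 hw, smul_smul,
        ← pow_add, Nat.succ_mul]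
  lift v to 𝒱 i using hv
  rw [koszul, TensorProduct.lift.tmul, LinearMap.comp_apply, LinearEquiv.coe_coe,
    DirectSum.decomposeLinearEquiv_apply_coe, DirectSum.toModule_lof]
  simp [hp]

end Graded

/-! ### Hopf algebras with respect to a braiding operator -/

section Hopf

variable {k V : Type*} [Field k] [Ring V] [Algebra k V]

/-- The product `(v ⊗ v')(w ⊗ w') = v B(v' ⊗ w) w'` of the braided tensor product algebra
`V ⊗ V`, for a braiding operator `B : V ⊗ V → V ⊗ V`. -/
def braidedMul (B : V ⊗[k] V →ₗ[k] V ⊗[k] V) :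
    (V ⊗[k] V) ⊗[k] (V ⊗[k] V) →ₗ[k] V ⊗[k] V :=
  TensorProduct.map (LinearMap.mul' k V) (LinearMap.mul' k V) ∘ₗ
    (TensorProduct.assoc k V V (V ⊗[k] V)).symm.toLinearMap ∘ₗ
    LinearMap.lTensor V ((TensorProduct.assoc k V V V).toLinearMap ∘ₗ
      LinearMap.rTensor V B ∘ₗ (TensorProduct.assoc k V V V).symm.toLinearMap) ∘ₗ
    (TensorProduct.assoc k V V (V ⊗[k] V)).toLinearMap

theorem braidedMul_apply_of_tmul (B : V ⊗[k] V →ₗ[k] V ⊗[k] V) (v v' w w' x y : V)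
    (h : B (v' ⊗ₜ w) = x ⊗ₜ y) :
    braidedMul B ((v ⊗ₜ v') ⊗ₜ (w ⊗ₜ w')) = (v * x) ⊗ₜ (y * w') := by
  simp [braidedMul, h]

/-- The coproduct `Δ`, counit `ε` and antipode `S` make the graded algebra `V` a graded Hopf algebra,
where `V ⊗ V` has the product twisted by the braiding operator `B`. -/
structure IsGradedHopf (𝒱 : ℕ → Submodule k V) (B : V ⊗[k] V →ₗ[k] V ⊗[k] V)
    (Δ : V →ₗ[k] V ⊗[k] V) (ε : V →ₗ[k] k) (S : V →ₗ[k] V) : Prop where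
  coassoc : ∀ v, TensorProduct.assoc k V V V (LinearMap.rTensor V Δ (Δ v)) =
    LinearMap.lTensor V Δ (Δ v)
  rTensor_counit : ∀ v, LinearMap.rTensor V ε (Δ v) = 1 ⊗ₜ[k] v
  lTensor_counit : ∀ v, LinearMap.lTensor V ε (Δ v) = v ⊗ₜ[k] 1
  comul_one : Δ 1 = 1 ⊗ₜ[k] 1
  comul_mul : ∀ v w, Δ (v * w) = braidedMul B (Δ v ⊗ₜ[k] Δ w)
  counit_one : ε 1 = 1
  counit_mul : ∀ v w, ε (v * w) = ε v * ε w
  antipode_left : ∀ v, LinearMap.mul' k V (LinearMap.rTensor V S (Δ v)) = algebraMap k V (ε v)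
  antipode_right : ∀ v, LinearMap.mul' k V (LinearMap.lTensor V S (Δ v)) = algebraMap k V (ε v)
  comul_mem : ∀ n, ∀ v ∈ 𝒱 n, Δ v ∈ ⨆ (i : ℕ) (j : ℕ) (_ : i + j = n),
    LinearMap.range (TensorProduct.map (𝒱 i).subtype (𝒱 j).subtype)
  counit_mem : ∀ n, ∀ v ∈ 𝒱 n, n ≠ 0 → ε v = 0
  antipode_mem : ∀ n, ∀ v ∈ 𝒱 n, S v ∈ 𝒱 n

/-- The super flip `v ⊗ w ↦ (-1)^{|v||w|} w ⊗ v`. -/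
def superFlip (𝒱 : ℕ → Submodule k V) [DirectSum.Decomposition 𝒱] :
    V ⊗[k] V →ₗ[k] V ⊗[k] V :=
  (TensorProduct.comm k V V).toLinearMap ∘ₗ koszul 𝒱

end Hopf

/-! ### Right crossed modules over a Hopf algebra -/

section Crossed

variable (k A : Type*) [Field k] [Ring A] [HopfAlgebra k A]

/-- A linear right action `v ◁ a = act v a` and a linear right coaction `coact v = v₀ ⊗ v₁`
(operations only; the axioms are in `IsCrossedModule`). -/
structure ActCoact (V : Type*) [AddCommGroup V] [Module k V] where
  act : V →ₗ[k] A →ₗ[k] V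
  coact : V →ₗ[k] V ⊗[k] A

variable {k A}

/-- `(a ⊗ c) ↦ (b ↦ S(a) b c)`. -/
def antipodeConj : A ⊗[k] A →ₗ[k] A →ₗ[k] A :=
  TensorProduct.lift (LinearMap.mk₂ k
    (fun a c => LinearMap.mulLeft k (antipode k a) ∘ₗ LinearMap.mulRight k c)
    (fun a a' c => by ext; simp [add_mul]) (fun r a c => by ext; simp)
    (fun a c c' => by ext; simp [mul_add]) (fun r a c => by ext; simp))

namespace ActCoact

variable {V : Type*} [AddCommGroup V] [Module k V]
variable {W : Type*} [AddCommGroup W] [Module k W]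

/-- `a₁ ⊗ (a₂ ⊗ a₃) ↦ (v ⊗ b ↦ v ◁ a₂ ⊗ S(a₁) b a₃)`. -/
def crossedTwist (X : ActCoact k A V) :
    A ⊗[k] (A ⊗[k] A) →ₗ[k] V ⊗[k] A →ₗ[k] V ⊗[k] A :=
  TensorProduct.homTensorHomMap (RingHom.id k) V A V A ∘ₗ
    TensorProduct.map X.act.flip antipodeConj ∘ₗ
    (TensorProduct.leftComm k A A A).toLinearMap

theorem crossedTwist_tmul (X : ActCoact k A V) (a b c d : A) (v : V) :
    X.crossedTwist (a ⊗ₜ (b ⊗ₜ c)) (v ⊗ₜ d) = X.act v b ⊗ₜ[k] (antipode k a * (d * c)) := by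
  simp [crossedTwist, antipodeConj]

/-- The axioms of a right crossed module: right module, right comodule and
`Δ_R(v ◁ a) = v₀ ◁ a₂ ⊗ S(a₁) v₁ a₃`. -/
structure IsCrossedModule (X : ActCoact k A V) : Prop where
  act_one : ∀ v, X.act v 1 = v
  act_mul : ∀ v a b, X.act v (a * b) = X.act (X.act v a) b
  coassoc : ∀ v, TensorProduct.assoc k V A A (LinearMap.rTensor A X.coact (X.coact v)) =
    LinearMap.lTensor V (comul (R := k)) (X.coact v)
  counit : ∀ v, LinearMap.lTensor V (counit (R := k) (A := A)) (X.coact v) = v ⊗ₜ[k] 1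
  crossed : ∀ v a, X.coact (X.act v a) =
    X.crossedTwist (LinearMap.lTensor A (comul (R := k)) (comul (R := k) a)) (X.coact v)

/-- The tensor product: `(v ⊗ w) ◁ a = v ◁ a₁ ⊗ w ◁ a₂` and
`Δ_R(v ⊗ w) = v₀ ⊗ w₀ ⊗ v₁ w₁`. -/
def tensor (X : ActCoact k A V) (Y : ActCoact k A W) : ActCoact k A (V ⊗[k] W) where
  act := (TensorProduct.homTensorHomMap (RingHom.id k) V W V W ∘ₗ
    TensorProduct.map X.act.flip Y.act.flip ∘ₗ comul (R := k)).flip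
  coact := LinearMap.lTensor (V ⊗[k] W) (LinearMap.mul' k A) ∘ₗ
    (TensorProduct.tensorTensorTensorComm k V A W A).toLinearMap ∘ₗ
    TensorProduct.map X.coact Y.coact

/-- The unit object `k`: `r ◁ a = r ε(a)` and `Δ_R(r) = r ⊗ 1`. -/
def unit : ActCoact k A k where
  act := (LinearMap.mul k k).compl₂ (counit (R := k) (A := A))
  coact := (TensorProduct.mk k k A).flip 1

/-- Morphisms of crossed modules: linear maps that commute with the action and the coaction. -/
structure IsHom (X : ActCoact k A V) (Y : ActCoact k A W) (f : V →ₗ[k] W) : Prop where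
  map_act : ∀ v a, f (X.act v a) = Y.act (f v) a
  map_coact : ∀ v, Y.coact (f v) = LinearMap.rTensor A f (X.coact v)

/-- The braiding `Ψ(v ⊗ w) = w₀ ⊗ v ◁ w₁`. -/
def braiding (X : ActCoact k A V) (Y : ActCoact k A W) : V ⊗[k] W →ₗ[k] W ⊗[k] V :=
  LinearMap.lTensor W (TensorProduct.lift X.act) ∘ₗ
    (TensorProduct.leftComm k V W A).toLinearMap ∘ₗ LinearMap.lTensor V Y.coact

end ActCoact

variable {V : Type*} [Ring V] [Algebra k V]

/-- `(Δ, ε, S)` make the graded algebra `V`, with action and coaction `X`, a graded braided-super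
Hopf algebra in the category of right crossed modules: the graded components are crossed modules,
all structure maps are morphisms of crossed modules, and the Hopf algebra axioms hold for the
super braiding `v ⊗ w ↦ (-1)^{|v||w|} w₀ ⊗ v ◁ w₁`. -/
structure IsGradedBraidedSuperHopf (𝒱 : ℕ → Submodule k V) [DirectSum.Decomposition 𝒱]
    (X : ActCoact k A V) (Δ : V →ₗ[k] V ⊗[k] V) (ε : V →ₗ[k] k) (S : V →ₗ[k] V) : Prop where
  crossedModule : X.IsCrossedModule
  act_mem : ∀ n, ∀ v ∈ 𝒱 n, ∀ a, X.act v a ∈ 𝒱 n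
  coact_mem : ∀ n, ∀ v ∈ 𝒱 n, X.coact v ∈ LinearMap.range (LinearMap.rTensor A (𝒱 n).subtype)
  mul_hom : (X.tensor X).IsHom X (LinearMap.mul' k V)
  one_hom : ActCoact.unit.IsHom X (Algebra.linearMap k V)
  comul_hom : X.IsHom (X.tensor X) Δ
  counit_hom : X.IsHom ActCoact.unit ε
  antipode_hom : X.IsHom X S
  hopf : IsGradedHopf 𝒱 (X.braiding X ∘ₗ koszul 𝒱) Δ ε S

end Crossed

/-! ### Bicovariant differential exterior algebras -/

section Bicovariant

variable (k A : Type*) [Field k] [Ring A] [HopfAlgebra k A]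
variable {Ω : Type*} [Ring Ω] [Algebra k Ω]

/-- A bicovariant differential exterior algebra over the Hopf algebra `A`: a graded algebra
`Ω = ⨁ Ωⁿ` with `Ω⁰ = A`, a super-derivation `d` of degree 1 with `d² = 0`, and graded coactions
`Δ_L`, `Δ_R` making `Ω` an `A`-bicomodule algebra, restricting to the coproduct on `A`, and such
that `d` is a bicomodule map. -/
structure BicovariantDGA (𝒢 : ℕ → Submodule k Ω) [GradedAlgebra 𝒢] where
  zeroEquiv : A ≃ₐ[k] 𝒢 0
  d : Ω →ₗ[k] Ω
  coactL : Ω →ₐ[k] A ⊗[k] Ω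
  coactR : Ω →ₐ[k] Ω ⊗[k] A
  d_mem : ∀ n, ∀ u ∈ 𝒢 n, d u ∈ 𝒢 (n + 1)
  d_mul : ∀ n, ∀ u ∈ 𝒢 n, ∀ v, d (u * v) = d u * v + ((-1 : k) ^ n) • (u * d v)
  d_d : ∀ u, d (d u) = 0
  coactL_coassoc : ∀ u, TensorProduct.assoc k A A Ω
    (LinearMap.rTensor Ω (comul (R := k)) (coactL u)) =
      LinearMap.lTensor A coactL.toLinearMap (coactL u)
  coactL_counit : ∀ u, LinearMap.rTensor Ω (counit (R := k) (A := A)) (coactL u) = 1 ⊗ₜ[k] u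
  coactR_coassoc : ∀ u, TensorProduct.assoc k Ω A A
    (LinearMap.rTensor A coactR.toLinearMap (coactR u)) =
      LinearMap.lTensor Ω (comul (R := k)) (coactR u)
  coactR_counit : ∀ u, LinearMap.lTensor Ω (counit (R := k) (A := A)) (coactR u) = u ⊗ₜ[k] 1
  coact_comm : ∀ u, TensorProduct.assoc k A Ω A
    (LinearMap.rTensor A coactL.toLinearMap (coactR u)) =
      LinearMap.lTensor A coactR.toLinearMap (coactL u)
  coactL_mem : ∀ n, ∀ u ∈ 𝒢 n, coactL u ∈ LinearMap.range (LinearMap.lTensor A (𝒢 n).subtype)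
  coactR_mem : ∀ n, ∀ u ∈ 𝒢 n, coactR u ∈ LinearMap.range (LinearMap.rTensor A (𝒢 n).subtype)
  coactL_zero : ∀ a, coactL (zeroEquiv a) =
    LinearMap.lTensor A ((𝒢 0).subtype ∘ₗ zeroEquiv.toLinearMap) (comul (R := k) a)
  coactR_zero : ∀ a, coactR (zeroEquiv a) =
    LinearMap.rTensor A ((𝒢 0).subtype ∘ₗ zeroEquiv.toLinearMap) (comul (R := k) a)
  d_coactL : ∀ u, coactL (d u) = LinearMap.lTensor A d (coactL u)
  d_coactR : ∀ u, coactR (d u) = LinearMap.rTensor A d (coactR u)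

namespace BicovariantDGA

variable {k A}
variable {𝒢 : ℕ → Submodule k Ω} [GradedAlgebra 𝒢] (X : BicovariantDGA k A 𝒢)

/-- The inclusion `A = Ω⁰ ⊆ Ω`. -/
def incl : A →ₗ[k] Ω := (𝒢 0).subtype ∘ₗ X.zeroEquiv.toLinearMap

/-- The projection `Ω → Ω⁰ = A`. -/
def proj : Ω →ₗ[k] A :=
  X.zeroEquiv.symm.toLinearMap ∘ₗ DirectSum.component k ℕ (fun n => 𝒢 n) 0 ∘ₗ
    (DirectSum.decomposeLinearEquiv 𝒢).toLinearMap

theorem proj_incl (a : A) : X.proj (X.incl a) = a := by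
  rw [proj, incl, LinearMap.comp_apply, LinearMap.comp_apply, LinearMap.comp_apply,
    LinearEquiv.coe_coe, Submodule.subtype_apply, LinearEquiv.coe_coe,
    DirectSum.decomposeLinearEquiv_apply_coe, DirectSum.component.lof_self]
  simp

theorem incl_one : X.incl 1 = 1 := by
  simp [incl]

theorem incl_mul (a b : A) : X.incl (a * b) = X.incl a * X.incl b := by
  simp [incl]

/-- `(Δ, ε, S)` is a graded super-Hopf algebra structure on `Ω`, extending that of `A = Ω⁰` and
inducing the given coactions `Δ_L`, `Δ_R`, for which `d` is a super-coderivation. -/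
structure IsStrong (Δ : Ω →ₗ[k] Ω ⊗[k] Ω) (ε : Ω →ₗ[k] k) (S : Ω →ₗ[k] Ω) : Prop where
  hopf : IsGradedHopf 𝒢 (superFlip 𝒢) Δ ε S
  comul_incl : ∀ a, Δ (X.incl a) = TensorProduct.map X.incl X.incl (comul (R := k) a)
  counit_incl : ∀ a, ε (X.incl a) = counit (R := k) a
  coactL_eq : ∀ u, X.coactL u = LinearMap.rTensor Ω X.proj (Δ u)
  coactR_eq : ∀ u, X.coactR u = LinearMap.lTensor Ω X.proj (Δ u)
  coderivation : ∀ u, Δ (X.d u) =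
    LinearMap.rTensor Ω X.d (Δ u) + TensorProduct.map (parity 𝒢) X.d (Δ u)

/-- `(Ω, d)` is strongly bicovariant. -/
def StronglyBicovariant : Prop :=
  ∃ (Δ : Ω →ₗ[k] Ω ⊗[k] Ω) (ε : Ω →ₗ[k] k) (S : Ω →ₗ[k] Ω), X.IsStrong Δ ε S

/-! #### Left-invariant forms -/

/-- The algebra `Λ` of left-invariant forms, `Δ_L η = 1 ⊗ η`. -/
def inv : Subalgebra k Ω :=
  AlgHom.equalizer X.coactL Algebra.TensorProduct.includeRight

theorem mem_inv {u : Ω} : u ∈ X.inv ↔ X.coactL u = 1 ⊗ₜ[k] u := Iff.rfl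

/-- The grading `Λⁿ = Λ ∩ Ωⁿ`. -/
def invGrading (n : ℕ) : Submodule k X.inv := (𝒢 n).comap X.inv.val.toLinearMap

theorem coactL_component (n : ℕ) (u : Ω) :
    X.coactL (GradedAlgebra.proj 𝒢 n u) =
      LinearMap.lTensor A (GradedAlgebra.proj 𝒢 n) (X.coactL u) := by
  induction u using DirectSum.Decomposition.inductionOn 𝒢 with
  | zero => simp
  | add x y hx hy => simp only [map_add, hx, hy]
  | @homogeneous i m =>
    obtain ⟨y, hy⟩ := X.coactL_mem i m m.2
    rw [← hy]
    by_cases h : i = n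
    · subst h
      have h1 : GradedAlgebra.proj 𝒢 i (m : Ω) = m := by
        rw [GradedAlgebra.proj_apply, DirectSum.decompose_of_mem_same 𝒢 m.2]
      have h2 : GradedAlgebra.proj 𝒢 i ∘ₗ (𝒢 i).subtype = (𝒢 i).subtype := by
        ext z
        simp
      rw [h1, ← LinearMap.comp_apply, ← LinearMap.lTensor_comp, h2, hy]
    · have h1 : GradedAlgebra.proj 𝒢 n (m : Ω) = 0 := by
        rw [GradedAlgebra.proj_apply, DirectSum.decompose_of_mem_ne 𝒢 m.2 h]
      have h2 : GradedAlgebra.proj 𝒢 n ∘ₗ (𝒢 i).subtype = 0 := by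
        ext z
        rw [LinearMap.comp_apply, Submodule.subtype_apply, GradedAlgebra.proj_apply,
          DirectSum.decompose_of_mem_ne 𝒢 z.2 h, LinearMap.zero_apply]
      rw [h1, ← LinearMap.comp_apply, ← LinearMap.lTensor_comp, h2]
      simp

theorem component_mem_inv {u : Ω} (hu : u ∈ X.inv) (n : ℕ) :
    ((DirectSum.decompose 𝒢 u n : 𝒢 n) : Ω) ∈ X.inv := by
  have h := X.coactL_component n u
  rw [X.mem_inv.1 hu, LinearMap.lTensor_tmul] at h
  exact X.mem_inv.2 h

instance : SetLike.GradedMonoid X.invGrading where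
  one_mem := SetLike.GradedOne.one_mem (A := 𝒢)
  mul_mem _ _ _ _ hu hv := SetLike.GradedMul.mul_mem (A := 𝒢) hu hv

theorem invGrading_isInternal : DirectSum.IsInternal X.invGrading := by
  classical
  constructor
  · intro x y h
    have hinj := (DirectSum.Decomposition.isInternal 𝒢).1
    let F : (DirectSum ℕ fun n => X.invGrading n) →+ DirectSum ℕ fun n => 𝒢 n :=
      DirectSum.map fun n => (⟨⟨fun z => ⟨z.1, z.2⟩, rfl⟩, fun _ _ => rfl⟩ : X.invGrading n →+ 𝒢 n)
    have hF : ∀ z, DirectSum.coeAddMonoidHom 𝒢 (F z) =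
        (DirectSum.coeAddMonoidHom X.invGrading z : X.inv) := by
      intro z
      induction z using DirectSum.induction_on with
      | zero => simp
      | of i z => simp [F]
      | add a b ha hb => simp [ha, hb]
    have h1 : F x = F y := hinj (by rw [hF, hF, h])
    have hFi : Function.Injective F :=
      (DirectSum.map_injective _).2 fun n a b hab => by
        have := congrArg (Subtype.val : 𝒢 n → Ω) hab
        exact Subtype.ext (Subtype.ext this)
    exact hFi h1
  · intro η
    refine ⟨∑ n ∈ DFinsupp.support (DirectSum.decompose 𝒢 (η : Ω)),
      DirectSum.of (fun n => X.invGrading n) n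
        ⟨⟨_, X.component_mem_inv η.2 n⟩, (DirectSum.decompose 𝒢 (η : Ω) n).2⟩, ?_⟩
    apply Subtype.ext
    rw [map_sum]
    simp only [DirectSum.coeAddMonoidHom_of, AddSubmonoidClass.coe_finsetSum]
    exact DirectSum.sum_support_decompose 𝒢 (η : Ω)

/-- The homogeneous components of a left-invariant form are left-invariant, so `Λ` is graded. -/
instance : GradedAlgebra X.invGrading := X.invGrading_isInternal.gradedAlgebra

/-- The projection `Ω → Ω`, `m ↦ S(m₋₁) m₀`. -/
def invProjAux : Ω →ₗ[k] Ω :=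
  LinearMap.mul' k Ω ∘ₗ TensorProduct.map (X.incl ∘ₗ antipode k) LinearMap.id ∘ₗ
    X.coactL.toLinearMap

theorem conv_assoc {B : Type*} [Ring B] [Algebra k B] (f f' : A →ₗ[k] B) (g : Ω →ₗ[k] B) (u : Ω) :
    LinearMap.mul' k B (TensorProduct.map f
      (LinearMap.mul' k B ∘ₗ TensorProduct.map f' g ∘ₗ X.coactL.toLinearMap) (X.coactL u)) =
    LinearMap.mul' k B (TensorProduct.map
      (LinearMap.mul' k B ∘ₗ TensorProduct.map f f' ∘ₗ comul (R := k)) g (X.coactL u)) := by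
  have key : LinearMap.mul' k B ∘ₗ TensorProduct.map f (LinearMap.mul' k B ∘ₗ
      TensorProduct.map f' g) ∘ₗ (TensorProduct.assoc k A A Ω).toLinearMap =
      LinearMap.mul' k B ∘ₗ TensorProduct.map (LinearMap.mul' k B ∘ₗ TensorProduct.map f f') g := by
    ext a b w
    simp [mul_assoc]
  have h1 : TensorProduct.map f (LinearMap.mul' k B ∘ₗ TensorProduct.map f' g ∘ₗ
      X.coactL.toLinearMap) = TensorProduct.map f (LinearMap.mul' k B ∘ₗ TensorProduct.map f' g) ∘ₗ
        LinearMap.lTensor A X.coactL.toLinearMap := by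
    rw [LinearMap.map_comp_lTensor, LinearMap.comp_assoc]
  have h2 : TensorProduct.map (LinearMap.mul' k B ∘ₗ TensorProduct.map f f' ∘ₗ comul (R := k)) g =
      TensorProduct.map (LinearMap.mul' k B ∘ₗ TensorProduct.map f f') g ∘ₗ
        LinearMap.rTensor Ω (comul (R := k)) := by
    rw [LinearMap.map_comp_rTensor, LinearMap.comp_assoc]
  rw [h1, h2, LinearMap.comp_apply, ← X.coactL_coassoc, LinearMap.comp_apply]
  exact LinearMap.congr_fun key _

theorem conv_counit {B : Type*} [Ring B] [Algebra k B] (g : Ω →ₗ[k] B) (u : Ω) :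
    LinearMap.mul' k B (TensorProduct.map (Algebra.linearMap k B ∘ₗ counit (R := k) (A := A)) g
      (X.coactL u)) = g u := by
  have h : TensorProduct.map (Algebra.linearMap k B ∘ₗ counit (R := k) (A := A)) g =
      TensorProduct.map (Algebra.linearMap k B) g ∘ₗ LinearMap.rTensor Ω counit := by
    rw [LinearMap.map_comp_rTensor]
  rw [h, LinearMap.comp_apply, X.coactL_counit]
  simp

/-- `u₋₁ (S(u₀₋₁) u₀₀) = u`. -/
theorem incl_conv_invProjAux (u : Ω) :
    LinearMap.mul' k Ω (TensorProduct.map X.incl X.invProjAux (X.coactL u)) = u := by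
  have h : LinearMap.mul' k Ω ∘ₗ TensorProduct.map X.incl (X.incl ∘ₗ antipode k) ∘ₗ
      comul (R := k) = Algebra.linearMap k Ω ∘ₗ counit (R := k) (A := A) := by
    have h1 : LinearMap.mul' k Ω ∘ₗ TensorProduct.map X.incl (X.incl ∘ₗ antipode k) =
        X.incl ∘ₗ LinearMap.mul' k A ∘ₗ LinearMap.lTensor A (antipode k) := by
      ext a b
      simp [X.incl_mul]
    ext a
    have h2 := LinearMap.congr_fun h1 (comul (R := k) a)
    simp only [LinearMap.comp_apply] at h2 ⊢
    rw [h2, HopfAlgebra.mul_antipode_lTensor_comul_apply, Algebra.algebraMap_eq_smul_one,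
      map_smul, X.incl_one, Algebra.linearMap_apply, Algebra.algebraMap_eq_smul_one]
  rw [invProjAux, X.conv_assoc, h, X.conv_counit]
  rfl

theorem invProjAux_mem (u : Ω) : X.invProjAux u ∈ X.inv := by
  rw [mem_inv]
  -- `G(a) = Δ_L(a)` and `F(a) = Δ_L(S(a))`
  let G : A →ₗ[k] A ⊗[k] Ω := X.coactL.toLinearMap ∘ₗ X.incl
  let F : A →ₗ[k] A ⊗[k] Ω := X.coactL.toLinearMap ∘ₗ X.incl ∘ₗ antipode k
  let P : Ω →ₗ[k] A ⊗[k] Ω := TensorProduct.mk k A Ω 1 ∘ₗ X.invProjAux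
  have hG : LinearMap.mul' k (A ⊗[k] Ω) ∘ₗ TensorProduct.map G P ∘ₗ X.coactL.toLinearMap =
      X.coactL.toLinearMap := by
    have h1 : LinearMap.mul' k (A ⊗[k] Ω) ∘ₗ TensorProduct.map (LinearMap.lTensor A X.incl) P =
        LinearMap.lTensor A (LinearMap.mul' k Ω ∘ₗ TensorProduct.map X.incl X.invProjAux) ∘ₗ
          (TensorProduct.assoc k A A Ω).toLinearMap := by
      ext a b w
      simp [P]
    have h2 : TensorProduct.map G P = TensorProduct.map (LinearMap.lTensor A X.incl) P ∘ₗ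
        LinearMap.rTensor Ω (comul (R := k)) := by
      rw [LinearMap.map_comp_rTensor]
      congr 1
      ext a
      exact X.coactL_zero a
    ext w
    have h3 := LinearMap.congr_fun h1 (LinearMap.rTensor Ω (comul (R := k)) (X.coactL w))
    rw [h2]
    simp only [LinearMap.comp_apply, LinearEquiv.coe_coe, AlgHom.toLinearMap_apply] at h3 ⊢
    rw [h3, X.coactL_coassoc, ← LinearMap.comp_apply, ← LinearMap.lTensor_comp]
    have h4 : (LinearMap.mul' k Ω ∘ₗ TensorProduct.map X.incl X.invProjAux) ∘ₗ
        X.coactL.toLinearMap = LinearMap.id := by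
      ext w
      exact X.incl_conv_invProjAux w
    rw [h4, LinearMap.lTensor_id, LinearMap.id_apply]
  have hFG : LinearMap.mul' k (A ⊗[k] Ω) ∘ₗ TensorProduct.map F G ∘ₗ comul (R := k) =
      Algebra.linearMap k (A ⊗[k] Ω) ∘ₗ counit (R := k) (A := A) := by
    have h1 : LinearMap.mul' k (A ⊗[k] Ω) ∘ₗ TensorProduct.map F G =
        X.coactL.toLinearMap ∘ₗ X.incl ∘ₗ LinearMap.mul' k A ∘ₗ
          LinearMap.rTensor A (antipode k) := by
      ext a b
      simp [F, G, X.incl_mul]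
    ext a
    have h2 := LinearMap.congr_fun h1 (comul (R := k) a)
    simp only [LinearMap.comp_apply] at h2 ⊢
    rw [h2, HopfAlgebra.mul_antipode_rTensor_comul_apply, Algebra.algebraMap_eq_smul_one,
      map_smul, X.incl_one, Algebra.linearMap_apply, Algebra.algebraMap_eq_smul_one, map_smul]
    simp
  have hF : X.coactL (X.invProjAux u) =
      LinearMap.mul' k (A ⊗[k] Ω) (TensorProduct.map F X.coactL.toLinearMap (X.coactL u)) := by
    have h1 : X.coactL.toLinearMap ∘ₗ LinearMap.mul' k Ω ∘ₗ
        TensorProduct.map (X.incl ∘ₗ antipode k) LinearMap.id =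
        LinearMap.mul' k (A ⊗[k] Ω) ∘ₗ TensorProduct.map F X.coactL.toLinearMap := by
      ext a w
      simp [F]
    exact LinearMap.congr_fun h1 (X.coactL u)
  have h := X.conv_assoc F G P u
  rw [hG, hFG, X.conv_counit] at h
  rw [hF, h]
  rfl

/-- The projection of `Ω` onto the left-invariant forms, `m ↦ S(m₋₁) m₀`. -/
def invProj : Ω →ₗ[k] X.inv :=
  X.invProjAux.codRestrict (Subalgebra.toSubmodule X.inv) X.invProjAux_mem

/-- The right action `η ◁ a = S(a₁) η a₂` and right coaction `Δ_R` on the left-invariant forms;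
see `coe_act` and `coe_coact`. -/
def invActCoact : ActCoact k A X.inv where
  act := ((LinearMap.mul k Ω).compl₁₂ X.inv.val.toLinearMap X.incl).compr₂ X.invProj
  coact := LinearMap.rTensor A X.invProj ∘ₗ X.coactR.toLinearMap ∘ₗ X.inv.val.toLinearMap

/-- `a ⊗ b ↦ S(a) η b`. -/
def adjoint (η : Ω) : A ⊗[k] A →ₗ[k] Ω :=
  TensorProduct.lift ((LinearMap.mul k Ω).compl₁₂
    (LinearMap.mulRight k η ∘ₗ X.incl ∘ₗ antipode k) X.incl)

theorem adjoint_tmul (η : Ω) (a b : A) :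
    X.adjoint η (a ⊗ₜ b) = X.incl (antipode k a) * η * X.incl b := by
  simp [adjoint]

theorem coe_act (η : X.inv) (a : A) :
    (X.invActCoact.act η a : Ω) = X.adjoint η (comul (R := k) a) := by
  have h : ∀ t : A ⊗[k] A, LinearMap.mul' k Ω (TensorProduct.map (X.incl ∘ₗ antipode k)
      LinearMap.id ((1 : A) ⊗ₜ[k] (η : Ω) * LinearMap.lTensor A X.incl t)) = X.adjoint η t := by
    intro t
    induction t using TensorProduct.induction_on with
    | zero => simp
    | tmul a b => simp [adjoint_tmul, mul_assoc]
    | add x y hx hy => simp only [map_add, mul_add, hx, hy]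
  rw [← h, ← X.mem_inv.1 η.2]
  have h2 : X.coactL (X.incl a) = LinearMap.lTensor A X.incl (comul (R := k) a) :=
    X.coactL_zero a
  rw [← h2, ← map_mul]
  rfl

theorem coe_coact (η : X.inv) :
    LinearMap.rTensor A X.inv.val.toLinearMap (X.invActCoact.coact η) = X.coactR η := by
  have h1 : LinearMap.rTensor A X.inv.val.toLinearMap (X.invActCoact.coact η) =
      LinearMap.rTensor A (LinearMap.mul' k Ω ∘ₗ TensorProduct.map (X.incl ∘ₗ antipode k)
        LinearMap.id) (LinearMap.rTensor A X.coactL.toLinearMap (X.coactR η)) := by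
    have h3 : X.invActCoact.coact η = LinearMap.rTensor A X.invProj (X.coactR η) := rfl
    rw [h3, ← LinearMap.comp_apply (LinearMap.rTensor A _), ← LinearMap.rTensor_comp,
      ← LinearMap.comp_apply (LinearMap.rTensor A _), ← LinearMap.rTensor_comp]
    rfl
  have h2 : LinearMap.rTensor A X.coactL.toLinearMap (X.coactR η) =
      (TensorProduct.assoc k A Ω A).symm (1 ⊗ₜ[k] X.coactR η) := by
    rw [LinearEquiv.eq_symm_apply, X.coact_comm, X.mem_inv.1 η.2]
    simp
  rw [h1, h2]
  generalize X.coactR η = t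
  induction t using TensorProduct.induction_on with
  | zero => simp
  | tmul w a => simp [X.incl_one]
  | add x y hx hy => simp only [TensorProduct.tmul_add, map_add, hx, hy]

/-- The restriction `δ` of `d` to the left-invariant forms. -/
def δ : X.inv →ₗ[k] X.inv :=
  (X.d ∘ₗ X.inv.val.toLinearMap).codRestrict (Subalgebra.toSubmodule X.inv) (fun η =>
    X.mem_inv.2 (by
      have h := X.mem_inv.1 η.2
      simp [X.d_coactL, h]))

/-- The counit projection `π(a) = a - ε(a)` onto the augmentation ideal `A⁺ = ker ε`. -/
def augProj : A →ₗ[k] LinearMap.ker (counit (R := k) (A := A)) :=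
  (LinearMap.id - Algebra.linearMap k A ∘ₗ counit (R := k)).codRestrict _ (fun a => by simp)

/-- The map `ω : A⁺ → Λ`, `ω(a) = S(a₁) d a₂`, with values in `Λ¹`; see `coe_ω`. -/
def ω : LinearMap.ker (counit (R := k) (A := A)) →ₗ[k] X.inv :=
  X.invProj ∘ₗ X.d ∘ₗ X.incl ∘ₗ Submodule.subtype _

theorem coe_ω (a : LinearMap.ker (counit (R := k) (A := A))) :
    (X.ω a : Ω) = LinearMap.mul' k Ω (TensorProduct.map (X.incl ∘ₗ antipode k) (X.d ∘ₗ X.incl)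
      (comul (R := k) (a : A))) := by
  have h1 : X.coactL (X.d (X.incl a)) = LinearMap.lTensor A (X.d ∘ₗ X.incl)
      (comul (R := k) (a : A)) := by
    have h2 : X.coactL (X.incl a) = LinearMap.lTensor A X.incl (comul (R := k) (a : A)) :=
      X.coactL_zero a
    rw [X.d_coactL, h2, ← LinearMap.comp_apply, ← LinearMap.lTensor_comp]
  have h3 : (X.ω a : Ω) = LinearMap.mul' k Ω (TensorProduct.map (X.incl ∘ₗ antipode k)
      LinearMap.id (X.coactL (X.d (X.incl a)))) := rfl
  rw [h3, h1, ← LinearMap.comp_apply (TensorProduct.map _ _), LinearMap.map_comp_lTensor]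
  rfl

/-- `x ⊗ y ↦ (-1)^{|x|} x₀ ⊗ ω(π(x₁)) y`. -/
def ωTwist : X.inv ⊗[k] X.inv →ₗ[k] X.inv ⊗[k] X.inv :=
  LinearMap.lTensor X.inv (LinearMap.mul' k X.inv) ∘ₗ
    (TensorProduct.assoc k X.inv X.inv X.inv).toLinearMap ∘ₗ
    LinearMap.rTensor X.inv
      (LinearMap.lTensor X.inv (X.ω ∘ₗ augProj) ∘ₗ X.invActCoact.coact ∘ₗ parity X.invGrading)

/-- The twisted super-coderivation identity
`Δ(δη) = δη¹ ⊗ η² + (-1)^{|η¹|} η¹ ⊗ δη² + (-1)^{|η¹|} (η¹)₀ ⊗ ω(π((η¹)₁)) η²`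
for a coproduct `Δη = η¹ ⊗ η²` on the left-invariant forms. -/
def TwistedCoderivation (Δ : X.inv →ₗ[k] X.inv ⊗[k] X.inv) : Prop :=
  ∀ η, Δ (X.δ η) = LinearMap.rTensor X.inv X.δ (Δ η) +
    TensorProduct.map (parity X.invGrading) X.δ (Δ η) + X.ωTwist (Δ η)

end BicovariantDGA

end Bicovariant

end StrongBicov

end

/-! The theorem is the Radford–Majid correspondence between Hopf algebras projecting onto `A` and
braided Hopf algebras in crossed modules, in a super version that also tracks the differential.

Write P(u) = S(u₋₁)u₀ for the projection `invProj` onto Λ and Π for `proj`. The formula u = u₋₁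
P(u₀) identifies Ω with A ⊗ Λ, so a linear map on Ω is determined by its values on products aη
(`hom_congr`). The relation ηa = a₁(η ◁ a₂) (`conv_incl_act`) moves A to the left of Λ. From these
two facts Λ is a crossed module whose product is a morphism, for every bicovariant Ω.

Everything else passes through one map, j = `crossMap` : Λ ⊗ Λ → Ω ⊗ Ω, j(x ⊗ y) = x₀ ⊗ x₁y. It is
split by P ⊗ P. It takes the braided-super product to the super product (`superMul_crossMap`),
because moving 1 ⊗ y past x₀ ⊗ x₁ produces y ◁ x₁. It takes the twisted operator of condition 2 to d
⊗ id + (-1)^{| |} ⊗ d (`dTensor_crossMap`): when d hits x₁y in the second leg, d(x₁) = x₁ ω(π(x₂))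
appears, and this is the extra term. It is also compatible with the actions
(`crossMap_mul_comulIncl`), with the coactions (`lTensor_coactR_crossMap`), and, through the
threefold analogue `crossMap₃`, with iterated coproducts. The two coproducts are related by Δ(aη) =
Δ(a) j(Δ'η), and since j is injective each axiom can be carried across.

From Ω to Λ, put Δ' = (P ⊗ P)Δ; the point is that Δη = j(Δ'η) (`IsStrong.comul_inv`). The braided
antipode is x ↦ S(x₀)x₁. Its invariance is not visible from the formula: it follows from uniqueness
of convolution inverses, after S(au) = S(u)S(a) has been derived.

From Λ to Ω, Δ' and the structure of A define the bosonisation. The Hopf axioms are checked on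
products aη. For the coderivation property one also needs Δ(da), which is forced by the coactions
because da has degree 1 (`bosonComul_d_incl`); the Leibniz rule then gives d(aη). -/

open scoped TensorProduct
open HopfAlgebra (antipode)
open Coalgebra (comul counit)

noncomputable section

namespace StrongBicov

/-! ### Convolution along a linear map `τ : U → V ⊗ W` -/

section Conv

variable {k : Type*} [Field k]
variable {U U' V V' W W' M N : Type*} [AddCommGroup U] [Module k U] [AddCommGroup U'] [Module k U']
  [AddCommGroup V] [Module k V] [AddCommGroup V'] [Module k V'] [AddCommGroup W] [Module k W]
  [AddCommGroup W'] [Module k W']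
  [Ring M] [Algebra k M] [Ring N] [Algebra k N]

/-- The convolution `u ↦ p(u₁) q(u₂)`, where `τ(u) = u₁ ⊗ u₂`. -/
def conv (τ : U →ₗ[k] V ⊗[k] W) (p : V →ₗ[k] M) (q : W →ₗ[k] M) : U →ₗ[k] M :=
  LinearMap.mul' k M ∘ₗ TensorProduct.map p q ∘ₗ τ

theorem conv_apply (τ : U →ₗ[k] V ⊗[k] W) (p : V →ₗ[k] M) (q : W →ₗ[k] M) (u : U) :
    conv τ p q u = LinearMap.mul' k M (TensorProduct.map p q (τ u)) := rfl

/-- Two linear maps on a tensor product that agree on pure tensors agree. -/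
theorem tensor_congr {N : Type*} [AddCommGroup N] [Module k N] {f g : V ⊗[k] W →ₗ[k] N}
    (h : ∀ v w, f (v ⊗ₜ w) = g (v ⊗ₜ w)) (t : V ⊗[k] W) : f t = g t :=
  LinearMap.congr_fun (TensorProduct.ext' h) t

/-- Four unrelated maps are allowed so that one statement serves a coproduct (all four equal) and a
right coaction (τ₁, τ₂, τ₄ the coaction, τ₃ the coproduct of `A`). The hypothesis is needed only at
the given point. -/
theorem conv_coassoc {τ₁ : U' →ₗ[k] V ⊗[k] W'} {τ₂ : U →ₗ[k] U' ⊗[k] W}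
    {τ₃ : V' →ₗ[k] W' ⊗[k] W} {τ₄ : U →ₗ[k] V ⊗[k] V'} (p : V →ₗ[k] M) (q : W' →ₗ[k] M)
    (r : W →ₗ[k] M) {u : U}
    (h : TensorProduct.assoc k V W' W (LinearMap.rTensor W τ₁ (τ₂ u)) =
      LinearMap.lTensor V τ₃ (τ₄ u)) :
    conv τ₂ (conv τ₁ p q) r u = conv τ₄ p (conv τ₃ q r) u := by
  have h1 : ∀ t, LinearMap.mul' k M (TensorProduct.map (conv τ₁ p q) r t) =
      LinearMap.mul' k M (TensorProduct.map p (LinearMap.mul' k M ∘ₗ TensorProduct.map q r)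
        (TensorProduct.assoc k V W' W (LinearMap.rTensor W τ₁ t))) := by
    refine tensor_congr (f := LinearMap.mul' k M ∘ₗ TensorProduct.map (conv τ₁ p q) r)
      (g := LinearMap.mul' k M ∘ₗ TensorProduct.map p (LinearMap.mul' k M ∘ₗ
        TensorProduct.map q r) ∘ₗ (TensorProduct.assoc k V W' W).toLinearMap ∘ₗ
          LinearMap.rTensor W τ₁) ?_
    intro x w
    simp only [LinearMap.comp_apply, TensorProduct.map_tmul, conv_apply, LinearMap.rTensor_tmul,
      LinearEquiv.coe_coe, LinearMap.mul'_apply]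
    generalize τ₁ x = s
    induction s using TensorProduct.induction_on with
    | zero => simp
    | tmul a b => simp [mul_assoc]
    | add a b ha hb => simp only [map_add, add_mul, TensorProduct.add_tmul, ha, hb]
  rw [conv_apply, h1, h, ← LinearMap.comp_apply (TensorProduct.map _ _),
    LinearMap.map_comp_lTensor]
  rfl

theorem map_conv (φ : M →ₐ[k] N) (τ : U →ₗ[k] V ⊗[k] W) (p : V →ₗ[k] M) (q : W →ₗ[k] M) (u : U) :
    φ (conv τ p q u) = conv τ (φ.toLinearMap ∘ₗ p) (φ.toLinearMap ∘ₗ q) u := by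
  simp only [conv_apply]
  exact tensor_congr (f := φ.toLinearMap ∘ₗ LinearMap.mul' k M ∘ₗ TensorProduct.map p q)
    (g := LinearMap.mul' k N ∘ₗ
      TensorProduct.map (φ.toLinearMap ∘ₗ p) (φ.toLinearMap ∘ₗ q)) (by intro v w; simp) (τ u)

theorem mul_conv (m : M) (τ : U →ₗ[k] V ⊗[k] W) (p : V →ₗ[k] M) (q : W →ₗ[k] M) (u : U) :
    m * conv τ p q u = conv τ (LinearMap.mulLeft k m ∘ₗ p) q u := by
  simp only [conv_apply]
  exact tensor_congr (f := LinearMap.mulLeft k m ∘ₗ LinearMap.mul' k M ∘ₗ TensorProduct.map p q)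
    (g := LinearMap.mul' k M ∘ₗ TensorProduct.map (LinearMap.mulLeft k m ∘ₗ p) q)
    (by intro v w; simp [mul_assoc]) (τ u)

theorem conv_mul (m : M) (τ : U →ₗ[k] V ⊗[k] W) (p : V →ₗ[k] M) (q : W →ₗ[k] M) (u : U) :
    conv τ p q u * m = conv τ p (LinearMap.mulRight k m ∘ₗ q) u := by
  simp only [conv_apply]
  exact tensor_congr (f := LinearMap.mulRight k m ∘ₗ LinearMap.mul' k M ∘ₗ TensorProduct.map p q)
    (g := LinearMap.mul' k M ∘ₗ TensorProduct.map p (LinearMap.mulRight k m ∘ₗ q))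
    (by intro v w; simp [mul_assoc]) (τ u)

theorem conv_mul_mid (m : M) (τ : U →ₗ[k] V ⊗[k] W) (p : V →ₗ[k] M) (q : W →ₗ[k] M) (u : U) :
    conv τ (LinearMap.mulRight k m ∘ₗ p) q u = conv τ p (LinearMap.mulLeft k m ∘ₗ q) u := by
  simp only [conv_apply]
  exact tensor_congr
    (f := LinearMap.mul' k M ∘ₗ TensorProduct.map (LinearMap.mulRight k m ∘ₗ p) q)
    (g := LinearMap.mul' k M ∘ₗ TensorProduct.map p (LinearMap.mulLeft k m ∘ₗ q))
    (by intro v w; simp [mul_assoc]) (τ u)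

theorem conv_counit_left {τ : U →ₗ[k] V ⊗[k] U} {e : V →ₗ[k] k} {u : U}
    (h : LinearMap.rTensor U e (τ u) = 1 ⊗ₜ u) (q : U →ₗ[k] M) :
    conv τ (Algebra.linearMap k M ∘ₗ e) q u = q u := by
  have h1 : TensorProduct.map (Algebra.linearMap k M ∘ₗ e) q =
      TensorProduct.map (Algebra.linearMap k M) q ∘ₗ LinearMap.rTensor U e := by
    rw [LinearMap.map_comp_rTensor]
  rw [conv_apply, h1, LinearMap.comp_apply, h]
  simp

theorem conv_counit_right {τ : U →ₗ[k] U ⊗[k] V} {e : V →ₗ[k] k} {u : U}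
    (h : LinearMap.lTensor U e (τ u) = u ⊗ₜ 1) (p : U →ₗ[k] M) :
    conv τ p (Algebra.linearMap k M ∘ₗ e) u = p u := by
  have h1 : TensorProduct.map p (Algebra.linearMap k M ∘ₗ e) =
      TensorProduct.map p (Algebra.linearMap k M) ∘ₗ LinearMap.lTensor U e := by
    rw [LinearMap.map_comp_lTensor]
  rw [conv_apply, h1, LinearMap.comp_apply, h]
  simp

theorem conv_of_map {τ : U →ₗ[k] V ⊗[k] W} {τ' : U' →ₗ[k] V' ⊗[k] W'} {f : V →ₗ[k] V'}
    {g : W →ₗ[k] W'} {u : U} {u' : U'} (h : τ' u' = TensorProduct.map f g (τ u))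
    (p : V' →ₗ[k] M) (q : W' →ₗ[k] M) : conv τ' p q u' = conv τ (p ∘ₗ f) (q ∘ₗ g) u := by
  rw [conv_apply, h, ← LinearMap.comp_apply (TensorProduct.map p q), ← TensorProduct.map_comp]
  rfl

/-- If `l` is a left and `r` a right convolution inverse of `m`, then `l = r`. -/
theorem conv_left_inv_eq_right_inv {τ : U →ₗ[k] U ⊗[k] U} {e : U →ₗ[k] k}
    (hassoc : ∀ u, TensorProduct.assoc k U U U (LinearMap.rTensor U τ (τ u)) =
      LinearMap.lTensor U τ (τ u))
    (hleft : ∀ u, LinearMap.rTensor U e (τ u) = 1 ⊗ₜ u)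
    (hright : ∀ u, LinearMap.lTensor U e (τ u) = u ⊗ₜ 1)
    {l m r : U →ₗ[k] M} (hl : ∀ u, conv τ l m u = algebraMap k M (e u))
    (hr : ∀ u, conv τ m r u = algebraMap k M (e u)) : l = r := by
  have hl' : conv τ l m = Algebra.linearMap k M ∘ₗ e := LinearMap.ext hl
  have hr' : conv τ m r = Algebra.linearMap k M ∘ₗ e := LinearMap.ext hr
  ext u
  -- The two bracketings of l * m * r: one collapses to r, the other to l.
  have h := conv_coassoc l m r (hassoc u)
  rwa [hl', hr', conv_counit_left (hleft u), conv_counit_right (hright u), eq_comm] at h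

/-! ### Convolution of linear maps on the Hopf algebra `A` -/

section HopfConv

variable {A : Type*} [Ring A] [HopfAlgebra k A]

theorem comul_conv_assoc (p q r : A →ₗ[k] M) :
    conv (comul (R := k)) (conv (comul (R := k)) p q) r =
      conv (comul (R := k)) p (conv (comul (R := k)) q r) :=
  LinearMap.ext fun a => conv_coassoc p q r (Coalgebra.coassoc_apply a)

theorem comul_conv_counit_left (q : A →ₗ[k] M) :
    conv (comul (R := k)) (Algebra.linearMap k M ∘ₗ counit (R := k) (A := A)) q = q :=
  LinearMap.ext fun a => conv_counit_left (Coalgebra.rTensor_counit_comul a) q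

theorem comul_conv_counit_right (q : A →ₗ[k] M) :
    conv (comul (R := k)) q (Algebra.linearMap k M ∘ₗ counit (R := k) (A := A)) = q :=
  LinearMap.ext fun a => conv_counit_right (Coalgebra.lTensor_counit_comul a) q

theorem conv_antipode_left (φ : A →ₐ[k] M) :
    conv (comul (R := k)) (φ.toLinearMap ∘ₗ antipode k) φ.toLinearMap =
      Algebra.linearMap k M ∘ₗ counit (R := k) (A := A) := by
  ext a
  have h := map_conv φ (comul (R := k)) (antipode k) LinearMap.id a
  rw [LinearMap.comp_id] at h
  rw [← h, conv_apply]
  have h2 := HopfAlgebra.mul_antipode_rTensor_comul_apply (R := k) a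
  rw [LinearMap.rTensor] at h2
  rw [h2]
  simp

theorem conv_antipode_right (φ : A →ₐ[k] M) :
    conv (comul (R := k)) φ.toLinearMap (φ.toLinearMap ∘ₗ antipode k) =
      Algebra.linearMap k M ∘ₗ counit (R := k) (A := A) := by
  ext a
  have h := map_conv φ (comul (R := k)) LinearMap.id (antipode k) a
  rw [LinearMap.comp_id] at h
  rw [← h, conv_apply]
  have h2 := HopfAlgebra.mul_antipode_lTensor_comul_apply (R := k) a
  rw [LinearMap.lTensor] at h2
  rw [h2]
  simp

/-- Convolution by an algebra map is injective. -/
theorem conv_left_cancel (φ : A →ₐ[k] M) {f g : A →ₗ[k] M}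
    (h : conv (comul (R := k)) φ.toLinearMap f = conv (comul (R := k)) φ.toLinearMap g) :
    f = g := by
  -- The convolution inverse of φ is φ ∘ S.
  rw [← comul_conv_counit_left f, ← conv_antipode_left φ, comul_conv_assoc, h, ← comul_conv_assoc,
    conv_antipode_left φ, comul_conv_counit_left g]

end HopfConv

end Conv

namespace BicovariantDGA

variable {k A Ω : Type*} [Field k] [Ring A] [HopfAlgebra k A] [Ring Ω] [Algebra k Ω]
variable {𝒢 : ℕ → Submodule k Ω} [GradedAlgebra 𝒢] (X : BicovariantDGA k A 𝒢)

/-! ### The decomposition `Ω = A Λ` -/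

/-- The inclusion `A → Ω` as an algebra map. -/
def inclHom : A →ₐ[k] Ω := AlgHom.ofLinearMap X.incl X.incl_one X.incl_mul

@[simp] theorem inclHom_apply (a : A) : X.inclHom a = X.incl a := rfl

@[simp] theorem inclHom_toLinearMap : X.inclHom.toLinearMap = X.incl := rfl

theorem incl_mem (a : A) : X.incl a ∈ 𝒢 0 := (X.zeroEquiv a).2

theorem coactL_incl (a : A) :
    X.coactL (X.incl a) = LinearMap.lTensor A X.incl (comul (R := k) a) := X.coactL_zero a

theorem coactR_incl (a : A) :
    X.coactR (X.incl a) = LinearMap.rTensor A X.incl (comul (R := k) a) := X.coactR_zero a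

theorem coactL_inv (η : X.inv) : X.coactL η = 1 ⊗ₜ[k] (η : Ω) := X.mem_inv.1 η.2

theorem coe_invProj (u : Ω) : (X.invProj u : Ω) = X.invProjAux u := rfl

theorem invProjAux_apply (u : Ω) : X.invProjAux u =
    LinearMap.mul' k Ω (TensorProduct.map (X.incl ∘ₗ antipode k) LinearMap.id (X.coactL u)) := rfl

theorem invProj_inv (η : X.inv) : X.invProj η = η := by
  apply Subtype.ext
  rw [coe_invProj, invProjAux_apply, coactL_inv]
  simp [X.incl_one]

theorem invProj_one : X.invProj 1 = 1 := X.invProj_inv 1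

theorem invProj_mul_inv (u : Ω) (η : X.inv) : X.invProj (u * η) = X.invProj u * η := by
  apply Subtype.ext
  rw [Subalgebra.coe_mul, coe_invProj, coe_invProj, invProjAux_apply, invProjAux_apply, map_mul,
    coactL_inv]
  exact tensor_congr (f := LinearMap.mul' k Ω ∘ₗ
      TensorProduct.map (X.incl ∘ₗ antipode k) LinearMap.id ∘ₗ LinearMap.mulRight k (1 ⊗ₜ (η : Ω)))
    (g := LinearMap.mulRight k (η : Ω) ∘ₗ LinearMap.mul' k Ω ∘ₗ
      TensorProduct.map (X.incl ∘ₗ antipode k) LinearMap.id) (by intro a w; simp [mul_assoc]) _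

/-- S(a₁u₋₁) a₂u₀ = S(u₋₁) S(a₁)a₂ u₀, and S(a₁)a₂ = ε(a). -/
theorem invProj_incl_mul (a : A) (u : Ω) :
    X.invProj (X.incl a * u) = counit (R := k) a • X.invProj u := by
  apply Subtype.ext
  rw [Subalgebra.coe_smul, coe_invProj, coe_invProj, invProjAux_apply, invProjAux_apply, map_mul,
    coactL_incl]
  have h := LinearMap.congr_fun (conv_antipode_left X.inclHom) a
  rw [conv_apply] at h
  simp only [LinearMap.comp_apply, Algebra.linearMap_apply, inclHom_toLinearMap] at h
  -- The coaction of u is frozen at b ⊗ w; since S reverses products, the two parts of a become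
  -- adjacent.
  have h1 : ∀ (b : A) (w : Ω) (t : A ⊗[k] A), LinearMap.mul' k Ω (TensorProduct.map
      (X.incl ∘ₗ antipode k) LinearMap.id (LinearMap.lTensor A X.incl t * b ⊗ₜ w)) =
      X.incl (antipode k b) * LinearMap.mul' k Ω (TensorProduct.map (X.incl ∘ₗ antipode k)
        X.incl t) * w := by
    intro b w
    exact tensor_congr (f := LinearMap.mul' k Ω ∘ₗ TensorProduct.map
        (X.incl ∘ₗ antipode k) LinearMap.id ∘ₗ LinearMap.mulRight k (b ⊗ₜ w) ∘ₗ
          LinearMap.lTensor A X.incl)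
      (g := LinearMap.mulRight k w ∘ₗ LinearMap.mulLeft k (X.incl (antipode k b)) ∘ₗ
        LinearMap.mul' k Ω ∘ₗ TensorProduct.map (X.incl ∘ₗ antipode k) X.incl)
      (by intro c d; simp [HopfAlgebra.antipode_mul_antidistrib, X.incl_mul, mul_assoc])
  refine tensor_congr (f := LinearMap.mul' k Ω ∘ₗ TensorProduct.map (X.incl ∘ₗ antipode k)
      LinearMap.id ∘ₗ LinearMap.mulLeft k (LinearMap.lTensor A X.incl (comul (R := k) a)))
    (g := counit (R := k) a • (LinearMap.mul' k Ω ∘ₗ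
      TensorProduct.map (X.incl ∘ₗ antipode k) LinearMap.id)) ?_ _
  intro b w
  simp only [LinearMap.comp_apply, LinearMap.mulLeft_apply, h1, LinearMap.smul_apply]
  rw [h, ← Algebra.commutes, mul_assoc, ← Algebra.smul_def]
  simp

theorem invProj_incl (a : A) : X.invProj (X.incl a) = counit (R := k) a • 1 := by
  rw [← mul_one (X.incl a), invProj_incl_mul, invProj_one]

/-- `u = u₋₁ P(u₀)` for the projection `P` to the left-invariant forms. -/
theorem incl_mul_invProj (u : Ω) :
    conv X.coactL.toLinearMap X.incl (X.inv.val.toLinearMap ∘ₗ X.invProj) u = u :=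
  X.incl_conv_invProjAux u

/-- Linear maps on `Ω` agree if they agree on products `a η` with `a ∈ A` and `η ∈ Λ`. -/
theorem hom_congr {N : Type*} [AddCommGroup N] [Module k N] {f g : Ω →ₗ[k] N}
    (h : ∀ (a : A) (η : X.inv), f (X.incl a * η) = g (X.incl a * η)) (u : Ω) : f u = g u := by
  rw [← X.incl_mul_invProj u, conv_apply]
  exact tensor_congr (f := f ∘ₗ LinearMap.mul' k Ω ∘ₗ
      TensorProduct.map X.incl (X.inv.val.toLinearMap ∘ₗ X.invProj))
    (g := g ∘ₗ LinearMap.mul' k Ω ∘ₗ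
      TensorProduct.map X.incl (X.inv.val.toLinearMap ∘ₗ X.invProj))
    (fun a w => by simpa using h a (X.invProj w)) _

/-- For u = aη both sides are ε(a) P(ηv). This is what makes ◁ associative. -/
theorem invProj_mul (u v : Ω) : X.invProj (u * v) = X.invProj (X.invProj u * v) := by
  refine X.hom_congr (f := X.invProj ∘ₗ LinearMap.mulRight k v)
    (g := X.invProj ∘ₗ LinearMap.mulRight k v ∘ₗ X.inv.val.toLinearMap ∘ₗ X.invProj) ?_ u
  intro a η
  simp [mul_assoc, invProj_incl_mul, invProj_inv]

/-- a₁ ⊗ P(a₂η) = a₁ ⊗ ε(a₂)η. Together with `incl_mul_invProj` this shows that multiplication A ⊗ Λ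
→ Ω is bijective, the fundamental theorem of Hopf modules for Ω. -/
theorem lTensor_invProj_coactL (a : A) (η : X.inv) :
    LinearMap.lTensor A X.invProj (X.coactL (X.incl a * η)) = a ⊗ₜ η := by
  rw [map_mul, coactL_incl, coactL_inv]
  have h := Coalgebra.lTensor_counit_comul (R := k) a
  have h1 := tensor_congr (f := LinearMap.lTensor A X.invProj ∘ₗ
      LinearMap.mulRight k (1 ⊗ₜ (η : Ω)) ∘ₗ LinearMap.lTensor A X.incl)
    (g := LinearMap.lTensor A ((LinearMap.lsmul k X.inv).flip η) ∘ₗ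
      LinearMap.lTensor A (counit (R := k) (A := A)))
    (by intro b c; simp [invProj_incl_mul, invProj_inv]) (comul (R := k) a)
  simp only [LinearMap.comp_apply, h] at h1
  simpa using h1

/-- A linear map on `Ω` of the form `u ↦ p(u₋₁) q(P(u₀))` maps `a η` to `p(a) q(η)`. -/
theorem conv_coactL_incl_mul {M : Type*} [Ring M] [Algebra k M] (p : A →ₗ[k] M)
    (q : X.inv →ₗ[k] M) (a : A) (η : X.inv) :
    conv X.coactL.toLinearMap p (q ∘ₗ X.invProj) (X.incl a * η) = p a * q η := by
  rw [conv_apply, AlgHom.toLinearMap_apply, ← LinearMap.map_comp_lTensor, LinearMap.comp_apply,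
    lTensor_invProj_coactL]
  simp

/-! ### The crossed module of left-invariant forms -/

theorem act_def (η : X.inv) (a : A) : X.invActCoact.act η a = X.invProj (η * X.incl a) := rfl

theorem coact_def (η : X.inv) : X.invActCoact.coact η = LinearMap.rTensor A X.invProj (X.coactR η) :=
  rfl

theorem coactR_inv (η : X.inv) :
    X.coactR η = LinearMap.rTensor A X.inv.val.toLinearMap (X.invActCoact.coact η) :=
  (X.coe_coact η).symm

/-- `η a = a₁ (η ◁ a₂)`. -/
theorem conv_incl_act (η : X.inv) (a : A) :
    conv (comul (R := k)) X.incl (X.inv.val.toLinearMap ∘ₗ X.invActCoact.act η) a =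
      η * X.incl a := by
  have h : X.coactL.toLinearMap (η * X.incl a) =
      TensorProduct.map LinearMap.id (LinearMap.mulLeft k (η : Ω) ∘ₗ X.incl) (comul a) := by
    rw [AlgHom.toLinearMap_apply, map_mul, coactL_inv, coactL_incl]
    exact tensor_congr (f := LinearMap.mulLeft k (1 ⊗ₜ (η : Ω)) ∘ₗ LinearMap.lTensor A X.incl)
      (g := TensorProduct.map LinearMap.id (LinearMap.mulLeft k (η : Ω) ∘ₗ X.incl))
      (by intro b c; simp) _
  have h2 := X.incl_mul_invProj (η * X.incl a)
  rw [conv_of_map h, LinearMap.comp_id] at h2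
  exact h2

theorem act_one (η : X.inv) : X.invActCoact.act η 1 = η := by
  rw [act_def, X.incl_one, mul_one, invProj_inv]

theorem act_mul (η : X.inv) (a b : A) :
    X.invActCoact.act η (a * b) = X.invActCoact.act (X.invActCoact.act η a) b := by
  simp only [act_def]
  rw [X.incl_mul, ← mul_assoc, invProj_mul]

/-- P splits the inclusion of Λ, so identities in Λ ⊗ N may be tested in Ω ⊗ N. -/
theorem rTensor_val_injective (N : Type*) [AddCommGroup N] [Module k N] :
    Function.Injective (LinearMap.rTensor N X.inv.val.toLinearMap) := by
  refine Function.LeftInverse.injective (g := LinearMap.rTensor N X.invProj) fun t => ?_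
  exact tensor_congr (f := LinearMap.rTensor N X.invProj ∘ₗ
      LinearMap.rTensor N X.inv.val.toLinearMap) (g := LinearMap.id)
    (by intro x n; simp [invProj_inv]) t

theorem coact_coassoc (η : X.inv) :
    TensorProduct.assoc k X.inv A A
      (LinearMap.rTensor A X.invActCoact.coact (X.invActCoact.coact η)) =
      LinearMap.lTensor X.inv (comul (R := k)) (X.invActCoact.coact η) := by
  apply X.rTensor_val_injective
  have h := X.coactR_coassoc η
  rw [coactR_inv] at h
  have h1 := tensor_congr (f := (TensorProduct.assoc k Ω A A).toLinearMap ∘ₗ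
      LinearMap.rTensor A X.coactR.toLinearMap ∘ₗ LinearMap.rTensor A X.inv.val.toLinearMap)
    (g := LinearMap.rTensor (A ⊗[k] A) X.inv.val.toLinearMap ∘ₗ
      (TensorProduct.assoc k X.inv A A).toLinearMap ∘ₗ LinearMap.rTensor A X.invActCoact.coact)
    (by
      intro x a
      simp only [LinearMap.comp_apply, LinearMap.rTensor_tmul, AlgHom.toLinearMap_apply,
        Subalgebra.coe_val, coactR_inv, LinearEquiv.coe_coe]
      exact tensor_congr (f := (TensorProduct.assoc k Ω A A).toLinearMap ∘ₗ
          (TensorProduct.mk k (Ω ⊗[k] A) A).flip a ∘ₗ LinearMap.rTensor A X.inv.val.toLinearMap)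
        (g := LinearMap.rTensor (A ⊗[k] A) X.inv.val.toLinearMap ∘ₗ
          (TensorProduct.assoc k X.inv A A).toLinearMap ∘ₗ
            (TensorProduct.mk k (X.inv ⊗[k] A) A).flip a)
        (by intro y b; simp) _) (X.invActCoact.coact η)
  simp only [LinearMap.comp_apply, LinearEquiv.coe_coe] at h1
  rw [← h1, h]
  exact tensor_congr (f := LinearMap.lTensor Ω (comul (R := k)) ∘ₗ
      LinearMap.rTensor A X.inv.val.toLinearMap)
    (g := LinearMap.rTensor (A ⊗[k] A) X.inv.val.toLinearMap ∘ₗ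
      LinearMap.lTensor X.inv (comul (R := k))) (by intro y b; simp) _

theorem coact_counit (η : X.inv) :
    LinearMap.lTensor X.inv (counit (R := k) (A := A)) (X.invActCoact.coact η) = η ⊗ₜ 1 := by
  apply X.rTensor_val_injective
  have h := X.coactR_counit η
  rw [coactR_inv] at h
  rw [LinearMap.rTensor_tmul, AlgHom.toLinearMap_apply, Subalgebra.coe_val, ← h]
  exact tensor_congr (f := LinearMap.rTensor k X.inv.val.toLinearMap ∘ₗ
      LinearMap.lTensor X.inv (counit (R := k) (A := A)))
    (g := LinearMap.lTensor Ω (counit (R := k) (A := A)) ∘ₗ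
      LinearMap.rTensor A X.inv.val.toLinearMap) (by intro y b; simp) _

theorem tensor_act_tmul (x y : X.inv) (a : A) :
    (X.invActCoact.tensor X.invActCoact).act (x ⊗ₜ y) a =
      TensorProduct.map (X.invActCoact.act x) (X.invActCoact.act y) (comul (R := k) a) := by
  simp only [ActCoact.tensor, LinearMap.flip_apply, LinearMap.comp_apply]
  exact tensor_congr (f := LinearMap.applyₗ (x ⊗ₜ[k] y) ∘ₗ
      TensorProduct.homTensorHomMap (RingHom.id k) X.inv X.inv X.inv X.inv ∘ₗ
        TensorProduct.map X.invActCoact.act.flip X.invActCoact.act.flip)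
    (g := TensorProduct.map (X.invActCoact.act x) (X.invActCoact.act y)) (by intro b c; simp) _

/-- P(xya) = P(x a₁ (y ◁ a₂)) = P(x a₁)(y ◁ a₂), because P is right Λ-linear. -/
theorem mul_act (x y : X.inv) (a : A) :
    conv (comul (R := k)) (X.invActCoact.act x) (X.invActCoact.act y) a =
      X.invActCoact.act (x * y) a := by
  rw [act_def, Subalgebra.coe_mul, mul_assoc, ← conv_incl_act, mul_conv, conv_apply, conv_apply]
  exact tensor_congr (f := LinearMap.mul' k X.inv ∘ₗ
      TensorProduct.map (X.invActCoact.act x) (X.invActCoact.act y))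
    (g := X.invProj ∘ₗ LinearMap.mul' k Ω ∘ₗ
      TensorProduct.map (LinearMap.mulLeft k (x : Ω) ∘ₗ X.incl)
        (X.inv.val.toLinearMap ∘ₗ X.invActCoact.act y))
    (by intro b c; simp [invProj_mul_inv, act_def]) _

/-- The product `(x ⊗ a, y ⊗ b) ↦ (x ⊗ y) ⊗ a b`. -/
def coactMul : X.inv ⊗[k] A →ₗ[k] X.inv ⊗[k] A →ₗ[k] (X.inv ⊗[k] X.inv) ⊗[k] A :=
  (TensorProduct.mk k (X.inv ⊗[k] A) (X.inv ⊗[k] A)).compr₂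
    (LinearMap.lTensor (X.inv ⊗[k] X.inv) (LinearMap.mul' k A) ∘ₗ
      (TensorProduct.tensorTensorTensorComm k X.inv A X.inv A).toLinearMap)

theorem coactMul_tmul (x y : X.inv) (a b : A) :
    X.coactMul (x ⊗ₜ a) (y ⊗ₜ b) = (x ⊗ₜ y) ⊗ₜ (a * b) := by
  simp [coactMul]

theorem tensor_coact_tmul (x y : X.inv) :
    (X.invActCoact.tensor X.invActCoact).coact (x ⊗ₜ y) =
      X.coactMul (X.invActCoact.coact x) (X.invActCoact.coact y) := rfl

theorem mul_hom : (X.invActCoact.tensor X.invActCoact).IsHom X.invActCoact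
    (LinearMap.mul' k X.inv) where
  map_act t a := by
    refine tensor_congr (f := LinearMap.mul' k X.inv ∘ₗ
      (X.invActCoact.tensor X.invActCoact).act.flip a)
      (g := X.invActCoact.act.flip a ∘ₗ LinearMap.mul' k X.inv) ?_ t
    intro x y
    simp only [LinearMap.comp_apply, LinearMap.flip_apply, LinearMap.mul'_apply, tensor_act_tmul]
    exact X.mul_act x y a
  map_coact t := by
    refine tensor_congr (f := X.invActCoact.coact ∘ₗ LinearMap.mul' k X.inv)
      (g := LinearMap.rTensor A (LinearMap.mul' k X.inv) ∘ₗ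
        (X.invActCoact.tensor X.invActCoact).coact) ?_ t
    intro x y
    apply X.rTensor_val_injective
    simp only [LinearMap.comp_apply, LinearMap.mul'_apply, tensor_coact_tmul]
    rw [← coactR_inv, Subalgebra.coe_mul, map_mul, coactR_inv, coactR_inv]
    generalize X.invActCoact.coact x = s
    generalize X.invActCoact.coact y = t
    induction s using TensorProduct.induction_on with
    | zero => simp
    | add s s' hs hs' => simp only [map_add, add_mul, LinearMap.add_apply, hs, hs']
    | tmul x a =>
      induction t using TensorProduct.induction_on with
      | zero => simp
      | add s s' hs hs' => simp only [map_add, mul_add, hs, hs']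
      | tmul y b => simp [coactMul_tmul]

theorem one_hom : ActCoact.unit.IsHom X.invActCoact (Algebra.linearMap k X.inv) where
  map_act r a := by
    simp [ActCoact.unit, act_def, Algebra.algebraMap_eq_smul_one, invProj_incl, mul_smul,
      smul_comm r]
  map_coact r := by
    apply X.rTensor_val_injective
    rw [← coactR_inv]
    simp [ActCoact.unit, Algebra.algebraMap_eq_smul_one, TensorProduct.smul_tmul',
      Algebra.TensorProduct.one_def]

/-- `x ⊗ c ↦ (b ↦ (x ◁ b) ⊗ c)`, with values in `Ω ⊗ A`. -/
def actLeft : X.inv ⊗[k] A →ₗ[k] A →ₗ[k] Ω ⊗[k] A :=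
  TensorProduct.lift (LinearMap.mk₂ k
    (fun x c => (TensorProduct.mk k Ω A).flip c ∘ₗ X.inv.val.toLinearMap ∘ₗ X.invActCoact.act x)
    (fun x y c => by ext; simp)
    (fun r x c => by ext; simp [TensorProduct.smul_tmul'])
    (fun x c d => by ext; simp)
    (fun r x c => by ext; simp))

theorem actLeft_tmul (x : X.inv) (c b : A) :
    X.actLeft (x ⊗ₜ c) b = (X.invActCoact.act x b : Ω) ⊗ₜ[k] c := by
  simp [actLeft]

theorem coactR_comp_incl : X.coactR.toLinearMap ∘ₗ X.incl =
    conv (comul (R := k)) (Algebra.TensorProduct.includeLeft.toLinearMap ∘ₗ X.incl)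
      (Algebra.TensorProduct.includeRight : A →ₐ[k] Ω ⊗[k] A).toLinearMap := by
  ext a
  rw [LinearMap.comp_apply, AlgHom.toLinearMap_apply, coactR_incl, conv_apply]
  exact tensor_congr (f := LinearMap.rTensor A X.incl) (g := LinearMap.mul' k (Ω ⊗[k] A) ∘ₗ
    TensorProduct.map (Algebra.TensorProduct.includeLeft.toLinearMap ∘ₗ X.incl)
      (Algebra.TensorProduct.includeRight : A →ₐ[k] Ω ⊗[k] A).toLinearMap)
    (by intro b c; simp) _

theorem conv_incl_actLeft (t : X.inv ⊗[k] A) (a : A) :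
    conv (comul (R := k)) (Algebra.TensorProduct.includeLeft.toLinearMap ∘ₗ X.incl)
      (X.actLeft t) a = LinearMap.rTensor A X.inv.val.toLinearMap t * (X.incl a ⊗ₜ 1) := by
  rw [conv_apply]
  induction t using TensorProduct.induction_on with
  | zero => simp
  | add s t hs ht => simp only [map_add, add_mul, ← hs, ← ht, TensorProduct.map_add_right,
      LinearMap.add_apply]
  | tmul x c =>
    rw [LinearMap.rTensor_tmul, Algebra.TensorProduct.tmul_mul_tmul, mul_one,
      AlgHom.toLinearMap_apply, Subalgebra.coe_val, ← conv_incl_act, conv_apply]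
    exact tensor_congr (f := LinearMap.mul' k (Ω ⊗[k] A) ∘ₗ
        TensorProduct.map (Algebra.TensorProduct.includeLeft.toLinearMap ∘ₗ X.incl)
          (X.actLeft (x ⊗ₜ c)))
      (g := (TensorProduct.mk k Ω A).flip c ∘ₗ LinearMap.mul' k Ω ∘ₗ
        TensorProduct.map X.incl (X.inv.val.toLinearMap ∘ₗ X.invActCoact.act x))
      (by intro b d; simp [actLeft_tmul]) _

/-- Puts the right side of the crossed-module axiom in the form of a triple convolution, the form in
which antipodes can be cancelled. -/
theorem rTensor_val_crossedTwist (t : X.inv ⊗[k] A) (a : A) :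
    LinearMap.rTensor A X.inv.val.toLinearMap (X.invActCoact.crossedTwist
      (LinearMap.lTensor A (comul (R := k)) (comul (R := k) a)) t) =
    conv (comul (R := k))
      ((Algebra.TensorProduct.includeRight : A →ₐ[k] Ω ⊗[k] A).toLinearMap ∘ₗ antipode k)
      (conv (comul (R := k)) (X.actLeft t)
        (Algebra.TensorProduct.includeRight : A →ₐ[k] Ω ⊗[k] A).toLinearMap) a := by
  have h : ∀ (p q r : A →ₗ[k] Ω ⊗[k] A), conv (comul (R := k)) p (conv (comul (R := k)) q r) a =
      LinearMap.mul' k _ (TensorProduct.map p (LinearMap.mul' k _ ∘ₗ TensorProduct.map q r)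
        (LinearMap.lTensor A (comul (R := k)) (comul (R := k) a))) := by
    intro p q r
    rw [← LinearMap.comp_apply (TensorProduct.map _ _), LinearMap.map_comp_lTensor]
    rfl
  rw [h]
  generalize LinearMap.lTensor A (comul (R := k)) (comul (R := k) a) = s
  induction t using TensorProduct.induction_on with
  | zero => simp
  | add s t hs ht => simp only [map_add, hs, ht, TensorProduct.map_add_right,
      TensorProduct.map_add_left, LinearMap.comp_add, LinearMap.add_apply]
  | tmul x c =>
    induction s using TensorProduct.induction_on with
    | zero => simp
    | add s t hs ht => simp only [map_add, hs, ht, LinearMap.add_apply]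
    | tmul a s =>
      induction s using TensorProduct.induction_on with
      | zero => simp
      | add s t hs ht => simp only [map_add, hs, ht, LinearMap.add_apply, TensorProduct.tmul_add]
      | tmul b d => simp [ActCoact.crossedTwist_tmul, actLeft_tmul]

/-- Applying the multiplicative map Δ_R to ηb = b₁(η ◁ b₂) gives Δ_R(η)Δ_R(b) = Δ_R(b₁)Δ_R(η ◁ b₂).
As Δ_R restricted to A is an algebra map, the factor Δ_R(b₁) can be cancelled. -/
theorem coact_act (η : X.inv) (a : A) :
    X.invActCoact.coact (X.invActCoact.act η a) = X.invActCoact.crossedTwist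
      (LinearMap.lTensor A (comul (R := k)) (comul (R := k) a)) (X.invActCoact.coact η) := by
  apply X.rTensor_val_injective
  rw [rTensor_val_crossedTwist, ← coactR_inv]
  have h : X.coactR.toLinearMap ∘ₗ X.inv.val.toLinearMap ∘ₗ X.invActCoact.act η =
      conv (comul (R := k))
        ((Algebra.TensorProduct.includeRight : A →ₐ[k] Ω ⊗[k] A).toLinearMap ∘ₗ antipode k)
        (conv (comul (R := k)) (X.actLeft (X.invActCoact.coact η))
          (Algebra.TensorProduct.includeRight : A →ₐ[k] Ω ⊗[k] A).toLinearMap) := by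
    apply conv_left_cancel (X.coactR.comp X.inclHom)
    rw [AlgHom.comp_toLinearMap, inclHom_toLinearMap]
    have h1 : conv (comul (R := k)) (X.coactR.toLinearMap ∘ₗ X.incl) (X.coactR.toLinearMap ∘ₗ
        X.inv.val.toLinearMap ∘ₗ X.invActCoact.act η) =
        LinearMap.mulLeft k (X.coactR η) ∘ₗ X.coactR.toLinearMap ∘ₗ X.incl := by
      ext b
      rw [← map_conv, conv_incl_act]
      simp
    -- Δ_R(b) = (b₁ ⊗ 1)(1 ⊗ b₂); the factor 1 ⊗ b₂ cancels the antipode of the twist, and b₁ ⊗ 1 is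
    -- absorbed by the action.
    rw [h1, coactR_comp_incl, comul_conv_assoc, ← comul_conv_assoc _ (_ ∘ₗ antipode k),
      conv_antipode_right, comul_conv_counit_left, ← comul_conv_assoc]
    ext b
    have h2 : conv (comul (R := k)) (Algebra.TensorProduct.includeLeft.toLinearMap ∘ₗ X.incl)
        (X.actLeft (X.invActCoact.coact η)) = LinearMap.mulLeft k (X.coactR η) ∘ₗ
          Algebra.TensorProduct.includeLeft.toLinearMap ∘ₗ X.incl := by
      ext b
      rw [conv_incl_actLeft, ← coactR_inv]
      rfl
    rw [h2, ← mul_conv]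
    rfl
  exact LinearMap.congr_fun h a

theorem isCrossedModule : X.invActCoact.IsCrossedModule where
  act_one := X.act_one
  act_mul := X.act_mul
  coassoc := X.coact_coassoc
  counit := X.coact_counit
  crossed := X.coact_act

/-! ### Degrees -/

theorem mem_invGrading {n : ℕ} {η : X.inv} : η ∈ X.invGrading n ↔ (η : Ω) ∈ 𝒢 n := Iff.rfl

theorem invProj_mem {n : ℕ} {u : Ω} (hu : u ∈ 𝒢 n) : X.invProj u ∈ X.invGrading n := by
  rw [mem_invGrading, coe_invProj, invProjAux_apply]
  obtain ⟨t, ht⟩ := X.coactL_mem n u hu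
  rw [← ht]
  clear ht
  induction t using TensorProduct.induction_on with
  | zero => simp
  | add s t hs ht => simpa only [map_add] using add_mem hs ht
  | tmul a w =>
    have := SetLike.mul_mem_graded (A := 𝒢) (X.incl_mem (antipode k a)) w.2
    simpa using this

theorem act_mem {n : ℕ} {η : X.inv} (hη : η ∈ X.invGrading n) (a : A) :
    X.invActCoact.act η a ∈ X.invGrading n := by
  rw [act_def]
  apply invProj_mem
  have := SetLike.mul_mem_graded (A := 𝒢) hη (X.incl_mem a)
  simpa using this

theorem coact_mem {n : ℕ} {η : X.inv} (hη : η ∈ X.invGrading n) :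
    X.invActCoact.coact η ∈ LinearMap.range (LinearMap.rTensor A (X.invGrading n).subtype) := by
  rw [coact_def]
  obtain ⟨t, ht⟩ := X.coactR_mem n η hη
  rw [← ht]
  clear ht
  induction t using TensorProduct.induction_on with
  | zero => simp
  | add s t hs ht => simpa only [map_add] using add_mem hs ht
  | tmul w a => exact ⟨⟨_, X.invProj_mem w.2⟩ ⊗ₜ a, by simp⟩

/-! ### The super tensor product algebra `Ω ⊗ Ω` -/

theorem braidedMul_tmul (B : Ω ⊗[k] Ω →ₗ[k] Ω ⊗[k] Ω) (v v' w w' : Ω) :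
    braidedMul B ((v ⊗ₜ v') ⊗ₜ (w ⊗ₜ w')) =
      TensorProduct.map (LinearMap.mulLeft k v) (LinearMap.mulRight k w') (B (v' ⊗ₜ w)) := by
  simp only [braidedMul, LinearMap.comp_apply, LinearEquiv.coe_coe, TensorProduct.assoc_tmul,
    LinearMap.lTensor_tmul, TensorProduct.assoc_symm_tmul, LinearMap.rTensor_tmul]
  exact tensor_congr
    (f := TensorProduct.map (LinearMap.mul' k Ω) (LinearMap.mul' k Ω) ∘ₗ
      (TensorProduct.assoc k Ω Ω (Ω ⊗[k] Ω)).symm.toLinearMap ∘ₗ TensorProduct.mk k Ω _ v ∘ₗ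
        (TensorProduct.assoc k Ω Ω Ω).toLinearMap ∘ₗ (TensorProduct.mk k (Ω ⊗[k] Ω) Ω).flip w')
    (g := TensorProduct.map (LinearMap.mulLeft k v) (LinearMap.mulRight k w'))
    (by intro x y; simp) _

/-- The product of the super tensor product algebra `Ω ⊗ Ω`. -/
def superMul (𝒢 : ℕ → Submodule k Ω) [GradedAlgebra 𝒢] :
    Ω ⊗[k] Ω →ₗ[k] Ω ⊗[k] Ω →ₗ[k] Ω ⊗[k] Ω :=
  (TensorProduct.mk k (Ω ⊗[k] Ω) (Ω ⊗[k] Ω)).compr₂ (braidedMul (superFlip 𝒢))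

theorem superMul_apply (s t : Ω ⊗[k] Ω) :
    superMul 𝒢 s t = braidedMul (superFlip 𝒢) (s ⊗ₜ t) := rfl

theorem superMul_of_mem {i j : ℕ} {v' w : Ω} (hv : v' ∈ 𝒢 i) (hw : w ∈ 𝒢 j) (v w' : Ω) :
    superMul 𝒢 (v ⊗ₜ v') (w ⊗ₜ w') = ((-1 : k) ^ (i * j)) • ((v * w) ⊗ₜ[k] (v' * w')) := by
  rw [superMul_apply, braidedMul_tmul, superFlip, LinearMap.comp_apply, koszul_of_mem 𝒢 hv hw]
  simp

/-- The sign in (v ⊗ v')(w ⊗ w') sees only v' and w, so only the inner factors have to be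
homogeneous. -/
theorem superMul_congr (𝒢 : ℕ → Submodule k Ω) [GradedAlgebra 𝒢] {N : Type*} [AddCommGroup N]
    [Module k N] {f g : Ω ⊗[k] Ω →ₗ[k] Ω ⊗[k] Ω →ₗ[k] N}
    (h : ∀ i j, ∀ v' ∈ 𝒢 i, ∀ w ∈ 𝒢 j, ∀ v w', f (v ⊗ₜ v') (w ⊗ₜ w') = g (v ⊗ₜ v') (w ⊗ₜ w'))
    (s t : Ω ⊗[k] Ω) : f s t = g s t := by
  induction s using TensorProduct.induction_on with
  | zero => simp
  | add x y hx hy => simp only [map_add, LinearMap.add_apply, hx, hy]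
  | tmul v v' =>
    induction v' using DirectSum.Decomposition.inductionOn 𝒢 with
    | zero => simp
    | add x y hx hy => simp only [TensorProduct.tmul_add, map_add, LinearMap.add_apply, hx, hy]
    | @homogeneous i v' =>
      induction t using TensorProduct.induction_on with
      | zero => simp
      | add x y hx hy => simp only [map_add, hx, hy]
      | tmul w w' =>
        induction w using DirectSum.Decomposition.inductionOn 𝒢 with
        | zero => simp
        | add x y hx hy => simp only [TensorProduct.add_tmul, map_add, hx, hy]
        | @homogeneous j w => exact h i j v' v'.2 w w.2 v w'

/-- The inclusion `A ⊗ A → Ω ⊗ Ω`. -/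
def incl₂ : A ⊗[k] A →ₐ[k] Ω ⊗[k] Ω := Algebra.TensorProduct.map X.inclHom X.inclHom

@[simp] theorem incl₂_tmul (a b : A) : X.incl₂ (a ⊗ₜ b) = X.incl a ⊗ₜ X.incl b := rfl

theorem incl₂_apply (c : A ⊗[k] A) : X.incl₂ c = TensorProduct.map X.incl X.incl c := rfl

/-- Multiplying by elements of A changes no degree and so no sign. -/
theorem superMul_incl₂_mul (c : A ⊗[k] A) (t s : Ω ⊗[k] Ω) :
    superMul 𝒢 (X.incl₂ c * t) s = X.incl₂ c * superMul 𝒢 t s := by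
  induction c using TensorProduct.induction_on with
  | zero => simp
  | add x y hx hy => simp only [map_add, add_mul, LinearMap.add_apply, hx, hy]
  | tmul a b =>
    refine superMul_congr 𝒢 (f := superMul 𝒢 ∘ₗ LinearMap.mulLeft k (X.incl₂ (a ⊗ₜ b)))
      (g := (superMul 𝒢).compr₂ (LinearMap.mulLeft k (X.incl₂ (a ⊗ₜ b)))) ?_ t s
    intro i j v' hv w hw v w'
    have h1 : X.incl b * v' ∈ 𝒢 i := by
      simpa using SetLike.mul_mem_graded (A := 𝒢) (X.incl_mem b) hv
    simp [superMul_of_mem h1 hw, superMul_of_mem hv hw, mul_assoc]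

/-- The super product is balanced over A ⊗ A: a factor Δ(a) may be handed from the left argument to
the right one. -/
theorem superMul_mul_incl₂ (c : A ⊗[k] A) (t s : Ω ⊗[k] Ω) :
    superMul 𝒢 (t * X.incl₂ c) s = superMul 𝒢 t (X.incl₂ c * s) := by
  induction c using TensorProduct.induction_on with
  | zero => simp
  | add x y hx hy => simp only [map_add, add_mul, mul_add, LinearMap.add_apply, hx, hy]
  | tmul a b =>
    refine superMul_congr 𝒢 (f := superMul 𝒢 ∘ₗ LinearMap.mulRight k (X.incl₂ (a ⊗ₜ b)))
      (g := (superMul 𝒢).compl₂ (LinearMap.mulLeft k (X.incl₂ (a ⊗ₜ b)))) ?_ t s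
    intro i j v' hv w hw v w'
    have h1 : v' * X.incl b ∈ 𝒢 i := by
      simpa using SetLike.mul_mem_graded (A := 𝒢) hv (X.incl_mem b)
    have h2 : X.incl a * w ∈ 𝒢 j := by
      simpa using SetLike.mul_mem_graded (A := 𝒢) (X.incl_mem a) hw
    simp [superMul_of_mem h1 hw, superMul_of_mem hv h2, mul_assoc]

theorem superMul_of_left_mem_zero {v : Ω} (hv : v ∈ 𝒢 0) (u : Ω) (t : Ω ⊗[k] Ω) :
    superMul 𝒢 (u ⊗ₜ v) t = u ⊗ₜ v * t := by
  induction t using TensorProduct.induction_on with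
  | zero => simp
  | add x y hx hy => simp only [map_add, mul_add, hx, hy]
  | tmul w w' =>
    induction w using DirectSum.Decomposition.inductionOn 𝒢 with
    | zero => simp
    | add x y hx hy => simp only [TensorProduct.add_tmul, map_add, mul_add, hx, hy]
    | homogeneous w => simp [superMul_of_mem hv w.2]

theorem superMul_one (t : Ω ⊗[k] Ω) : superMul 𝒢 t 1 = t := by
  have h1 : (1 : Ω) ∈ 𝒢 0 := SetLike.GradedOne.one_mem
  induction t using TensorProduct.induction_on with
  | zero => simp
  | add x y hx hy => simp only [map_add, LinearMap.add_apply, hx, hy]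
  | tmul w w' =>
    induction w' using DirectSum.Decomposition.inductionOn 𝒢 with
    | zero => simp
    | add x y hx hy => simp only [TensorProduct.tmul_add, map_add, LinearMap.add_apply, hx, hy]
    | homogeneous w' => simp [Algebra.TensorProduct.one_def, superMul_of_mem w'.2 h1]

/-- Moving a form of degree 1 past w costs (-1)^{|w|}. This case is needed for the term a₁ ⊗ da₂ of
Δ(da). -/
theorem superMul_of_left_mem_one {v : Ω} (hv : v ∈ 𝒢 1) (u : Ω) (t : Ω ⊗[k] Ω) :
    superMul 𝒢 (u ⊗ₜ v) t = u ⊗ₜ v * LinearMap.rTensor Ω (parity 𝒢) t := by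
  induction t using TensorProduct.induction_on with
  | zero => simp
  | add x y hx hy => simp only [map_add, mul_add, hx, hy]
  | tmul w w' =>
    induction w using DirectSum.Decomposition.inductionOn 𝒢 with
    | zero => simp
    | add x y hx hy => simp only [TensorProduct.add_tmul, map_add, mul_add, hx, hy]
    | homogeneous w => simp [superMul_of_mem hv w.2, parity_of_mem 𝒢 w.2, TensorProduct.smul_tmul']

theorem superMul_incl₂ (c : A ⊗[k] A) (t : Ω ⊗[k] Ω) :
    superMul 𝒢 (X.incl₂ c) t = X.incl₂ c * t := by
  have h := X.superMul_incl₂_mul (𝒢 := 𝒢) c 1 t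
  rwa [mul_one, Algebra.TensorProduct.one_def,
    superMul_of_left_mem_zero (SetLike.GradedOne.one_mem (A := 𝒢)),
    ← Algebra.TensorProduct.one_def, one_mul] at h

/-! ### The embedding `Λ ⊗ Λ → Ω ⊗ Ω` -/

/-- The coproduct of `A` with values in `Ω ⊗ Ω`. -/
def comulIncl : A →ₐ[k] Ω ⊗[k] Ω := X.incl₂.comp (Bialgebra.comulAlgHom k A)

theorem comulIncl_apply (a : A) : X.comulIncl a = X.incl₂ (comul (R := k) a) := rfl

/-- The right coaction with values in `Ω ⊗ Ω`. -/
def coactIncl : Ω →ₐ[k] Ω ⊗[k] Ω :=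
  (Algebra.TensorProduct.map (AlgHom.id k Ω) X.inclHom).comp X.coactR

theorem coactIncl_apply (u : Ω) : X.coactIncl u = LinearMap.lTensor Ω X.incl (X.coactR u) := rfl

theorem coactIncl_incl (a : A) : X.coactIncl (X.incl a) = X.comulIncl a := by
  rw [coactIncl_apply, coactR_incl, ← LinearMap.comp_apply, LinearMap.lTensor_comp_rTensor]
  rfl

/-- The map `x ⊗ y ↦ x₀ ⊗ x₁ y`. -/
def crossMap : X.inv ⊗[k] X.inv →ₗ[k] Ω ⊗[k] Ω :=
  TensorProduct.lift ((LinearMap.mul k (Ω ⊗[k] Ω)).compl₁₂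
    (X.coactIncl.toLinearMap ∘ₗ X.inv.val.toLinearMap)
    (Algebra.TensorProduct.includeRight.toLinearMap ∘ₗ X.inv.val.toLinearMap))

theorem crossMap_tmul (x y : X.inv) :
    X.crossMap (x ⊗ₜ y) = X.coactIncl x * 1 ⊗ₜ[k] (y : Ω) := by
  simp [crossMap]

theorem coactIncl_inv (x : X.inv) : X.coactIncl x =
    TensorProduct.map X.inv.val.toLinearMap X.incl (X.invActCoact.coact x) := by
  rw [coactIncl_apply, coactR_inv, ← LinearMap.comp_apply, LinearMap.lTensor_comp_rTensor]

/-- P(x₀) ⊗ P(x₁y) = x₀ ⊗ ε(x₁)y = x ⊗ y. Hence identities in Λ ⊗ Λ may be tested in Ω ⊗ Ω after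
applying j. -/
theorem map_invProj_crossMap (t : X.inv ⊗[k] X.inv) :
    TensorProduct.map X.invProj X.invProj (X.crossMap t) = t := by
  refine tensor_congr (f := TensorProduct.map X.invProj X.invProj ∘ₗ X.crossMap)
    (g := LinearMap.id) ?_ t
  intro x y
  rw [LinearMap.comp_apply, crossMap_tmul, coactIncl_inv]
  have h := tensor_congr (f := TensorProduct.map X.invProj X.invProj ∘ₗ
      LinearMap.mulRight k (1 ⊗ₜ (y : Ω)) ∘ₗ TensorProduct.map X.inv.val.toLinearMap X.incl)
    (g := LinearMap.lTensor X.inv ((LinearMap.lsmul k X.inv).flip y) ∘ₗ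
      LinearMap.lTensor X.inv (counit (R := k) (A := A)))
    (by intro z a; simp [invProj_inv, invProj_incl_mul]) (X.invActCoact.coact x)
  simp only [LinearMap.comp_apply, coact_counit] at h
  simpa using h

theorem crossMap_injective : Function.Injective X.crossMap :=
  Function.LeftInverse.injective X.map_invProj_crossMap

/-- Separates the legs as (a₁ ⊗ 1)(1 ⊗ a₂), so that `conv_coassoc` and `comul_conv_assoc` can
regroup the second leg. -/
theorem comulIncl_eq_conv : X.comulIncl.toLinearMap = conv (comul (R := k))
    (Algebra.TensorProduct.includeLeft.toLinearMap ∘ₗ X.incl)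
    ((Algebra.TensorProduct.includeRight : Ω →ₐ[k] Ω ⊗[k] Ω).toLinearMap ∘ₗ X.incl) := by
  ext a
  exact tensor_congr (f := X.incl₂.toLinearMap) (g := LinearMap.mul' k (Ω ⊗[k] Ω) ∘ₗ
    TensorProduct.map (Algebra.TensorProduct.includeLeft.toLinearMap ∘ₗ X.incl)
      ((Algebra.TensorProduct.includeRight : Ω →ₐ[k] Ω ⊗[k] Ω).toLinearMap ∘ₗ X.incl))
    (by intro b c; simp) (comul (R := k) a)

theorem coactIncl_inv_eq_conv : X.coactIncl.toLinearMap ∘ₗ X.inv.val.toLinearMap =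
    conv X.invActCoact.coact
      (Algebra.TensorProduct.includeLeft.toLinearMap ∘ₗ X.inv.val.toLinearMap)
      ((Algebra.TensorProduct.includeRight : Ω →ₐ[k] Ω ⊗[k] Ω).toLinearMap ∘ₗ X.incl) := by
  ext x
  rw [LinearMap.comp_apply, AlgHom.toLinearMap_apply, AlgHom.toLinearMap_apply, Subalgebra.coe_val,
    coactIncl_inv]
  exact tensor_congr (f := TensorProduct.map X.inv.val.toLinearMap X.incl)
    (g := LinearMap.mul' k (Ω ⊗[k] Ω) ∘ₗ
      TensorProduct.map (Algebra.TensorProduct.includeLeft.toLinearMap ∘ₗ X.inv.val.toLinearMap)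
      ((Algebra.TensorProduct.includeRight : Ω →ₐ[k] Ω ⊗[k] Ω).toLinearMap ∘ₗ X.incl))
    (by intro b c; simp) (X.invActCoact.coact x)

/-- The map `a ↦ 1 ⊗ (y ◁ a)`. -/
def actRight (y : X.inv) : A →ₗ[k] Ω ⊗[k] Ω :=
  Algebra.TensorProduct.includeRight.toLinearMap ∘ₗ X.inv.val.toLinearMap ∘ₗ X.invActCoact.act y

theorem conv_incl_actRight (y : X.inv) : conv (comul (R := k))
    ((Algebra.TensorProduct.includeRight : Ω →ₐ[k] Ω ⊗[k] Ω).toLinearMap ∘ₗ X.incl)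
      (X.actRight y) = LinearMap.mulLeft k (1 ⊗ₜ (y : Ω)) ∘ₗ
        (Algebra.TensorProduct.includeRight : Ω →ₐ[k] Ω ⊗[k] Ω).toLinearMap ∘ₗ X.incl := by
  ext a
  rw [actRight, ← map_conv, conv_incl_act]
  simp

/-- `(1 ⊗ y)(x₀ ⊗ x₁) = x₀ ⊗ x₁ (y ◁ x₂)`. -/
theorem one_tmul_mul_coactIncl (x y : X.inv) : 1 ⊗ₜ[k] (y : Ω) * X.coactIncl x =
    conv X.invActCoact.coact (X.coactIncl.toLinearMap ∘ₗ X.inv.val.toLinearMap)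
      (X.actRight y) x := by
  -- By coassociativity x₁ and x₂ are the two parts of a single b in A, and b₁(y ◁ b₂) = yb; then 1
  -- ⊗ y commutes with x₀ ⊗ 1.
  rw [coactIncl_inv_eq_conv, conv_coassoc _ _ _ (X.coact_coassoc x), conv_incl_actRight,
    ← conv_mul_mid]
  have h := LinearMap.congr_fun X.coactIncl_inv_eq_conv x
  rw [LinearMap.comp_apply, AlgHom.toLinearMap_apply, AlgHom.toLinearMap_apply,
    Subalgebra.coe_val] at h
  rw [h, mul_conv]
  congr 2
  ext z
  simp

/-- `(1 ⊗ y)(a₁ ⊗ a₂) = a₁ ⊗ a₂ (y ◁ a₃)`. -/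
theorem one_tmul_mul_comulIncl (y : X.inv) (a : A) : 1 ⊗ₜ[k] (y : Ω) * X.comulIncl a =
    conv (comul (R := k)) X.comulIncl.toLinearMap (X.actRight y) a := by
  rw [comulIncl_eq_conv, comul_conv_assoc, conv_incl_actRight, ← conv_mul_mid]
  have h := LinearMap.congr_fun X.comulIncl_eq_conv a
  rw [AlgHom.toLinearMap_apply] at h
  rw [h, mul_conv]
  congr 2
  ext z
  simp

/-- `j(t) Δ(a) = Δ(a₁) j(t ◁ a₂)` for the embedding `j : Λ ⊗ Λ → Ω ⊗ Ω`. -/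
theorem crossMap_mul_comulIncl (t : X.inv ⊗[k] X.inv) (a : A) :
    X.crossMap t * X.comulIncl a = conv (comul (R := k)) X.comulIncl.toLinearMap
      (X.crossMap ∘ₗ (X.invActCoact.tensor X.invActCoact).act t) a := by
  induction t using TensorProduct.induction_on with
  | zero => simp [conv_apply]
  | add x y hx hy => simp only [map_add, add_mul, hx, hy, conv_apply, LinearMap.comp_add,
      TensorProduct.map_add_right, LinearMap.add_apply]
  | tmul x y =>
    -- Δ(a) is moved first past 1 ⊗ y, which becomes 1 ⊗ (y ◁ a₂), and then past x₀ ⊗ x₁.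
    rw [crossMap_tmul, mul_assoc, one_tmul_mul_comulIncl, mul_conv]
    -- This is Δ_R applied to xb = b₁(x ◁ b₂).
    have h1 : LinearMap.mulLeft k (X.coactIncl x) ∘ₗ X.comulIncl.toLinearMap =
        conv (comul (R := k)) X.comulIncl.toLinearMap
          (X.coactIncl.toLinearMap ∘ₗ X.inv.val.toLinearMap ∘ₗ X.invActCoact.act x) := by
      ext b
      have h2 := congrArg X.coactIncl (X.conv_incl_act x b)
      rw [map_conv, map_mul, coactIncl_incl] at h2
      have h3 : X.coactIncl.toLinearMap ∘ₗ X.incl = X.comulIncl.toLinearMap :=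
        LinearMap.ext X.coactIncl_incl
      rw [h3] at h2
      exact h2.symm
    have h4 : conv (comul (R := k))
        (X.coactIncl.toLinearMap ∘ₗ X.inv.val.toLinearMap ∘ₗ X.invActCoact.act x)
        (X.actRight y) = X.crossMap ∘ₗ (X.invActCoact.tensor X.invActCoact).act (x ⊗ₜ y) := by
      ext b
      rw [LinearMap.comp_apply, tensor_act_tmul, conv_apply]
      exact tensor_congr (f := LinearMap.mul' k (Ω ⊗[k] Ω) ∘ₗ TensorProduct.map
          (X.coactIncl.toLinearMap ∘ₗ X.inv.val.toLinearMap ∘ₗ X.invActCoact.act x)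
          (X.actRight y))
        (g := X.crossMap ∘ₗ TensorProduct.map (X.invActCoact.act x) (X.invActCoact.act y))
        (by intro b c; simp [crossMap_tmul, actRight]) _
    rw [h1, comul_conv_assoc, h4]

theorem braiding_tmul (y x : X.inv) : X.invActCoact.braiding X.invActCoact (y ⊗ₜ x) =
    LinearMap.lTensor X.inv (X.invActCoact.act y) (X.invActCoact.coact x) := by
  simp only [ActCoact.braiding, LinearMap.comp_apply, LinearMap.lTensor_tmul, LinearEquiv.coe_coe]
  exact tensor_congr (f := LinearMap.lTensor X.inv (TensorProduct.lift X.invActCoact.act) ∘ₗ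
      (TensorProduct.leftComm k X.inv X.inv A).toLinearMap ∘ₗ TensorProduct.mk k X.inv _ y)
    (g := LinearMap.lTensor X.inv (X.invActCoact.act y)) (by intro z a; simp) _

/-- The inner factors are x₁y and x'₀. They have the degrees of y and x', since the coaction
preserves degree and A sits in degree 0; so the super product is the plain product up to a constant
sign. -/
theorem superMul_crossMap_tmul {i j : ℕ} {y x' : X.inv} (hy : y ∈ X.invGrading i)
    (hx : x' ∈ X.invGrading j) (x y' : X.inv) :
    superMul 𝒢 (X.crossMap (x ⊗ₜ y)) (X.crossMap (x' ⊗ₜ y')) =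
      ((-1 : k) ^ (i * j)) • (X.crossMap (x ⊗ₜ y) * X.crossMap (x' ⊗ₜ y')) := by
  rw [crossMap_tmul, crossMap_tmul, coactIncl_apply, coactIncl_apply]
  obtain ⟨t, ht⟩ := X.coactR_mem j x' hx
  rw [← ht]
  generalize X.coactR x = s
  clear ht
  induction s using TensorProduct.induction_on with
  | zero => simp
  | add s s' hs hs' => simp only [map_add, add_mul, LinearMap.add_apply, hs, hs', smul_add]
  | tmul u a =>
    induction t using TensorProduct.induction_on with
    | zero => simp
    | add s s' hs hs' => simp only [map_add, add_mul, mul_add, hs, hs', smul_add]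
    | tmul v b =>
      have h : X.incl a * y ∈ 𝒢 i := by
        simpa using SetLike.mul_mem_graded (A := 𝒢) (X.incl_mem a) hy
      simp [superMul_of_mem h v.2]

/-- The embedding `Λ ⊗ Λ → Ω ⊗ Ω` is multiplicative from the braided to the super tensor
product algebra. -/
theorem superMul_crossMap (s t : X.inv ⊗[k] X.inv) :
    superMul 𝒢 (X.crossMap s) (X.crossMap t) = X.crossMap (braidedMul
      (X.invActCoact.braiding X.invActCoact ∘ₗ koszul X.invGrading) (s ⊗ₜ t)) := by
  refine superMul_congr X.invGrading (f := (superMul 𝒢).compl₁₂ X.crossMap X.crossMap)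
    (g := (TensorProduct.mk k (X.inv ⊗[k] X.inv) (X.inv ⊗[k] X.inv)).compr₂ (X.crossMap ∘ₗ
      braidedMul (X.invActCoact.braiding X.invActCoact ∘ₗ koszul X.invGrading))) ?_ s t
  intro i j y hy x' hx x y'
  simp only [LinearMap.compl₁₂_apply, LinearMap.compr₂_apply, TensorProduct.mk_apply,
    LinearMap.comp_apply]
  rw [superMul_crossMap_tmul X hy hx, braidedMul_tmul, LinearMap.comp_apply,
    koszul_of_mem _ hy hx, map_smul, map_smul, map_smul, braiding_tmul]
  congr 1
  -- With equal signs removed, the inner product (1 ⊗ y)(x'₀ ⊗ x'₁) is rewritten as x'₀ ⊗ x'₁(y ◁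
  -- x'₂), which is the braiding of y and x' seen through j.
  rw [crossMap_tmul, crossMap_tmul, mul_assoc, ← mul_assoc (1 ⊗ₜ _), one_tmul_mul_coactIncl,
    conv_mul, mul_conv, conv_apply]
  refine tensor_congr (f := LinearMap.mul' k (Ω ⊗[k] Ω) ∘ₗ TensorProduct.map
      (LinearMap.mulLeft k (X.coactIncl x) ∘ₗ X.coactIncl.toLinearMap ∘ₗ X.inv.val.toLinearMap)
      (LinearMap.mulRight k (1 ⊗ₜ (y' : Ω)) ∘ₗ X.actRight y))
    (g := X.crossMap ∘ₗ TensorProduct.map (LinearMap.mulLeft k x) (LinearMap.mulRight k y') ∘ₗ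
      LinearMap.lTensor X.inv (X.invActCoact.act y)) ?_ _
  intro z a
  simp [crossMap_tmul, actRight, mul_assoc]

/-- The embedding `Λ ⊗ Λ → Ω ⊗ Ω` is a comodule map for the coaction on the second factor of
`Ω ⊗ Ω`. -/
theorem lTensor_coactR_crossMap (t : X.inv ⊗[k] X.inv) :
    LinearMap.lTensor Ω X.coactR.toLinearMap (X.crossMap t) = TensorProduct.assoc k Ω Ω A
      (LinearMap.rTensor A X.crossMap ((X.invActCoact.tensor X.invActCoact).coact t)) := by
  refine tensor_congr (f := LinearMap.lTensor Ω X.coactR.toLinearMap ∘ₗ X.crossMap)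
    (g := (TensorProduct.assoc k Ω Ω A).toLinearMap ∘ₗ LinearMap.rTensor A X.crossMap ∘ₗ
      (X.invActCoact.tensor X.invActCoact).coact) ?_ t
  intro x y
  simp only [LinearMap.comp_apply, LinearEquiv.coe_coe, tensor_coact_tmul, crossMap_tmul]
  let φ : Ω ⊗[k] Ω →ₐ[k] Ω ⊗[k] (Ω ⊗[k] A) :=
    Algebra.TensorProduct.map (AlgHom.id k Ω) X.coactR
  -- The maps i₁, i₂, i₃ are the inclusions of the three legs.
  let i₁ : Ω →ₐ[k] Ω ⊗[k] (Ω ⊗[k] A) := Algebra.TensorProduct.includeLeft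
  let i₂ : Ω →ₐ[k] Ω ⊗[k] (Ω ⊗[k] A) :=
    Algebra.TensorProduct.includeRight.comp Algebra.TensorProduct.includeLeft
  let i₃ : A →ₐ[k] Ω ⊗[k] (Ω ⊗[k] A) :=
    Algebra.TensorProduct.includeRight.comp Algebra.TensorProduct.includeRight
  -- On the leg x₁ in A the right coaction is the coproduct, so the result is x₀ ⊗ x₁ ⊗ x₂.
  -- Coassociativity then allows x₀ ⊗ x₁ to be read as the coaction of the first part of x, which is
  -- what j expects.
  have h1 : φ (X.coactIncl x) = conv X.invActCoact.coact
      (i₁.toLinearMap ∘ₗ X.inv.val.toLinearMap)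
      (conv (comul (R := k)) (i₂.toLinearMap ∘ₗ X.incl) i₃.toLinearMap) x := by
    have h := LinearMap.congr_fun X.coactIncl_inv_eq_conv x
    rw [LinearMap.comp_apply, AlgHom.toLinearMap_apply, AlgHom.toLinearMap_apply,
      Subalgebra.coe_val] at h
    rw [h, map_conv]
    congr 2
    · ext z
      simp [φ, i₁, Algebra.TensorProduct.one_def]
    · ext a
      simp only [LinearMap.comp_apply, AlgHom.toLinearMap_apply, φ,
        Algebra.TensorProduct.includeRight_apply, Algebra.TensorProduct.map_tmul, map_one,
        coactR_incl, conv_apply]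
      exact tensor_congr (f := TensorProduct.mk k Ω _ 1 ∘ₗ LinearMap.rTensor A X.incl)
        (g := LinearMap.mul' k _ ∘ₗ TensorProduct.map (i₂.toLinearMap ∘ₗ X.incl) i₃.toLinearMap)
        (by intro b c; simp [i₂, i₃]) _
  have h2 : LinearMap.lTensor Ω X.coactR.toLinearMap (X.coactIncl x * 1 ⊗ₜ (y : Ω)) =
      φ (X.coactIncl x) * 1 ⊗ₜ X.coactR y := by
    have : LinearMap.lTensor Ω X.coactR.toLinearMap (X.coactIncl x * 1 ⊗ₜ (y : Ω)) =
      φ (X.coactIncl x * 1 ⊗ₜ (y : Ω)) := rfl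
    rw [this, map_mul]
    simp [φ]
  rw [h2, h1, ← conv_coassoc _ _ _ (X.coact_coassoc x), coactR_inv, conv_apply]
  generalize X.invActCoact.coact x = s
  generalize X.invActCoact.coact y = t
  induction s using TensorProduct.induction_on with
  | zero => simp
  | add s s' hs hs' => simp only [map_add, add_mul, LinearMap.add_apply, hs, hs']
  | tmul z a =>
    induction t using TensorProduct.induction_on with
    | zero => simp
    | add s s' hs hs' => simp only [map_add, mul_add, TensorProduct.tmul_add, hs, hs']
    | tmul w b =>
      simp only [coactMul_tmul, LinearMap.rTensor_tmul, TensorProduct.map_tmul,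
        LinearMap.mul'_apply, crossMap_tmul, coactIncl_inv, conv_apply, AlgHom.toLinearMap_apply,
        Subalgebra.coe_val]
      exact tensor_congr (f := LinearMap.mulRight k (1 ⊗ₜ ((w : Ω) ⊗ₜ b)) ∘ₗ
          LinearMap.mulRight k (i₃ a) ∘ₗ LinearMap.mul' k _ ∘ₗ TensorProduct.map
            (i₁.toLinearMap ∘ₗ X.inv.val.toLinearMap) (i₂.toLinearMap ∘ₗ X.incl))
        (g := (TensorProduct.assoc k Ω Ω A).toLinearMap ∘ₗ
          (TensorProduct.mk k (Ω ⊗[k] Ω) A).flip (a * b) ∘ₗ LinearMap.mulRight k (1 ⊗ₜ (w : Ω)) ∘ₗ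
            TensorProduct.map X.inv.val.toLinearMap X.incl)
        (by intro u c; simp [i₁, i₂, i₃]) _

/-! ### Parity and the differential -/

theorem coe_parity (η : X.inv) : (parity X.invGrading η : Ω) = parity 𝒢 (η : Ω) := by
  induction η using DirectSum.Decomposition.inductionOn X.invGrading with
  | zero => simp
  | add x y hx hy => simp only [map_add, Subalgebra.coe_add, hx, hy]
  | @homogeneous n η =>
    rw [parity_of_mem X.invGrading η.2, parity_of_mem 𝒢 (v := ((η : X.inv) : Ω)) η.2]
    rfl

theorem coactR_parity (u : Ω) :
    X.coactR (parity 𝒢 u) = LinearMap.rTensor A (parity 𝒢) (X.coactR u) := by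
  induction u using DirectSum.Decomposition.inductionOn 𝒢 with
  | zero => simp
  | add x y hx hy => simp only [map_add, hx, hy]
  | @homogeneous n u =>
    rw [parity_of_mem 𝒢 u.2, map_smul]
    obtain ⟨t, ht⟩ := X.coactR_mem n u u.2
    rw [← ht]
    exact tensor_congr (f := ((-1 : k) ^ n) • LinearMap.rTensor A (𝒢 n).subtype)
      (g := LinearMap.rTensor A (parity 𝒢) ∘ₗ LinearMap.rTensor A (𝒢 n).subtype)
      (by intro w a; simp [parity_of_mem 𝒢 w.2, TensorProduct.smul_tmul']) t

theorem parity_incl_mul (a : A) (u : Ω) :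
    parity 𝒢 (X.incl a * u) = X.incl a * parity 𝒢 u := by
  induction u using DirectSum.Decomposition.inductionOn 𝒢 with
  | zero => simp
  | add x y hx hy => simp only [map_add, mul_add, hx, hy]
  | @homogeneous n u =>
    have h : X.incl a * u ∈ 𝒢 n := by
      simpa using SetLike.mul_mem_graded (A := 𝒢) (X.incl_mem a) u.2
    rw [parity_of_mem 𝒢 h, parity_of_mem 𝒢 u.2, mul_smul_comm]

theorem d_incl_mul (a : A) (u : Ω) :
    X.d (X.incl a * u) = X.d (X.incl a) * u + X.incl a * X.d u := by
  rw [X.d_mul 0 _ (X.incl_mem a), pow_zero, one_smul]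

theorem d_one : X.d 1 = 0 := by
  have h := X.d_incl_mul 1 1
  rw [mul_one, X.incl_one, mul_one, one_mul] at h
  exact left_eq_add.1 h

theorem d_incl_mem (a : A) : X.d (X.incl a) ∈ 𝒢 1 := X.d_mem 0 _ (X.incl_mem a)

theorem d_inv (η : X.inv) : X.d η = X.δ η := rfl

theorem coactL_d_incl (a : A) :
    X.coactL (X.d (X.incl a)) = LinearMap.lTensor A (X.d ∘ₗ X.incl) (comul (R := k) a) := by
  rw [X.d_coactL, coactL_incl, LinearMap.lTensor_comp_apply]

theorem coactR_d_incl (a : A) :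
    X.coactR (X.d (X.incl a)) = LinearMap.rTensor A (X.d ∘ₗ X.incl) (comul (R := k) a) := by
  rw [X.d_coactR, coactR_incl, LinearMap.rTensor_comp_apply]

/-- Since d1 = 0, subtracting ε(a)1 does not affect da; π only serves to land in the domain of ω. -/
theorem ω_augProj (a : A) : X.ω (augProj a) = X.invProj (X.d (X.incl a)) := by
  have h : ((augProj (k := k) a : LinearMap.ker (counit (R := k) (A := A))) : A) =
      a - algebraMap k A (counit (R := k) a) := rfl
  have h1 : X.ω (augProj a) = X.invProj (X.d (X.incl
    ((augProj (k := k) a : LinearMap.ker (counit (R := k) (A := A))) : A))) := rfl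
  rw [h1, h, Algebra.algebraMap_eq_smul_one, map_sub, map_smul, X.incl_one, map_sub, map_smul,
    d_one, smul_zero, sub_zero]

/-- `d a = a₁ ω(π(a₂))`. -/
theorem conv_incl_ω (a : A) : conv (comul (R := k)) X.incl
    (X.inv.val.toLinearMap ∘ₗ X.ω ∘ₗ augProj) a = X.d (X.incl a) := by
  have h : X.coactL.toLinearMap (X.d (X.incl a)) =
      TensorProduct.map LinearMap.id (X.d ∘ₗ X.incl) (comul (R := k) a) := X.coactL_d_incl a
  have h2 := X.incl_mul_invProj (X.d (X.incl a))
  rw [conv_of_map h, LinearMap.comp_id] at h2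
  rw [← h2]
  congr 2
  ext b
  simp [ω_augProj]

/-- The super derivation `d ⊗ id + (-1)^{| |} ⊗ d` of `Ω ⊗ Ω`. -/
def dTensor : Ω ⊗[k] Ω →ₗ[k] Ω ⊗[k] Ω :=
  LinearMap.rTensor Ω X.d + TensorProduct.map (parity 𝒢) X.d

theorem dTensor_tmul (u v : Ω) :
    X.dTensor (u ⊗ₜ v) = X.d u ⊗ₜ v + parity 𝒢 u ⊗ₜ X.d v := by
  simp [dTensor]

/-- The Leibniz rule for a left factor of degree 0. The differentiated factor contains a₁ ⊗ da₂-type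
terms, whose second leg has degree 1, so it acts on t by the super product. -/
theorem dTensor_incl₂_mul (c : A ⊗[k] A) (t : Ω ⊗[k] Ω) :
    X.dTensor (X.incl₂ c * t) = X.incl₂ c * X.dTensor t +
      superMul 𝒢 (LinearMap.rTensor Ω (X.d ∘ₗ X.incl) (LinearMap.lTensor A X.incl c) +
        LinearMap.lTensor Ω (X.d ∘ₗ X.incl) (LinearMap.rTensor A X.incl c)) t := by
  induction c using TensorProduct.induction_on with
  | zero => simp
  | add x y hx hy => simp only [map_add, add_mul, LinearMap.add_apply, hx, hy]; abel
  | tmul a b =>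
    simp only [LinearMap.lTensor_tmul, LinearMap.rTensor_tmul, LinearMap.comp_apply, map_add,
      LinearMap.add_apply, superMul_of_left_mem_zero (X.incl_mem b),
      superMul_of_left_mem_one (X.d_incl_mem b), incl₂_tmul]
    refine tensor_congr (f := X.dTensor ∘ₗ LinearMap.mulLeft k (X.incl a ⊗ₜ[k] X.incl b))
      (g := LinearMap.mulLeft k (X.incl a ⊗ₜ[k] X.incl b) ∘ₗ X.dTensor +
        (LinearMap.mulLeft k (X.d (X.incl a) ⊗ₜ[k] X.incl b) +
          LinearMap.mulLeft k (X.incl a ⊗ₜ[k] X.d (X.incl b)) ∘ₗ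
            LinearMap.rTensor Ω (parity 𝒢))) ?_ t
    intro u v
    simp [dTensor_tmul, d_incl_mul, parity_incl_mul, TensorProduct.add_tmul,
      TensorProduct.tmul_add, mul_add]
    abel

/-- The twisted super coderivation of `Λ ⊗ Λ`. -/
def dTwisted : X.inv ⊗[k] X.inv →ₗ[k] X.inv ⊗[k] X.inv :=
  LinearMap.rTensor X.inv X.δ + TensorProduct.map (parity X.invGrading) X.δ + X.ωTwist

/-- j sends x₀ ⊗ ω(π(x₁))y to x₀ ⊗ x₁ ω(π(x₂)) y, and x₁ ω(π(x₂)) recombines to d(x₁). -/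
theorem crossMap_ωTwist (x y : X.inv) : X.crossMap (X.ωTwist (x ⊗ₜ y)) =
    LinearMap.lTensor Ω (X.d ∘ₗ X.incl) (X.coactR (parity 𝒢 (x : Ω))) * 1 ⊗ₜ (y : Ω) := by
  rw [← coe_parity, ωTwist]
  simp only [LinearMap.comp_apply, LinearMap.rTensor_tmul, LinearEquiv.coe_coe]
  generalize parity X.invGrading x = x
  let i₂ : Ω →ₐ[k] Ω ⊗[k] Ω := Algebra.TensorProduct.includeRight
  have h1 : X.crossMap (LinearMap.lTensor X.inv (LinearMap.mul' k X.inv)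
      (TensorProduct.assoc k X.inv X.inv X.inv
        (LinearMap.lTensor X.inv (X.ω ∘ₗ augProj) (X.invActCoact.coact x) ⊗ₜ y))) =
      conv X.invActCoact.coact (X.coactIncl.toLinearMap ∘ₗ X.inv.val.toLinearMap)
        (i₂.toLinearMap ∘ₗ X.inv.val.toLinearMap ∘ₗ X.ω ∘ₗ augProj) x * 1 ⊗ₜ (y : Ω) := by
    rw [conv_apply]
    exact tensor_congr (f := X.crossMap ∘ₗ LinearMap.lTensor X.inv (LinearMap.mul' k X.inv) ∘ₗ
        (TensorProduct.assoc k X.inv X.inv X.inv).toLinearMap ∘ₗ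
          (TensorProduct.mk k (X.inv ⊗[k] X.inv) X.inv).flip y ∘ₗ
            LinearMap.lTensor X.inv (X.ω ∘ₗ augProj))
      (g := LinearMap.mulRight k (1 ⊗ₜ (y : Ω)) ∘ₗ LinearMap.mul' k (Ω ⊗[k] Ω) ∘ₗ
        TensorProduct.map (X.coactIncl.toLinearMap ∘ₗ X.inv.val.toLinearMap)
          (i₂.toLinearMap ∘ₗ X.inv.val.toLinearMap ∘ₗ X.ω ∘ₗ augProj))
      (by intro z a; simp [crossMap_tmul, i₂, mul_assoc]) _
  have h2 : conv (comul (R := k)) (i₂.toLinearMap ∘ₗ X.incl)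
      (i₂.toLinearMap ∘ₗ X.inv.val.toLinearMap ∘ₗ X.ω ∘ₗ augProj) =
      i₂.toLinearMap ∘ₗ X.d ∘ₗ X.incl := by
    ext a
    rw [← map_conv, conv_incl_ω]
    rfl
  rw [h1, coactIncl_inv_eq_conv, conv_coassoc _ _ _ (X.coact_coassoc x), h2, coactR_inv, conv_apply]
  congr 1
  exact tensor_congr (f := LinearMap.mul' k (Ω ⊗[k] Ω) ∘ₗ TensorProduct.map
      (Algebra.TensorProduct.includeLeft.toLinearMap ∘ₗ X.inv.val.toLinearMap)
      (i₂.toLinearMap ∘ₗ X.d ∘ₗ X.incl))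
    (g := LinearMap.lTensor Ω (X.d ∘ₗ X.incl) ∘ₗ LinearMap.rTensor A X.inv.val.toLinearMap)
    (by intro z a; simp [i₂]) _

/-- The embedding `Λ ⊗ Λ → Ω ⊗ Ω` intertwines the twisted with the untwisted super coderivation. -/
theorem dTensor_crossMap (t : X.inv ⊗[k] X.inv) :
    X.dTensor (X.crossMap t) = X.crossMap (X.dTwisted t) := by
  refine tensor_congr (f := X.dTensor ∘ₗ X.crossMap) (g := X.crossMap ∘ₗ X.dTwisted) ?_ t
  intro x y
  simp only [LinearMap.comp_apply, dTwisted, LinearMap.add_apply, map_add, crossMap_ωTwist]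
  simp only [LinearMap.rTensor_tmul, TensorProduct.map_tmul, crossMap_tmul, coactIncl_apply,
    coe_parity, ← d_inv, X.d_coactR, coactR_parity]
  -- For x₀ ⊗ x₁y the Leibniz rule in the second leg gives x₁dy and d(x₁)y. The latter is the image
  -- of the ω-term, and is the reason for that term in the twisted identity.
  have h := tensor_congr (f := X.dTensor ∘ₗ LinearMap.mulRight k (1 ⊗ₜ (y : Ω)) ∘ₗ
      LinearMap.lTensor Ω X.incl)
    (g := LinearMap.mulRight k (1 ⊗ₜ (y : Ω)) ∘ₗ LinearMap.lTensor Ω X.incl ∘ₗ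
        LinearMap.rTensor A X.d +
      LinearMap.mulRight k (1 ⊗ₜ X.d (y : Ω)) ∘ₗ LinearMap.lTensor Ω X.incl ∘ₗ
        LinearMap.rTensor A (parity 𝒢) +
      LinearMap.mulRight k (1 ⊗ₜ (y : Ω)) ∘ₗ LinearMap.lTensor Ω (X.d ∘ₗ X.incl) ∘ₗ
        LinearMap.rTensor A (parity 𝒢))
    (by
      intro u a
      simp [dTensor_tmul, d_incl_mul, TensorProduct.tmul_add]
      abel) (X.coactR x)
  exact h

theorem twistedCoderivation_iff (Δ : X.inv →ₗ[k] X.inv ⊗[k] X.inv) :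
    X.TwistedCoderivation Δ ↔ ∀ η, Δ (X.δ η) = X.dTwisted (Δ η) := Iff.rfl

/-! ### Degrees in tensor products -/

/-- The component of degree `n` of `V ⊗ V`. -/
def tensorGrading {V : Type*} [AddCommGroup V] [Module k V] (𝒱 : ℕ → Submodule k V) (n : ℕ) :
    Submodule k (V ⊗[k] V) :=
  ⨆ (i : ℕ) (j : ℕ) (_ : i + j = n),
    LinearMap.range (TensorProduct.map (𝒱 i).subtype (𝒱 j).subtype)

section

variable {V : Type*} [AddCommGroup V] [Module k V] {𝒱 : ℕ → Submodule k V}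

theorem mem_tensorGrading {i j n : ℕ} (h : i + j = n) {t : V ⊗[k] V}
    (ht : t ∈ LinearMap.range (TensorProduct.map (𝒱 i).subtype (𝒱 j).subtype)) :
    t ∈ tensorGrading 𝒱 n :=
  Submodule.mem_iSup_of_mem i (Submodule.mem_iSup_of_mem j (Submodule.mem_iSup_of_mem h ht))

theorem tmul_mem_tensorGrading {i j n : ℕ} (h : i + j = n) {v w : V} (hv : v ∈ 𝒱 i)
    (hw : w ∈ 𝒱 j) : v ⊗ₜ[k] w ∈ tensorGrading 𝒱 n :=
  mem_tensorGrading h ⟨⟨v, hv⟩ ⊗ₜ ⟨w, hw⟩, rfl⟩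

theorem map_mem_of_mem_tensorGrading {N : Type*} [AddCommGroup N] [Module k N] {n : ℕ}
    {P : Submodule k N} {f : V ⊗[k] V →ₗ[k] N}
    (h : ∀ i j, i + j = n → ∀ v ∈ 𝒱 i, ∀ w ∈ 𝒱 j, f (v ⊗ₜ w) ∈ P) {t : V ⊗[k] V}
    (ht : t ∈ tensorGrading 𝒱 n) : f t ∈ P := by
  have hle : tensorGrading 𝒱 n ≤ P.comap f := by
    refine iSup_le fun i => iSup_le fun j => iSup_le fun hij => ?_
    rintro _ ⟨s, rfl⟩
    induction s using TensorProduct.induction_on with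
    | zero => simp
    | add x y hx hy => rw [map_add]; exact add_mem hx hy
    | tmul v w => exact h i j hij v v.2 w w.2
  exact hle ht

end

theorem crossMap_mem {n : ℕ} {t : X.inv ⊗[k] X.inv} (ht : t ∈ tensorGrading X.invGrading n) :
    X.crossMap t ∈ tensorGrading 𝒢 n := by
  refine map_mem_of_mem_tensorGrading ?_ ht
  intro i j hij x hx y hy
  rw [crossMap_tmul, coactIncl_apply]
  obtain ⟨s, hs⟩ := X.coactR_mem i x hx
  rw [← hs]
  clear hs
  induction s using TensorProduct.induction_on with
  | zero => simp
  | add s s' hs hs' => simpa only [map_add, add_mul] using add_mem hs hs'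
  | tmul z a =>
    have h : X.incl a * y ∈ 𝒢 j := by
      simpa using SetLike.mul_mem_graded (A := 𝒢) (X.incl_mem a) hy
    simpa using tmul_mem_tensorGrading (k := k) hij z.2 h

theorem map_invProj_mem {n : ℕ} {t : Ω ⊗[k] Ω} (ht : t ∈ tensorGrading 𝒢 n) :
    TensorProduct.map X.invProj X.invProj t ∈ tensorGrading X.invGrading n :=
  map_mem_of_mem_tensorGrading (fun _ _ hij _ hv _ hw =>
    tmul_mem_tensorGrading hij (X.invProj_mem hv) (X.invProj_mem hw)) ht

theorem incl₂_mul_mem {n : ℕ} (c : A ⊗[k] A) {t : Ω ⊗[k] Ω} (ht : t ∈ tensorGrading 𝒢 n) :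
    X.incl₂ c * t ∈ tensorGrading 𝒢 n := by
  induction c using TensorProduct.induction_on with
  | zero => simp
  | add s s' hs hs' => simpa only [map_add, add_mul] using add_mem hs hs'
  | tmul a b =>
    refine map_mem_of_mem_tensorGrading (f := LinearMap.mulLeft k (X.incl₂ (a ⊗ₜ b))) ?_ ht
    intro i j hij v hv w hw
    have h : X.incl a * v ∈ 𝒢 i := by
      simpa using SetLike.mul_mem_graded (A := 𝒢) (X.incl_mem a) hv
    have h' : X.incl b * w ∈ 𝒢 j := by
      simpa using SetLike.mul_mem_graded (A := 𝒢) (X.incl_mem b) hw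
    simpa using tmul_mem_tensorGrading (k := k) hij h h'

/-! ### The projection to degree zero -/

theorem exists_incl_of_mem {u : Ω} (hu : u ∈ 𝒢 0) : ∃ a, X.incl a = u :=
  ⟨X.zeroEquiv.symm ⟨u, hu⟩, by simp [incl]⟩

theorem proj_of_mem_ne {n : ℕ} (hn : n ≠ 0) {u : Ω} (hu : u ∈ 𝒢 n) : X.proj u = 0 := by
  have h : DirectSum.component k ℕ (fun n => 𝒢 n) 0 (DirectSum.decomposeLinearEquiv 𝒢 u) = 0 :=
    Subtype.ext (DirectSum.decompose_of_mem_ne 𝒢 hu hn)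
  simp only [proj, LinearMap.comp_apply, LinearEquiv.coe_coe, h, map_zero]

theorem proj_incl_mul (a : A) (u : Ω) : X.proj (X.incl a * u) = a * X.proj u := by
  induction u using DirectSum.Decomposition.inductionOn 𝒢 with
  | zero => simp
  | add x y hx hy => simp only [map_add, mul_add, hx, hy]
  | @homogeneous n u =>
    by_cases hn : n = 0
    · subst hn
      obtain ⟨b, hb⟩ := X.exists_incl_of_mem u.2
      rw [← hb, ← X.incl_mul, proj_incl, proj_incl]
    · have h : X.incl a * u ∈ 𝒢 n := by
        simpa using SetLike.mul_mem_graded (A := 𝒢) (X.incl_mem a) u.2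
      rw [X.proj_of_mem_ne hn h, X.proj_of_mem_ne hn u.2, mul_zero]

/-- An invariant element a of A equals P(a) = ε(a)1. -/
theorem exists_smul_one_of_mem {η : X.inv} (hη : η ∈ X.invGrading 0) : ∃ r : k, η = r • 1 := by
  obtain ⟨a, ha⟩ := X.exists_incl_of_mem hη
  exact ⟨counit (R := k) a, by rw [← X.invProj_incl, ← X.invProj_inv η]; exact congrArg _ ha.symm⟩

/-- In degree 0 invariant forms are scalars, and in positive degree both Π and ε vanish. -/
theorem proj_inv {ε : X.inv →ₗ[k] k} (h1 : ε 1 = 1)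
    (h : ∀ n, ∀ η ∈ X.invGrading n, n ≠ 0 → ε η = 0) (η : X.inv) :
    X.proj η = algebraMap k A (ε η) := by
  induction η using DirectSum.Decomposition.inductionOn X.invGrading with
  | zero => simp
  | add x y hx hy => simp only [map_add, Subalgebra.coe_add, hx, hy]
  | @homogeneous n η =>
    by_cases hn : n = 0
    · subst hn
      obtain ⟨r, hr⟩ := X.exists_smul_one_of_mem η.2
      rw [hr, map_smul, h1, Subalgebra.coe_smul, map_smul, Subalgebra.coe_one, ← X.incl_one,
        proj_incl, smul_eq_mul, mul_one, Algebra.algebraMap_eq_smul_one]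
    · rw [X.proj_of_mem_ne hn (u := ((η : X.inv) : Ω)) η.2, h n η η.2 hn, map_zero]

theorem rTensor_proj_incl₂_mul (c : A ⊗[k] A) (t : Ω ⊗[k] Ω) :
    LinearMap.rTensor Ω X.proj (X.incl₂ c * t) =
      LinearMap.lTensor A X.incl c * LinearMap.rTensor Ω X.proj t := by
  induction c using TensorProduct.induction_on with
  | zero => simp
  | add x y hx hy => simp only [map_add, add_mul, hx, hy]
  | tmul a b =>
    exact tensor_congr
      (f := LinearMap.rTensor Ω X.proj ∘ₗ LinearMap.mulLeft k (X.incl₂ (a ⊗ₜ b)))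
      (g := LinearMap.mulLeft k (LinearMap.lTensor A X.incl (a ⊗ₜ b)) ∘ₗ
        LinearMap.rTensor Ω X.proj) (by intro u v; simp [proj_incl_mul]) t

theorem lTensor_proj_incl₂_mul (c : A ⊗[k] A) (t : Ω ⊗[k] Ω) :
    LinearMap.lTensor Ω X.proj (X.incl₂ c * t) =
      LinearMap.rTensor A X.incl c * LinearMap.lTensor Ω X.proj t := by
  induction c using TensorProduct.induction_on with
  | zero => simp
  | add x y hx hy => simp only [map_add, add_mul, hx, hy]
  | tmul a b =>
    exact tensor_congr
      (f := LinearMap.lTensor Ω X.proj ∘ₗ LinearMap.mulLeft k (X.incl₂ (a ⊗ₜ b)))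
      (g := LinearMap.mulLeft k (LinearMap.rTensor A X.incl (a ⊗ₜ b)) ∘ₗ
        LinearMap.lTensor Ω X.proj) (by intro u v; simp [proj_incl_mul]) t

/-! ### Counits and the embedding `Λ ⊗ Λ → Ω ⊗ Ω` -/

/-- Colinearity of ε gives ε(x₀)x₁ = ε(x)1. The free map f lets the same computation serve the
counit (f the identity) and the projection Π (f the unit of `A`). -/
theorem rTensor_crossMap {N : Type*} [AddCommGroup N] [Module k N] {e : Ω →ₗ[k] N}
    {f : k →ₗ[k] N} {ε : X.inv →ₗ[k] k}
    (he : ∀ η : X.inv, e η = f (ε η)) (hε : X.invActCoact.IsHom ActCoact.unit ε)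
    (t : X.inv ⊗[k] X.inv) : LinearMap.rTensor Ω e (X.crossMap t) =
      TensorProduct.map f X.inv.val.toLinearMap (LinearMap.rTensor X.inv ε t) := by
  refine tensor_congr (f := LinearMap.rTensor Ω e ∘ₗ X.crossMap)
    (g := TensorProduct.map f X.inv.val.toLinearMap ∘ₗ LinearMap.rTensor X.inv ε) ?_ t
  intro x y
  simp only [LinearMap.comp_apply, crossMap_tmul, coactIncl_inv, LinearMap.rTensor_tmul,
    TensorProduct.map_tmul]
  have h := tensor_congr (f := LinearMap.rTensor Ω e ∘ₗ LinearMap.mulRight k (1 ⊗ₜ (y : Ω)) ∘ₗ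
      TensorProduct.map X.inv.val.toLinearMap X.incl)
    (g := TensorProduct.map f (LinearMap.mulRight k (y : Ω) ∘ₗ X.incl) ∘ₗ LinearMap.rTensor A ε)
    (by intro z a; simp [he]) (X.invActCoact.coact x)
  simp only [LinearMap.comp_apply, ← hε.map_coact] at h
  simpa [ActCoact.unit, X.incl_one] using h

theorem lTensor_counit_crossMap {e : Ω →ₗ[k] k} {ε : X.inv →ₗ[k] k} (he : ∀ η : X.inv, e η = ε η)
    (hmul : ∀ a u, e (X.incl a * u) = counit (R := k) a * e u) (t : X.inv ⊗[k] X.inv) :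
    LinearMap.lTensor Ω e (X.crossMap t) =
      LinearMap.rTensor k X.inv.val.toLinearMap (LinearMap.lTensor X.inv ε t) := by
  refine tensor_congr (f := LinearMap.lTensor Ω e ∘ₗ X.crossMap)
    (g := LinearMap.rTensor k X.inv.val.toLinearMap ∘ₗ LinearMap.lTensor X.inv ε) ?_ t
  intro x y
  simp only [LinearMap.comp_apply, crossMap_tmul, coactIncl_inv, LinearMap.lTensor_tmul,
    LinearMap.rTensor_tmul]
  have h := tensor_congr (f := LinearMap.lTensor Ω e ∘ₗ LinearMap.mulRight k (1 ⊗ₜ (y : Ω)) ∘ₗ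
      TensorProduct.map X.inv.val.toLinearMap X.incl)
    (g := TensorProduct.map X.inv.val.toLinearMap (LinearMap.mulRight k (ε y)) ∘ₗ
      LinearMap.lTensor X.inv (counit (R := k) (A := A)))
    (by intro z a; simp [he, hmul]) (X.invActCoact.coact x)
  simp only [LinearMap.comp_apply, coact_counit] at h
  simpa using h

/-- Π(x₁y) = x₁ ε(y), so x₀ ⊗ x₁ survives with coefficient ε(y). -/
theorem lTensor_proj_crossMap {ε : X.inv →ₗ[k] k}
    (hε : ∀ η : X.inv, X.proj η = algebraMap k A (ε η)) (t : X.inv ⊗[k] X.inv) :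
    LinearMap.lTensor Ω X.proj (X.crossMap t) =
      X.coactR (TensorProduct.rid k X.inv (LinearMap.lTensor X.inv ε t)) := by
  refine tensor_congr (f := LinearMap.lTensor Ω X.proj ∘ₗ X.crossMap)
    (g := X.coactR.toLinearMap ∘ₗ X.inv.val.toLinearMap ∘ₗ (TensorProduct.rid k X.inv).toLinearMap ∘ₗ
      LinearMap.lTensor X.inv ε) ?_ t
  intro x y
  simp only [LinearMap.comp_apply, crossMap_tmul, coactIncl_apply, LinearMap.lTensor_tmul,
    LinearEquiv.coe_coe, TensorProduct.rid_tmul, map_smul, AlgHom.toLinearMap_apply,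
    Subalgebra.coe_val]
  exact tensor_congr (f := LinearMap.lTensor Ω X.proj ∘ₗ LinearMap.mulRight k (1 ⊗ₜ (y : Ω)) ∘ₗ
      LinearMap.lTensor Ω X.incl) (g := ε y • LinearMap.id)
    (by
      intro u a
      simp [proj_incl_mul, hε, Algebra.algebraMap_eq_smul_one]) (X.coactR x)

/-! ### Coassociativity -/

/-- The right coaction `x ↦ x₀ ⊗ (x₁ ⊗ x₂)`. -/
def coactIncl₃ : Ω →ₐ[k] Ω ⊗[k] (Ω ⊗[k] Ω) :=
  (Algebra.TensorProduct.map (AlgHom.id k Ω) X.comulIncl).comp X.coactR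

theorem coactIncl₃_apply (u : Ω) :
    X.coactIncl₃ u = LinearMap.lTensor Ω X.comulIncl.toLinearMap (X.coactR u) := rfl

/-- The map `x ⊗ y ⊗ z ↦ x₀ ⊗ x₁ y₀ ⊗ x₂ y₁ z`. -/
def crossMap₃ : X.inv ⊗[k] (X.inv ⊗[k] X.inv) →ₗ[k] Ω ⊗[k] (Ω ⊗[k] Ω) :=
  TensorProduct.lift ((LinearMap.mul k (Ω ⊗[k] (Ω ⊗[k] Ω))).compl₁₂
    (X.coactIncl₃.toLinearMap ∘ₗ X.inv.val.toLinearMap) (TensorProduct.mk k Ω _ 1 ∘ₗ X.crossMap))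

theorem crossMap₃_tmul (x : X.inv) (t : X.inv ⊗[k] X.inv) :
    X.crossMap₃ (x ⊗ₜ t) = X.coactIncl₃ x * 1 ⊗ₜ[k] X.crossMap t := by
  simp [crossMap₃]

theorem map_invProj_comulIncl_mul (a : A) (t : Ω ⊗[k] Ω) :
    TensorProduct.map X.invProj X.invProj (X.comulIncl a * t) =
      counit (R := k) a • TensorProduct.map X.invProj X.invProj t := by
  have h1 : ∀ c : A ⊗[k] A, TensorProduct.map X.invProj X.invProj (X.incl₂ c * t) =
      LinearMap.mul' k k (TensorProduct.map (counit (R := k)) (counit (R := k)) c) •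
        TensorProduct.map X.invProj X.invProj t := by
    intro c
    induction c using TensorProduct.induction_on with
    | zero => simp
    | add x y hx hy => simp only [map_add, add_mul, add_smul, hx, hy]
    | tmul a b =>
      exact tensor_congr
        (f := TensorProduct.map X.invProj X.invProj ∘ₗ LinearMap.mulLeft k (X.incl₂ (a ⊗ₜ b)))
        (g := (counit (R := k) a * counit (R := k) b) •
          TensorProduct.map X.invProj X.invProj)
        (by
          intro u v
          simp [invProj_incl_mul, TensorProduct.smul_tmul', TensorProduct.tmul_smul, smul_smul,
            mul_comm]) t
  rw [comulIncl_apply, h1]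
  congr 1
  have h2 := LinearMap.congr_fun (comul_conv_counit_left (counit (R := k) (A := A))) a
  rw [← h2, conv_apply]
  congr 3

theorem map_invProj_crossMap₃ (t : X.inv ⊗[k] (X.inv ⊗[k] X.inv)) :
    TensorProduct.map X.invProj (TensorProduct.map X.invProj X.invProj) (X.crossMap₃ t) = t := by
  refine tensor_congr (f := TensorProduct.map X.invProj
    (TensorProduct.map X.invProj X.invProj) ∘ₗ X.crossMap₃) (g := LinearMap.id) ?_ t
  intro x s
  rw [LinearMap.comp_apply, crossMap₃_tmul, coactIncl₃_apply, coactR_inv]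
  have h := tensor_congr (f := TensorProduct.map X.invProj
      (TensorProduct.map X.invProj X.invProj) ∘ₗ LinearMap.mulRight k (1 ⊗ₜ X.crossMap s) ∘ₗ
        LinearMap.lTensor Ω X.comulIncl.toLinearMap ∘ₗ LinearMap.rTensor A X.inv.val.toLinearMap)
    (g := LinearMap.lTensor X.inv ((LinearMap.lsmul k (X.inv ⊗[k] X.inv)).flip s) ∘ₗ
      LinearMap.lTensor X.inv (counit (R := k) (A := A)))
    (by intro z a; simp [invProj_inv, map_invProj_comulIncl_mul, map_invProj_crossMap])
    (X.invActCoact.coact x)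
  simp only [LinearMap.comp_apply, coact_counit] at h
  simpa using h

theorem crossMap₃_injective : Function.Injective X.crossMap₃ :=
  Function.LeftInverse.injective X.map_invProj_crossMap₃

/-- The second coaction falls on the A-leg x₁, where it is the coproduct. -/
theorem coactIncl₃_inv (x : X.inv) :
    Algebra.TensorProduct.map (AlgHom.id k Ω) X.coactIncl (X.coactIncl x) = X.coactIncl₃ x := by
  rw [coactIncl_apply, coactIncl₃_apply]
  exact tensor_congr (f := LinearMap.lTensor Ω X.coactIncl.toLinearMap ∘ₗ
      LinearMap.lTensor Ω X.incl) (g := LinearMap.lTensor Ω X.comulIncl.toLinearMap)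
    (by intro u a; simp [coactIncl_incl]) _

/-- x₀ ⊗ Δ(x₁y) = x₀ ⊗ Δ(x₁) j(Δ'y). With the next lemma it turns coassociativity of Δ on Λ into
that of Δ', in both directions. -/
theorem lTensor_comul_crossMap {Δ : Ω →ₗ[k] Ω ⊗[k] Ω} {Δ' : X.inv →ₗ[k] X.inv ⊗[k] X.inv}
    (hA : ∀ a u, Δ (X.incl a * u) = X.comulIncl a * Δ u)
    (hΛ : ∀ η : X.inv, Δ η = X.crossMap (Δ' η)) (t : X.inv ⊗[k] X.inv) :
    LinearMap.lTensor Ω Δ (X.crossMap t) = X.crossMap₃ (LinearMap.lTensor X.inv Δ' t) := by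
  refine tensor_congr (f := LinearMap.lTensor Ω Δ ∘ₗ X.crossMap)
    (g := X.crossMap₃ ∘ₗ LinearMap.lTensor X.inv Δ') ?_ t
  intro x y
  simp only [LinearMap.comp_apply, LinearMap.lTensor_tmul, crossMap_tmul, crossMap₃_tmul,
    coactIncl_apply, coactIncl₃_apply, ← hΛ]
  exact tensor_congr (f := LinearMap.lTensor Ω Δ ∘ₗ LinearMap.mulRight k (1 ⊗ₜ (y : Ω)) ∘ₗ
      LinearMap.lTensor Ω X.incl)
    (g := LinearMap.mulRight k (1 ⊗ₜ Δ (y : Ω)) ∘ₗ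
      LinearMap.lTensor Ω X.comulIncl.toLinearMap) (by intro u a; simp [hA]) _

/-- In Δ(x₀) ⊗ x₁y, colinearity of Δ' replaces Δ'(x₀) ⊗ x₁ by the coaction of Δ'(x), and j carries
this coaction to its second leg. -/
theorem rTensor_comul_crossMap {Δ : Ω →ₗ[k] Ω ⊗[k] Ω} {Δ' : X.inv →ₗ[k] X.inv ⊗[k] X.inv}
    (hΛ : ∀ η : X.inv, Δ η = X.crossMap (Δ' η))
    (hco : ∀ η, (X.invActCoact.tensor X.invActCoact).coact (Δ' η) =
      LinearMap.rTensor A Δ' (X.invActCoact.coact η)) (t : X.inv ⊗[k] X.inv) :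
    TensorProduct.assoc k Ω Ω Ω (LinearMap.rTensor Ω Δ (X.crossMap t)) =
      X.crossMap₃ (TensorProduct.assoc k X.inv X.inv X.inv (LinearMap.rTensor X.inv Δ' t)) := by
  refine tensor_congr
    (f := (TensorProduct.assoc k Ω Ω Ω).toLinearMap ∘ₗ LinearMap.rTensor Ω Δ ∘ₗ X.crossMap)
    (g := X.crossMap₃ ∘ₗ (TensorProduct.assoc k X.inv X.inv X.inv).toLinearMap ∘ₗ
      LinearMap.rTensor X.inv Δ') ?_ t
  intro x y
  simp only [LinearMap.comp_apply, LinearMap.rTensor_tmul, LinearEquiv.coe_coe, crossMap_tmul,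
    coactIncl_inv]
  have h1 := tensor_congr (f := (TensorProduct.assoc k Ω Ω Ω).toLinearMap ∘ₗ
      LinearMap.rTensor Ω Δ ∘ₗ LinearMap.mulRight k (1 ⊗ₜ (y : Ω)) ∘ₗ
        TensorProduct.map X.inv.val.toLinearMap X.incl)
    (g := LinearMap.mulRight k (1 ⊗ₜ (1 ⊗ₜ (y : Ω))) ∘ₗ
      LinearMap.lTensor Ω (LinearMap.lTensor Ω X.incl) ∘ₗ
        (TensorProduct.assoc k Ω Ω A).toLinearMap ∘ₗ LinearMap.rTensor A X.crossMap ∘ₗ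
          LinearMap.rTensor A Δ')
    (by
      intro z a
      simp only [LinearMap.comp_apply, TensorProduct.map_tmul, LinearMap.rTensor_tmul,
        LinearMap.mulRight_apply, Algebra.TensorProduct.tmul_mul_tmul, mul_one,
        AlgHom.toLinearMap_apply, Subalgebra.coe_val, hΛ]
      exact tensor_congr (f := (TensorProduct.assoc k Ω Ω Ω).toLinearMap ∘ₗ
          (TensorProduct.mk k (Ω ⊗[k] Ω) Ω).flip (X.incl a * y))
        (g := LinearMap.mulRight k (1 ⊗ₜ (1 ⊗ₜ (y : Ω))) ∘ₗ
          LinearMap.lTensor Ω (LinearMap.lTensor Ω X.incl) ∘ₗ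
            (TensorProduct.assoc k Ω Ω A).toLinearMap ∘ₗ (TensorProduct.mk k (Ω ⊗[k] Ω) A).flip a)
        (by intro u v; simp) _) (X.invActCoact.coact x)
  simp only [LinearMap.comp_apply, LinearEquiv.coe_coe, ← hco, ← lTensor_coactR_crossMap,
    LinearMap.mulRight_apply] at h1
  rw [h1]
  refine tensor_congr (f := LinearMap.mulRight k (1 ⊗ₜ (1 ⊗ₜ (y : Ω))) ∘ₗ
      LinearMap.lTensor Ω (LinearMap.lTensor Ω X.incl) ∘ₗ
        LinearMap.lTensor Ω X.coactR.toLinearMap ∘ₗ X.crossMap)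
    (g := X.crossMap₃ ∘ₗ (TensorProduct.assoc k X.inv X.inv X.inv).toLinearMap ∘ₗ
      (TensorProduct.mk k (X.inv ⊗[k] X.inv) X.inv).flip y) ?_ (Δ' x)
  intro z w
  simp only [LinearMap.comp_apply, LinearMap.flip_apply, TensorProduct.mk_apply,
    LinearEquiv.coe_coe, TensorProduct.assoc_tmul, crossMap₃_tmul, LinearMap.mulRight_apply]
  rw [← coactIncl₃_inv, crossMap_tmul, crossMap_tmul]
  have h2 : ∀ s : Ω ⊗[k] Ω, LinearMap.lTensor Ω (LinearMap.lTensor Ω X.incl)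
      (LinearMap.lTensor Ω X.coactR.toLinearMap s) =
        Algebra.TensorProduct.map (AlgHom.id k Ω) X.coactIncl s := by
    intro s
    exact tensor_congr (f := LinearMap.lTensor Ω (LinearMap.lTensor Ω X.incl) ∘ₗ
        LinearMap.lTensor Ω X.coactR.toLinearMap)
      (g := (Algebra.TensorProduct.map (AlgHom.id k Ω) X.coactIncl).toLinearMap)
      (by intro u v; simp [coactIncl_apply]) s
  rw [h2, map_mul, mul_assoc]
  simp

/-! ### From strong bicovariance to the braided-super Hopf algebra of left-invariant forms -/

/-- The coproduct on the left-invariant forms induced by a coproduct on `Ω`. -/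
def invComul (Δ : Ω →ₗ[k] Ω ⊗[k] Ω) : X.inv →ₗ[k] X.inv ⊗[k] X.inv :=
  TensorProduct.map X.invProj X.invProj ∘ₗ Δ ∘ₗ X.inv.val.toLinearMap

theorem invComul_apply (Δ : Ω →ₗ[k] Ω ⊗[k] Ω) (η : X.inv) :
    X.invComul Δ η = TensorProduct.map X.invProj X.invProj (Δ η) := rfl

namespace IsStrong

variable {X} {Δ : Ω →ₗ[k] Ω ⊗[k] Ω} {ε : Ω →ₗ[k] k} {S : Ω →ₗ[k] Ω} (h : X.IsStrong Δ ε S)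
include h

theorem comul_mul (u v : Ω) : Δ (u * v) = superMul 𝒢 (Δ u) (Δ v) := h.hopf.comul_mul u v

theorem comul_incl_mul (a : A) (u : Ω) : Δ (X.incl a * u) = X.comulIncl a * Δ u := by
  rw [h.comul_mul, h.comul_incl, ← incl₂_apply, superMul_incl₂]
  rfl

/-- The first leg of Δη is left-invariant: with Δ_L = (Π ⊗ id)Δ, coassociativity gives (Δ_L ⊗ id)Δη
= (id ⊗ Δ)Δ_L η = 1 ⊗ Δη. -/
theorem rTensor_invProj_comul (η : X.inv) :
    LinearMap.rTensor Ω (X.inv.val.toLinearMap ∘ₗ X.invProj) (Δ η) = Δ η := by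
  have h1 : LinearMap.rTensor Ω X.coactL.toLinearMap (Δ η) =
      (TensorProduct.assoc k A Ω Ω).symm (1 ⊗ₜ Δ η) := by
    rw [LinearEquiv.eq_symm_apply]
    have h2 : X.coactL.toLinearMap = LinearMap.rTensor Ω X.proj ∘ₗ Δ := LinearMap.ext h.coactL_eq
    rw [h2, LinearMap.rTensor_comp_apply]
    have h3 := tensor_congr (f := (TensorProduct.assoc k A Ω Ω).toLinearMap ∘ₗ
        LinearMap.rTensor Ω (LinearMap.rTensor Ω X.proj))
      (g := LinearMap.rTensor (Ω ⊗[k] Ω) X.proj ∘ₗ (TensorProduct.assoc k Ω Ω Ω).toLinearMap)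
      (by
        intro t w
        induction t using TensorProduct.induction_on with
        | zero => simp
        | add x y hx hy => simp only [TensorProduct.add_tmul, map_add, hx, hy]
        | tmul u v => simp) (LinearMap.rTensor Ω Δ (Δ η))
    simp only [LinearMap.comp_apply, LinearEquiv.coe_coe] at h3
    rw [h3, h.hopf.coassoc, ← LinearMap.comp_apply, LinearMap.rTensor_comp_lTensor,
      ← LinearMap.lTensor_comp_rTensor, LinearMap.comp_apply, ← h.coactL_eq, coactL_inv,
      LinearMap.lTensor_tmul]
  have h4 : X.inv.val.toLinearMap ∘ₗ X.invProj = LinearMap.mul' k Ω ∘ₗ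
      TensorProduct.map (X.incl ∘ₗ antipode k) LinearMap.id ∘ₗ X.coactL.toLinearMap := rfl
  rw [h4, LinearMap.rTensor_comp_apply, LinearMap.rTensor_comp_apply, h1]
  exact tensor_congr (f := LinearMap.rTensor Ω (LinearMap.mul' k Ω) ∘ₗ
      LinearMap.rTensor Ω (TensorProduct.map (X.incl ∘ₗ antipode k) LinearMap.id) ∘ₗ
        (TensorProduct.assoc k A Ω Ω).symm.toLinearMap ∘ₗ TensorProduct.mk k A _ 1)
    (g := LinearMap.id) (by intro u v; simp [X.incl_one]) (Δ η)

/-- This is u = u₋₁ P(u₀) with Δ_L written as (Π ⊗ id)Δ. -/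
theorem conv_proj_invProj (u : Ω) :
    conv Δ (X.incl ∘ₗ X.proj) (X.inv.val.toLinearMap ∘ₗ X.invProj) u = u := by
  have h1 := X.incl_mul_invProj u
  rwa [conv_of_map (f := X.proj) (g := LinearMap.id) (τ := Δ) (u := u) (h.coactL_eq u),
    LinearMap.comp_id] at h1

/-- As Δ_R = (id ⊗ Π)Δ and the first leg of Δη is invariant, j((P ⊗ P)Δη) = η₁ ⊗ Π(η₂)P(η₃), and
Π(u₁)P(u₂) = u. This determines Δ from Δ' and is the key to the forward direction. -/
theorem comul_inv (η : X.inv) : Δ η = X.crossMap (X.invComul Δ η) := by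
  have h1 := tensor_congr (f := X.crossMap ∘ₗ TensorProduct.map X.invProj X.invProj)
    (g := LinearMap.lTensor Ω (LinearMap.mul' k Ω ∘ₗ TensorProduct.map (X.incl ∘ₗ X.proj)
      (X.inv.val.toLinearMap ∘ₗ X.invProj)) ∘ₗ (TensorProduct.assoc k Ω Ω Ω).toLinearMap ∘ₗ
        LinearMap.rTensor Ω Δ ∘ₗ LinearMap.rTensor Ω (X.inv.val.toLinearMap ∘ₗ X.invProj))
    (by
      intro u v
      simp only [LinearMap.comp_apply, TensorProduct.map_tmul, LinearMap.rTensor_tmul,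
        crossMap_tmul, coactIncl_apply, h.coactR_eq, LinearEquiv.coe_coe,
        AlgHom.toLinearMap_apply, Subalgebra.coe_val]
      exact tensor_congr (f := LinearMap.mulRight k (1 ⊗ₜ (X.invProj v : Ω)) ∘ₗ
          LinearMap.lTensor Ω X.incl ∘ₗ LinearMap.lTensor Ω X.proj)
        (g := LinearMap.lTensor Ω (LinearMap.mul' k Ω ∘ₗ TensorProduct.map (X.incl ∘ₗ X.proj)
          (X.inv.val.toLinearMap ∘ₗ X.invProj)) ∘ₗ (TensorProduct.assoc k Ω Ω Ω).toLinearMap ∘ₗ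
            (TensorProduct.mk k (Ω ⊗[k] Ω) Ω).flip v) (by intro a b; simp) _) (Δ η)
  simp only [LinearMap.comp_apply, h.rTensor_invProj_comul, LinearEquiv.coe_coe,
    h.hopf.coassoc] at h1
  rw [invComul_apply, h1, ← LinearMap.lTensor_comp_apply]
  have h2 : (LinearMap.mul' k Ω ∘ₗ TensorProduct.map (X.incl ∘ₗ X.proj)
      (X.inv.val.toLinearMap ∘ₗ X.invProj)) ∘ₗ Δ = LinearMap.id :=
    LinearMap.ext h.conv_proj_invProj
  rw [h2, LinearMap.lTensor_id, LinearMap.id_apply]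

/-- Under j both sides become (id ⊗ id ⊗ Π) of the iterated coproduct of η, by coassociativity. -/
theorem coact_invComul (η : X.inv) :
    (X.invActCoact.tensor X.invActCoact).coact (X.invComul Δ η) =
      LinearMap.rTensor A (X.invComul Δ) (X.invActCoact.coact η) := by
  have hinj : Function.Injective (LinearMap.rTensor A X.crossMap) := by
    refine Function.LeftInverse.injective
      (g := LinearMap.rTensor A (TensorProduct.map X.invProj X.invProj)) fun t => ?_
    rw [← LinearMap.rTensor_comp_apply]
    have : TensorProduct.map X.invProj X.invProj ∘ₗ X.crossMap = LinearMap.id :=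
      LinearMap.ext X.map_invProj_crossMap
    rw [this, LinearMap.rTensor_id, LinearMap.id_apply]
  apply hinj
  apply (TensorProduct.assoc k Ω Ω A).injective
  rw [← lTensor_coactR_crossMap, ← h.comul_inv, ← LinearMap.rTensor_comp_apply]
  have h1 : X.crossMap ∘ₗ X.invComul Δ = Δ ∘ₗ X.inv.val.toLinearMap :=
    LinearMap.ext fun x => (h.comul_inv x).symm
  have h2 : X.coactR.toLinearMap = LinearMap.lTensor Ω X.proj ∘ₗ Δ := LinearMap.ext h.coactR_eq
  rw [h1, LinearMap.rTensor_comp_apply, ← coactR_inv, h.coactR_eq, h2,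
    LinearMap.lTensor_comp_apply, ← h.hopf.coassoc, ← LinearMap.comp_apply (LinearMap.rTensor A Δ),
    LinearMap.rTensor_comp_lTensor, ← LinearMap.lTensor_comp_rTensor, LinearMap.comp_apply]
  exact tensor_congr (f := LinearMap.lTensor Ω (LinearMap.lTensor Ω X.proj) ∘ₗ
      (TensorProduct.assoc k Ω Ω Ω).toLinearMap)
    (g := (TensorProduct.assoc k Ω Ω A).toLinearMap ∘ₗ LinearMap.lTensor (Ω ⊗[k] Ω) X.proj)
    (by
      intro t w
      induction t using TensorProduct.induction_on with
      | zero => simp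
      | add x y hx hy => simp only [TensorProduct.add_tmul, map_add, hx, hy]
      | tmul u v => simp) _

/-- Δ(η)Δ(b) = Δ(ηb) = Δ(b₁)Δ(η ◁ b₂), while j(t)Δ(b) = Δ(b₁)j(t ◁ b₂); the algebra map Δ on A can
be cancelled. -/
theorem invComul_act (η : X.inv) (a : A) : X.invComul Δ (X.invActCoact.act η a) =
    (X.invActCoact.tensor X.invActCoact).act (X.invComul Δ η) a := by
  apply X.crossMap_injective
  rw [← h.comul_inv]
  have h1 : Δ ∘ₗ X.inv.val.toLinearMap ∘ₗ X.invActCoact.act η =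
      X.crossMap ∘ₗ (X.invActCoact.tensor X.invActCoact).act (X.invComul Δ η) := by
    apply conv_left_cancel X.comulIncl
    ext b
    rw [← crossMap_mul_comulIncl, ← h.comul_inv]
    have h2 : Δ η * X.comulIncl b = Δ (η * X.incl b) := by
      rw [h.comul_mul, h.comul_incl, ← incl₂_apply, ← mul_one (X.incl₂ _), ← superMul_mul_incl₂,
        superMul_one]
      rfl
    rw [h2, ← conv_incl_act, conv_apply, conv_apply]
    exact tensor_congr (f := LinearMap.mul' k (Ω ⊗[k] Ω) ∘ₗ TensorProduct.map
        X.comulIncl.toLinearMap (Δ ∘ₗ X.inv.val.toLinearMap ∘ₗ X.invActCoact.act η))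
      (g := Δ ∘ₗ LinearMap.mul' k Ω ∘ₗ TensorProduct.map X.incl
        (X.inv.val.toLinearMap ∘ₗ X.invActCoact.act η))
      (by intro c d; simp [h.comul_incl_mul]) _
  exact LinearMap.congr_fun h1 a

theorem counit_incl_mul (a : A) (u : Ω) : ε (X.incl a * u) = counit (R := k) a * ε u := by
  rw [h.hopf.counit_mul, h.counit_incl]

theorem proj_inv (η : X.inv) : X.proj η = algebraMap k A (ε η) :=
  X.proj_inv (ε := ε ∘ₗ X.inv.val.toLinearMap) h.hopf.counit_one
    (fun n η hη hn => h.hopf.counit_mem n η hη hn) η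

/-- Linearity comes from applying the character ε to ηa = a₁(η ◁ a₂); colinearity from (ε ⊗ Π)Δη = 1
⊗ Π(η) and Π(η) = ε(η)1. -/
theorem counit_hom : X.invActCoact.IsHom ActCoact.unit (ε ∘ₗ X.inv.val.toLinearMap) where
  map_act η a := by
    have h1 := congrArg ε (X.conv_incl_act η a)
    rw [h.hopf.counit_mul, h.counit_incl, conv_apply] at h1
    have h2 := tensor_congr (f := ε ∘ₗ LinearMap.mul' k Ω ∘ₗ
        TensorProduct.map X.incl (X.inv.val.toLinearMap ∘ₗ X.invActCoact.act η))
      (g := LinearMap.mul' k k ∘ₗ TensorProduct.map (Algebra.linearMap k k ∘ₗ counit (R := k))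
        (ε ∘ₗ X.inv.val.toLinearMap ∘ₗ X.invActCoact.act η))
      (by intro c d; simp [h.counit_incl_mul]) (comul (R := k) a)
    have h3 := LinearMap.congr_fun (comul_conv_counit_left
      (ε ∘ₗ X.inv.val.toLinearMap ∘ₗ X.invActCoact.act η)) a
    rw [conv_apply] at h3
    simp only [LinearMap.comp_apply] at h1 h2 h3
    simp only [LinearMap.comp_apply, ActCoact.unit, LinearMap.compl₂_apply, LinearMap.mul_apply']
    exact h3.symm.trans (h2.symm.trans h1)
  map_coact η := by
    rw [LinearMap.rTensor_comp_apply, ← coactR_inv, h.coactR_eq,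
      ← LinearMap.comp_apply (LinearMap.rTensor A ε),
      LinearMap.rTensor_comp_lTensor, ← LinearMap.lTensor_comp_rTensor,
      LinearMap.comp_apply (LinearMap.lTensor k X.proj), h.hopf.rTensor_counit, LinearMap.lTensor_tmul, h.proj_inv, Algebra.algebraMap_eq_smul_one,
      TensorProduct.tmul_smul, TensorProduct.smul_tmul', smul_eq_mul, mul_one]
    rfl

theorem invComul_coassoc (η : X.inv) : TensorProduct.assoc k X.inv X.inv X.inv
    (LinearMap.rTensor X.inv (X.invComul Δ) (X.invComul Δ η)) =
      LinearMap.lTensor X.inv (X.invComul Δ) (X.invComul Δ η) := by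
  apply X.crossMap₃_injective
  rw [← X.rTensor_comul_crossMap h.comul_inv h.coact_invComul,
    ← X.lTensor_comul_crossMap h.comul_incl_mul h.comul_inv, ← h.comul_inv, h.hopf.coassoc]

theorem rTensor_counit_invComul (η : X.inv) :
    LinearMap.rTensor X.inv (ε ∘ₗ X.inv.val.toLinearMap) (X.invComul Δ η) = 1 ⊗ₜ η := by
  have h1 := X.rTensor_crossMap (e := ε) (f := LinearMap.id) (fun _ => rfl) h.counit_hom
    (X.invComul Δ η)
  rw [← h.comul_inv, h.hopf.rTensor_counit] at h1
  have h2 := congrArg (TensorProduct.map (LinearMap.id : k →ₗ[k] k) X.invProj) h1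
  rw [← LinearMap.comp_apply, ← TensorProduct.map_comp] at h2
  have h3 : X.invProj ∘ₗ X.inv.val.toLinearMap = LinearMap.id := LinearMap.ext X.invProj_inv
  rw [h3, LinearMap.id_comp, TensorProduct.map_id, LinearMap.id_apply, TensorProduct.map_tmul,
    invProj_inv] at h2
  exact h2.symm

theorem lTensor_counit_invComul (η : X.inv) :
    LinearMap.lTensor X.inv (ε ∘ₗ X.inv.val.toLinearMap) (X.invComul Δ η) = η ⊗ₜ 1 := by
  apply X.rTensor_val_injective
  rw [← X.lTensor_counit_crossMap (e := ε) (fun _ => rfl) h.counit_incl_mul, ← h.comul_inv,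
    h.hopf.lTensor_counit]
  rfl

theorem invComul_mul (v w : X.inv) : X.invComul Δ (v * w) = braidedMul
    (X.invActCoact.braiding X.invActCoact ∘ₗ koszul X.invGrading)
      (X.invComul Δ v ⊗ₜ X.invComul Δ w) := by
  apply X.crossMap_injective
  rw [← superMul_crossMap, ← h.comul_inv, ← h.comul_inv, ← h.comul_inv, Subalgebra.coe_mul,
    h.comul_mul]

theorem invComul_one : X.invComul Δ 1 = 1 ⊗ₜ 1 := by
  rw [invComul_apply, Subalgebra.coe_one, h.hopf.comul_one, TensorProduct.map_tmul, invProj_one]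

theorem twistedCoderivation : X.TwistedCoderivation (X.invComul Δ) := by
  rw [twistedCoderivation_iff]
  intro η
  apply X.crossMap_injective
  rw [← dTensor_crossMap, ← h.comul_inv, ← h.comul_inv, ← d_inv, h.coderivation]
  rfl

end IsStrong

/-! ### The antipode of the left-invariant forms -/

theorem coact_mul (x y : X.inv) : X.invActCoact.coact (x * y) =
    X.invActCoact.coact x * X.invActCoact.coact y := by
  apply X.rTensor_val_injective
  have h : ∀ t, LinearMap.rTensor A X.inv.val.toLinearMap t =
      Algebra.TensorProduct.map X.inv.val (AlgHom.id k A) t := fun _ => rfl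
  rw [← coactR_inv, Subalgebra.coe_mul, map_mul, coactR_inv, coactR_inv, h, h, h, map_mul]

theorem coact_one : X.invActCoact.coact 1 = 1 := by
  rw [coact_def, Subalgebra.coe_one, map_one, Algebra.TensorProduct.one_def,
    LinearMap.rTensor_tmul, invProj_one]
  rfl

/-- The right coaction on the left-invariant forms as an algebra map. -/
def coactHom : X.inv →ₐ[k] X.inv ⊗[k] A :=
  AlgHom.ofLinearMap X.invActCoact.coact X.coact_one X.coact_mul

/-- The map `x ↦ f(x₀) x₁`. -/
def twistRight (f : X.inv →ₗ[k] Ω) : X.inv →ₗ[k] Ω := conv X.invActCoact.coact f X.incl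

/-- The map `x ↦ f(x₀) S(x₁)`. -/
def untwistRight (f : X.inv →ₗ[k] Ω) : X.inv →ₗ[k] Ω :=
  conv X.invActCoact.coact f (X.incl ∘ₗ antipode k)

/-- f(x₀)S(x₁)x₂ = f(x). -/
theorem twistRight_untwistRight (f : X.inv →ₗ[k] Ω) : X.twistRight (X.untwistRight f) = f := by
  ext x
  have h := conv_antipode_left X.inclHom
  rw [inclHom_toLinearMap] at h
  rw [twistRight, untwistRight, conv_coassoc _ _ _ (X.coact_coassoc x), h,
    conv_counit_right (X.coact_counit x)]

/-- x₀ S(x₁y) = x₀ S(y) S(x₁). Reversal of products by S is needed only when one factor lies in A.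
-/
theorem mul_lTensor_crossMap_tmul {S : Ω →ₗ[k] Ω}
    (hS : ∀ a u, S (X.incl a * u) = S u * X.incl (antipode k a)) (x y : X.inv) :
    LinearMap.mul' k Ω (LinearMap.lTensor Ω S (X.crossMap (x ⊗ₜ y))) =
      X.untwistRight (LinearMap.mulRight k (S y) ∘ₗ X.inv.val.toLinearMap) x := by
  rw [crossMap_tmul, coactIncl_inv, untwistRight, conv_apply]
  exact tensor_congr (f := LinearMap.mul' k Ω ∘ₗ LinearMap.lTensor Ω S ∘ₗ
      LinearMap.mulRight k (1 ⊗ₜ (y : Ω)) ∘ₗ TensorProduct.map X.inv.val.toLinearMap X.incl)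
    (g := LinearMap.mul' k Ω ∘ₗ TensorProduct.map (LinearMap.mulRight k (S y) ∘ₗ
      X.inv.val.toLinearMap) (X.incl ∘ₗ antipode k))
    (by intro z a; simp [hS, mul_assoc]) (X.invActCoact.coact x)

theorem mul_rTensor_crossMap_tmul (S : Ω →ₗ[k] Ω) (x y : X.inv) :
    LinearMap.mul' k Ω (LinearMap.rTensor Ω S (X.crossMap (x ⊗ₜ y))) =
      X.twistRight (S ∘ₗ X.inv.val.toLinearMap) x * y := by
  rw [crossMap_tmul, coactIncl_inv, twistRight, conv_apply]
  exact tensor_congr (f := LinearMap.mul' k Ω ∘ₗ LinearMap.rTensor Ω S ∘ₗ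
      LinearMap.mulRight k (1 ⊗ₜ (y : Ω)) ∘ₗ TensorProduct.map X.inv.val.toLinearMap X.incl)
    (g := LinearMap.mulRight k (y : Ω) ∘ₗ LinearMap.mul' k Ω ∘ₗ TensorProduct.map
      (S ∘ₗ X.inv.val.toLinearMap) X.incl)
    (by intro z a; simp [mul_assoc]) (X.invActCoact.coact x)

theorem mul_rTensor_incl₂_mul {S : Ω →ₗ[k] Ω}
    (hS : ∀ a u, S (X.incl a * u) = S u * X.incl (antipode k a)) (a : A) (t : Ω ⊗[k] Ω) :
    LinearMap.mul' k Ω (LinearMap.rTensor Ω S (X.comulIncl a * t)) =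
      counit (R := k) a • LinearMap.mul' k Ω (LinearMap.rTensor Ω S t) := by
  have h := LinearMap.congr_fun (conv_antipode_left X.inclHom) a
  rw [conv_apply] at h
  induction t using TensorProduct.induction_on with
  | zero => simp
  | add x y hx hy => simp only [map_add, mul_add, smul_add, hx, hy]
  | tmul u v =>
    have h1 := tensor_congr (f := LinearMap.mul' k Ω ∘ₗ LinearMap.rTensor Ω S ∘ₗ
        LinearMap.mulRight k (u ⊗ₜ v) ∘ₗ X.incl₂.toLinearMap)
      (g := LinearMap.mulRight k v ∘ₗ LinearMap.mulLeft k (S u) ∘ₗ LinearMap.mul' k Ω ∘ₗ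
        TensorProduct.map (X.inclHom.toLinearMap ∘ₗ antipode k) X.inclHom.toLinearMap)
      (by intro b c; simp [hS, mul_assoc]) (comul (R := k) a)
    simp only [LinearMap.comp_apply, h] at h1
    simpa [comulIncl_apply, Algebra.algebraMap_eq_smul_one] using h1

/-- Here the contraction of t stands between a₁ and S(a₂), so it must be a scalar before a₁S(a₂) can
collapse. In the left-handed version S(a₁)a₂ is already adjacent and t is arbitrary. -/
theorem mul_lTensor_incl₂_mul {S : Ω →ₗ[k] Ω}
    (hS : ∀ a u, S (X.incl a * u) = S u * X.incl (antipode k a)) (a : A) {t : Ω ⊗[k] Ω} {r : k}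
    (ht : LinearMap.mul' k Ω (LinearMap.lTensor Ω S t) = algebraMap k Ω r) :
    LinearMap.mul' k Ω (LinearMap.lTensor Ω S (X.comulIncl a * t)) =
      algebraMap k Ω (counit (R := k) a * r) := by
  have h := LinearMap.congr_fun (conv_antipode_right X.inclHom) a
  rw [conv_apply] at h
  have h1 : ∀ c : A ⊗[k] A, LinearMap.mul' k Ω (LinearMap.lTensor Ω S (X.incl₂ c * t)) =
      r • LinearMap.mul' k Ω
        (TensorProduct.map X.inclHom.toLinearMap (X.inclHom.toLinearMap ∘ₗ antipode k) c) := by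
    intro c
    induction c using TensorProduct.induction_on with
    | zero => simp
    | add x y hx hy => simp only [map_add, add_mul, smul_add, hx, hy]
    | tmul b c =>
      have h2 := tensor_congr (f := LinearMap.mul' k Ω ∘ₗ LinearMap.lTensor Ω S ∘ₗ
          LinearMap.mulLeft k (X.incl₂ (b ⊗ₜ c)))
        (g := LinearMap.mulLeft k (X.incl b) ∘ₗ LinearMap.mulRight k (X.incl (antipode k c)) ∘ₗ
          LinearMap.mul' k Ω ∘ₗ LinearMap.lTensor Ω S)
        (by intro u v; simp [hS, mul_assoc]) t
      simp only [LinearMap.comp_apply, ht, LinearMap.mulLeft_apply, LinearMap.mulRight_apply] at h2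
      rw [h2]
      simp [Algebra.algebraMap_eq_smul_one]
  rw [comulIncl_apply, h1, h]
  simp [Algebra.algebraMap_eq_smul_one, smul_smul, mul_comm]

/-- The antipode on the left-invariant forms induced by an antipode on `Ω`. -/
def invAntipode (S : Ω →ₗ[k] Ω) : X.inv →ₗ[k] X.inv :=
  X.invProj ∘ₗ X.twistRight (S ∘ₗ X.inv.val.toLinearMap)

namespace IsStrong

variable {X} {Δ : Ω →ₗ[k] Ω ⊗[k] Ω} {ε : Ω →ₗ[k] k} {S : Ω →ₗ[k] Ω} (h : X.IsStrong Δ ε S)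
include h

theorem conv_id_antipode (u : Ω) : conv Δ LinearMap.id S u = algebraMap k Ω (ε u) :=
  h.hopf.antipode_right u

/-- `S(a₁ u) a₂ = ε(a) S(u)`. -/
theorem conv_antipode_mul_incl (u : Ω) :
    conv (comul (R := k)) (S ∘ₗ LinearMap.mulRight k u ∘ₗ X.incl) X.incl =
      LinearMap.mulLeft k (S u) ∘ₗ Algebra.linearMap k Ω ∘ₗ counit (R := k) (A := A) := by
  ext a
  -- G(b ⊗ c)(u) = S(bu)c. For c = Δ(a) it will be compared with ε(a)S by convolving over Ω.
  let G : A ⊗[k] A →ₗ[k] Ω →ₗ[k] Ω := TensorProduct.lift (LinearMap.mk₂ k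
    (fun b c => LinearMap.mulRight k (X.incl c) ∘ₗ S ∘ₗ LinearMap.mulLeft k (X.incl b))
    (fun b b' c => by ext; simp [add_mul]) (fun r b c => by ext; simp)
    (fun b c c' => by ext; simp [mul_add]) (fun r b c => by ext; simp))
  have hG : ∀ b c u, G (b ⊗ₜ c) u = S (X.incl b * u) * X.incl c := by
    intro b c u
    simp [G]
  have h1 : ∀ (c : A ⊗[k] A) (t : Ω ⊗[k] Ω), LinearMap.mul' k Ω
      (TensorProduct.map (G c) LinearMap.id t) =
        LinearMap.mul' k Ω (LinearMap.rTensor Ω S (X.incl₂ c * t)) := by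
    intro c t
    induction c using TensorProduct.induction_on with
    | zero => simp
    | add x y hx hy => simp only [map_add, add_mul, TensorProduct.map_add_left,
        LinearMap.add_apply, hx, hy]
    | tmul b c =>
      exact tensor_congr (f := LinearMap.mul' k Ω ∘ₗ TensorProduct.map (G (b ⊗ₜ c)) LinearMap.id)
        (g := LinearMap.mul' k Ω ∘ₗ LinearMap.rTensor Ω S ∘ₗ
          LinearMap.mulLeft k (X.incl₂ (b ⊗ₜ c)))
        (by intro v w; simp [hG, mul_assoc]) t
  -- S(a₁v₁)a₂v₂ = ε(av), the left antipode axiom at av.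
  have h2 : conv Δ (G (comul (R := k) a)) LinearMap.id =
      counit (R := k) a • (Algebra.linearMap k Ω ∘ₗ ε) := by
    ext v
    rw [conv_apply, h1, ← comulIncl_apply, ← h.comul_incl_mul]
    rw [h.hopf.antipode_left, h.counit_incl_mul, map_mul, ← Algebra.smul_def]
    rfl
  have h3 : conv Δ LinearMap.id S = Algebra.linearMap k Ω ∘ₗ ε := LinearMap.ext h.conv_id_antipode
  -- Both bracketings of G(Δa)(u₁) u₂ S(u₃): one is ε(a)S(u), the other G(Δa)(u).
  have h4 := conv_coassoc (G (comul (R := k) a)) LinearMap.id S (h.hopf.coassoc u)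
  have h5 : conv Δ (counit (R := k) a • (Algebra.linearMap k Ω ∘ₗ ε)) S =
      counit (R := k) a • conv Δ (Algebra.linearMap k Ω ∘ₗ ε) S := by
    ext v
    simp [conv_apply, TensorProduct.map_smul_left]
  rw [h2, h3, conv_counit_right (h.hopf.lTensor_counit u), h5, LinearMap.smul_apply,
    conv_counit_left (h.hopf.rTensor_counit u)] at h4
  have h6 : conv (comul (R := k)) (S ∘ₗ LinearMap.mulRight k u ∘ₗ X.incl) X.incl a =
      G (comul (R := k) a) u :=
    tensor_congr (f := LinearMap.mul' k Ω ∘ₗ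
        TensorProduct.map (S ∘ₗ LinearMap.mulRight k u ∘ₗ X.incl) X.incl)
      (g := LinearMap.applyₗ u ∘ₗ G) (by intro b c; simp [hG]) (comul (R := k) a)
  rw [h6, ← h4]
  simp [Algebra.algebraMap_eq_smul_one]

/-- S(au) = S(a₁u) a₂ S(a₃) = S(u) S(a). -/
theorem antipode_incl_mul (a : A) (u : Ω) :
    S (X.incl a * u) = S u * X.incl (antipode k a) := by
  have h1 := comul_conv_counit_right (S ∘ₗ LinearMap.mulRight k u ∘ₗ X.incl)
  have h2 := conv_antipode_right X.inclHom
  rw [inclHom_toLinearMap] at h2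
  rw [← h2, ← comul_conv_assoc, h.conv_antipode_mul_incl] at h1
  have h3 := LinearMap.congr_fun h1 a
  rw [← mul_conv, comul_conv_counit_left] at h3
  exact h3.symm

end IsStrong

/-! ### Convolution inverses of the identity of Λ are crossed-module morphisms -/

section ConvInverse

variable {Δ' : X.inv →ₗ[k] X.inv ⊗[k] X.inv} {ε' : X.inv →ₗ[k] k} {S' : X.inv →ₗ[k] X.inv}

/-- A convolution inverse of the identity commutes with the coaction. -/
theorem antipode_map_coact
    (hassoc : ∀ u, TensorProduct.assoc k X.inv X.inv X.inv (LinearMap.rTensor X.inv Δ' (Δ' u)) =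
      LinearMap.lTensor X.inv Δ' (Δ' u))
    (hleft : ∀ u, LinearMap.rTensor X.inv ε' (Δ' u) = 1 ⊗ₜ u)
    (hright : ∀ u, LinearMap.lTensor X.inv ε' (Δ' u) = u ⊗ₜ 1)
    (hl : ∀ u, LinearMap.mul' k X.inv (LinearMap.rTensor X.inv S' (Δ' u)) =
      algebraMap k X.inv (ε' u))
    (hr : ∀ u, LinearMap.mul' k X.inv (LinearMap.lTensor X.inv S' (Δ' u)) =
      algebraMap k X.inv (ε' u))
    (hΔ : ∀ η, (X.invActCoact.tensor X.invActCoact).coact (Δ' η) =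
      LinearMap.rTensor A Δ' (X.invActCoact.coact η))
    (hε : ∀ η, ActCoact.unit.coact (ε' η) = LinearMap.rTensor A ε' (X.invActCoact.coact η))
    (η : X.inv) : X.invActCoact.coact (S' η) =
      LinearMap.rTensor A S' (X.invActCoact.coact η) := by
  -- In the convolution algebra of maps Λ → Λ ⊗ A, the left side is a left inverse of Δ_R because
  -- Δ_R is multiplicative, and the right side is a right inverse because Δ' and ε' are colinear.
  have key : X.invActCoact.coact ∘ₗ S' = LinearMap.rTensor A S' ∘ₗ X.invActCoact.coact := by
    refine conv_left_inv_eq_right_inv hassoc hleft hright (m := X.invActCoact.coact) ?_ ?_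
    · intro u
      have h1 := map_conv X.coactHom Δ' S' LinearMap.id u
      have h2 : conv Δ' S' LinearMap.id u = algebraMap k X.inv (ε' u) := hl u
      rw [h2, AlgHom.commutes] at h1
      exact h1.symm
    · intro u
      have h1 := tensor_congr (f := LinearMap.mul' k (X.inv ⊗[k] A) ∘ₗ TensorProduct.map
          X.invActCoact.coact (LinearMap.rTensor A S' ∘ₗ X.invActCoact.coact))
        (g := LinearMap.rTensor A (LinearMap.mul' k X.inv ∘ₗ LinearMap.lTensor X.inv S') ∘ₗ
          (X.invActCoact.tensor X.invActCoact).coact)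
        (by
          intro x y
          simp only [LinearMap.comp_apply, TensorProduct.map_tmul, LinearMap.mul'_apply,
            tensor_coact_tmul]
          generalize X.invActCoact.coact x = s
          generalize X.invActCoact.coact y = t
          induction s using TensorProduct.induction_on with
          | zero => simp
          | add s s' hs hs' => simp only [map_add, add_mul, LinearMap.add_apply, hs, hs']
          | tmul z a =>
            induction t using TensorProduct.induction_on with
            | zero => simp
            | add s s' hs hs' => simp only [map_add, mul_add, hs, hs']
            | tmul w b => simp [coactMul_tmul]) (Δ' u)
      have h2 : (LinearMap.mul' k X.inv ∘ₗ LinearMap.lTensor X.inv S') ∘ₗ Δ' =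
          Algebra.linearMap k X.inv ∘ₗ ε' := LinearMap.ext hr
      rw [conv_apply]
      refine h1.trans ?_
      rw [LinearMap.comp_apply, hΔ, ← LinearMap.rTensor_comp_apply, h2,
        LinearMap.rTensor_comp_apply, ← hε]
      simp only [ActCoact.unit, LinearMap.flip_apply, TensorProduct.mk_apply,
        LinearMap.rTensor_tmul, Algebra.linearMap_apply, Algebra.algebraMap_eq_smul_one,
        Algebra.TensorProduct.one_def, TensorProduct.smul_tmul']
  exact LinearMap.congr_fun key η

/-- A convolution inverse of the identity commutes with the action. -/
theorem antipode_map_act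
    (hassoc : ∀ u, TensorProduct.assoc k X.inv X.inv X.inv (LinearMap.rTensor X.inv Δ' (Δ' u)) =
      LinearMap.lTensor X.inv Δ' (Δ' u))
    (hleft : ∀ u, LinearMap.rTensor X.inv ε' (Δ' u) = 1 ⊗ₜ u)
    (hright : ∀ u, LinearMap.lTensor X.inv ε' (Δ' u) = u ⊗ₜ 1)
    (hl : ∀ u, LinearMap.mul' k X.inv (LinearMap.rTensor X.inv S' (Δ' u)) =
      algebraMap k X.inv (ε' u))
    (hr : ∀ u, LinearMap.mul' k X.inv (LinearMap.lTensor X.inv S' (Δ' u)) =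
      algebraMap k X.inv (ε' u))
    (hΔ : ∀ η a, Δ' (X.invActCoact.act η a) =
      (X.invActCoact.tensor X.invActCoact).act (Δ' η) a)
    (hε : ∀ η a, ε' (X.invActCoact.act η a) = ε' η * counit (R := k) a)
    (η : X.inv) (a : A) : S' (X.invActCoact.act η a) = X.invActCoact.act (S' η) a := by
  -- This gives Λ ⊗ A its tensor product coalgebra structure. On it, S' ∘ α and α ∘ (S' ⊗ id) are
  -- respectively a left and a right convolution inverse of the action map α, hence equal.
  let : Coalgebra k X.inv :=
    { comul := Δ'
      counit := ε'
      coassoc := LinearMap.ext hassoc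
      rTensor_counit_comp_comul := LinearMap.ext hleft
      lTensor_counit_comp_comul := LinearMap.ext hright }
  let T : X.inv ⊗[k] X.inv →ₗ[k] A ⊗[k] A →ₗ[k] (X.inv ⊗[k] A) ⊗[k] (X.inv ⊗[k] A) :=
    (TensorProduct.mk k (X.inv ⊗[k] X.inv) (A ⊗[k] A)).compr₂
      (TensorProduct.tensorTensorTensorComm k X.inv X.inv A A).toLinearMap
  have hT : ∀ x y c d, T (x ⊗ₜ y) (c ⊗ₜ d) = (x ⊗ₜ c) ⊗ₜ (y ⊗ₜ d) := by
    intro x y c d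
    simp [T]
  have hc : ∀ (u : X.inv) (b : A), comul (R := k) (u ⊗ₜ[k] b) = T (Δ' u) (comul (R := k) b) :=
    fun _ _ => rfl
  clear_value T
  have he : ∀ (u : X.inv) (b : A), counit (R := k) (u ⊗ₜ[k] b) = ε' u * counit (R := k) b := by
    intro u b
    rw [TensorProduct.counit_tmul, smul_eq_mul, mul_comm]
    rfl
  let α : X.inv ⊗[k] A →ₗ[k] X.inv := TensorProduct.lift X.invActCoact.act
  have key : S' ∘ₗ α = α ∘ₗ LinearMap.rTensor A S' := by
    refine conv_left_inv_eq_right_inv (τ := comul (R := k)) (e := counit (R := k)) (m := α)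
      Coalgebra.coassoc_apply Coalgebra.rTensor_counit_comul Coalgebra.lTensor_counit_comul ?_ ?_
    · refine tensor_congr (f := conv (comul (R := k)) (S' ∘ₗ α) α)
        (g := Algebra.linearMap k X.inv ∘ₗ counit (R := k) (A := X.inv ⊗[k] A)) ?_
      intro u b
      rw [conv_apply, hc, LinearMap.comp_apply, he, ← hε, Algebra.linearMap_apply, ← hl, hΔ]
      generalize Δ' u = t
      induction t using TensorProduct.induction_on with
      | zero => simp
      | add s s' hs hs' => simp only [map_add, LinearMap.add_apply, hs, hs']
      | tmul x y =>
        rw [tensor_act_tmul]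
        exact tensor_congr (f := LinearMap.mul' k X.inv ∘ₗ TensorProduct.map (S' ∘ₗ α) α ∘ₗ
            T (x ⊗ₜ y))
          (g := LinearMap.mul' k X.inv ∘ₗ LinearMap.rTensor X.inv S' ∘ₗ
            TensorProduct.map (X.invActCoact.act x) (X.invActCoact.act y))
          (by intro c d; simp [α, hT]) (comul (R := k) b)
    · refine tensor_congr (f := conv (comul (R := k)) α (α ∘ₗ LinearMap.rTensor A S'))
        (g := Algebra.linearMap k X.inv ∘ₗ counit (R := k) (A := X.inv ⊗[k] A)) ?_
      intro u b
      -- Here (x ◁ b₁)(S'(y) ◁ b₂) = (xS'(y)) ◁ b, and scalars transform under ◁ by ε(b).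
      have h1 : algebraMap k X.inv (ε' u * counit (R := k) b) =
          X.invActCoact.act (algebraMap k X.inv (ε' u)) b := by
        rw [Algebra.algebraMap_eq_smul_one, Algebra.algebraMap_eq_smul_one, map_smul,
          LinearMap.smul_apply, act_def, Subalgebra.coe_one, one_mul, invProj_incl, smul_smul]
      rw [conv_apply, hc, LinearMap.comp_apply, he, Algebra.linearMap_apply, h1, ← hr]
      generalize Δ' u = t
      induction t using TensorProduct.induction_on with
      | zero => simp
      | add s s' hs hs' => simp only [map_add, LinearMap.add_apply, hs, hs']
      | tmul x y =>
        rw [LinearMap.lTensor_tmul, LinearMap.mul'_apply, ← mul_act, conv_apply]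
        exact tensor_congr (f := LinearMap.mul' k X.inv ∘ₗ
            TensorProduct.map α (α ∘ₗ LinearMap.rTensor A S') ∘ₗ
            T (x ⊗ₜ y))
          (g := LinearMap.mul' k X.inv ∘ₗ
            TensorProduct.map (X.invActCoact.act x) (X.invActCoact.act (S' y)))
          (by intro c d; simp [α, hT]) (comul (R := k) b)
  have := LinearMap.congr_fun key (η ⊗ₜ a)
  simpa [α] using this

end ConvInverse

/-! ### The braided antipode induced by a strongly bicovariant structure -/

namespace IsStrong

variable {X} {Δ : Ω →ₗ[k] Ω ⊗[k] Ω} {ε : Ω →ₗ[k] k} {S : Ω →ₗ[k] Ω} (h : X.IsStrong Δ ε S)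
include h

/-- By right Λ-linearity of P the product P(S(x₀)x₁)y is P(S(x₀)x₁y), which for x ⊗ y = Δ'η is
P(S(η₁)η₂) = ε(η)1. -/
theorem invAntipode_left (η : X.inv) :
    LinearMap.mul' k X.inv (LinearMap.rTensor X.inv (X.invAntipode S) (X.invComul Δ η)) =
      algebraMap k X.inv (ε η) := by
  have h1 := tensor_congr (f := LinearMap.mul' k X.inv ∘ₗ
      LinearMap.rTensor X.inv (X.invAntipode S))
    (g := X.invProj ∘ₗ LinearMap.mul' k Ω ∘ₗ LinearMap.rTensor Ω S ∘ₗ X.crossMap)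
    (by
      intro x y
      simp only [LinearMap.comp_apply, mul_rTensor_crossMap_tmul, invProj_mul_inv,
        LinearMap.rTensor_tmul, LinearMap.mul'_apply]
      rfl) (X.invComul Δ η)
  simp only [LinearMap.comp_apply, ← h.comul_inv, h.hopf.antipode_left] at h1
  rw [h1, Algebra.algebraMap_eq_smul_one, map_smul, invProj_one, Algebra.algebraMap_eq_smul_one]

/-- The map `x ↦ S(x₀) x₁` is a right convolution inverse of the inclusion `Λ → Ω`. -/
theorem conv_val_twistRight (η : X.inv) :
    conv (X.invComul Δ) X.inv.val.toLinearMap (X.twistRight (S ∘ₗ X.inv.val.toLinearMap)) η =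
      algebraMap k Ω (ε η) := by
  -- g(x ⊗ y) = x₀S(y)S(x₁), so g ∘ Δ' = ε by the right antipode axiom of Ω.
  let g : X.inv ⊗[k] X.inv →ₗ[k] Ω :=
    LinearMap.mul' k Ω ∘ₗ LinearMap.lTensor Ω S ∘ₗ X.crossMap
  have hg : ∀ x y, g (x ⊗ₜ y) =
      X.untwistRight (LinearMap.mulRight k (S y) ∘ₗ X.inv.val.toLinearMap) x :=
    X.mul_lTensor_crossMap_tmul h.antipode_incl_mul
  -- g(x₀ ⊗ y₀)x₁y₁ = x S(y₀)y₁: the outer x-parts S(x₁)x₂ cancel.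
  have h1 := tensor_congr (f := conv (X.invActCoact.tensor X.invActCoact).coact g X.incl)
    (g := LinearMap.mul' k Ω ∘ₗ TensorProduct.map X.inv.val.toLinearMap
      (X.twistRight (S ∘ₗ X.inv.val.toLinearMap)))
    (by
      intro x y
      rw [conv_apply, tensor_coact_tmul, LinearMap.comp_apply, TensorProduct.map_tmul, twistRight,
        LinearMap.mul'_apply, mul_conv, conv_apply]
      generalize X.invActCoact.coact y = t
      induction t using TensorProduct.induction_on with
      | zero => simp
      | add s s' hs hs' => simp only [map_add, hs, hs']
      | tmul y b =>
        have h2 := LinearMap.congr_fun (X.twistRight_untwistRight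
          (LinearMap.mulRight k (S y) ∘ₗ X.inv.val.toLinearMap)) x
        rw [twistRight, conv_apply] at h2
        have h3 := tensor_congr (f := LinearMap.mul' k Ω ∘ₗ TensorProduct.map g X.incl ∘ₗ
            X.coactMul.flip (y ⊗ₜ b))
          (g := LinearMap.mulRight k (X.incl b) ∘ₗ LinearMap.mul' k Ω ∘ₗ TensorProduct.map
            (X.untwistRight (LinearMap.mulRight k (S y) ∘ₗ X.inv.val.toLinearMap)) X.incl)
          (by intro z a; simp [coactMul_tmul, hg, X.incl_mul, mul_assoc]) (X.invActCoact.coact x)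
        simp only [LinearMap.comp_apply, h2, LinearMap.flip_apply] at h3
        rw [h3]
        simp [mul_assoc]) (X.invComul Δ η)
  rw [conv_apply]
  refine h1.symm.trans ?_
  have h4 : g ∘ₗ X.invComul Δ = Algebra.linearMap k Ω ∘ₗ ε ∘ₗ X.inv.val.toLinearMap := by
    ext x
    simp only [LinearMap.comp_apply, g, ← h.comul_inv]
    exact h.hopf.antipode_right x
  -- Colinearity of Δ' turns the expression into g(Δ'(η₀))η₁ = ε(η₀)η₁ = ε(η).
  have h5 : (X.invActCoact.tensor X.invActCoact).coact (X.invComul Δ η) =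
      TensorProduct.map (X.invComul Δ) LinearMap.id (X.invActCoact.coact η) := h.coact_invComul η
  rw [conv_of_map h5, h4, LinearMap.comp_id, conv_apply, ← LinearMap.map_comp_rTensor,
    LinearMap.comp_apply, ← h.counit_hom.map_coact]
  simp [ActCoact.unit, X.incl_one]

/-- A left and a right convolution inverse of the inclusion Λ → Ω coincide. In particular S(x₀)x₁ is
left-invariant, so the projection in `invAntipode` loses nothing. -/
theorem twistRight_antipode : X.inv.val.toLinearMap ∘ₗ X.invAntipode S =
    X.twistRight (S ∘ₗ X.inv.val.toLinearMap) := by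
  refine conv_left_inv_eq_right_inv h.invComul_coassoc h.rTensor_counit_invComul
    h.lTensor_counit_invComul (m := X.inv.val.toLinearMap) ?_ h.conv_val_twistRight
  intro η
  have h1 := map_conv X.inv.val (X.invComul Δ) (X.invAntipode S) LinearMap.id η
  have h2 : conv (X.invComul Δ) (X.invAntipode S) LinearMap.id η = algebraMap k X.inv (ε η) :=
    h.invAntipode_left η
  rw [h2] at h1
  exact h1.symm

theorem invAntipode_right (η : X.inv) :
    LinearMap.mul' k X.inv (LinearMap.lTensor X.inv (X.invAntipode S) (X.invComul Δ η)) =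
      algebraMap k X.inv (ε η) := by
  have h1 := h.conv_val_twistRight η
  rw [← h.twistRight_antipode] at h1
  apply Subtype.ext
  have h2 := map_conv X.inv.val (X.invComul Δ) LinearMap.id (X.invAntipode S) η
  exact h2.trans h1

theorem invAntipode_mem {n : ℕ} {η : X.inv} (hη : η ∈ X.invGrading n) :
    X.invAntipode S η ∈ X.invGrading n := by
  apply X.invProj_mem
  rw [twistRight, conv_apply]
  obtain ⟨t, ht⟩ := X.coact_mem hη
  rw [← ht]
  clear ht
  induction t using TensorProduct.induction_on with
  | zero => simp
  | add s t hs ht => simpa only [map_add] using add_mem hs ht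
  | tmul w a =>
    have := SetLike.mul_mem_graded (A := 𝒢) (h.hopf.antipode_mem n _ w.2) (X.incl_mem a)
    simpa using this

theorem isGradedBraidedSuperHopf : IsGradedBraidedSuperHopf X.invGrading X.invActCoact
    (X.invComul Δ) (ε ∘ₗ X.inv.val.toLinearMap) (X.invAntipode S) where
  crossedModule := X.isCrossedModule
  act_mem _ _ hv a := X.act_mem hv a
  coact_mem _ _ hv := X.coact_mem hv
  mul_hom := X.mul_hom
  one_hom := X.one_hom
  comul_hom := ⟨h.invComul_act, h.coact_invComul⟩
  counit_hom := h.counit_hom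
  antipode_hom :=
    ⟨X.antipode_map_act h.invComul_coassoc h.rTensor_counit_invComul h.lTensor_counit_invComul
      h.invAntipode_left h.invAntipode_right h.invComul_act h.counit_hom.map_act,
    X.antipode_map_coact h.invComul_coassoc h.rTensor_counit_invComul h.lTensor_counit_invComul
      h.invAntipode_left h.invAntipode_right h.coact_invComul h.counit_hom.map_coact⟩
  hopf :=
    { coassoc := h.invComul_coassoc
      rTensor_counit := h.rTensor_counit_invComul
      lTensor_counit := h.lTensor_counit_invComul
      comul_one := h.invComul_one
      comul_mul := h.invComul_mul
      counit_one := h.hopf.counit_one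
      counit_mul := fun v w => h.hopf.counit_mul v w
      antipode_left := h.invAntipode_left
      antipode_right := h.invAntipode_right
      comul_mem := fun n v hv => X.map_invProj_mem (h.hopf.comul_mem n v hv)
      counit_mem := fun n v hv hn => h.hopf.counit_mem n v hv hn
      antipode_mem := fun _ _ hv => h.invAntipode_mem hv }

end IsStrong

/-! ### From the braided-super Hopf algebra of left-invariant forms to strong bicovariance -/

/-- The coproduct `Δ(a η) = a₁ (η¹)₀ ⊗ a₂ (η¹)₁ η²` on `Ω` given by a coproduct on `Λ`. -/
def bosonComul (Δ' : X.inv →ₗ[k] X.inv ⊗[k] X.inv) : Ω →ₗ[k] Ω ⊗[k] Ω :=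
  conv X.coactL.toLinearMap X.comulIncl.toLinearMap ((X.crossMap ∘ₗ Δ') ∘ₗ X.invProj)

/-- The counit `ε(a η) = ε(a) ε(η)` on `Ω` given by a counit on `Λ`. -/
def bosonCounit (ε' : X.inv →ₗ[k] k) : Ω →ₗ[k] k := ε' ∘ₗ X.invProj

/-- The antipode `S(a η) = S(η₀) S(a η₁)` on `Ω` given by an antipode on `Λ`. -/
def bosonAntipode (S' : X.inv →ₗ[k] X.inv) : Ω →ₗ[k] Ω :=
  LinearMap.mul' k Ω ∘ₗ TensorProduct.map (X.untwistRight (X.inv.val.toLinearMap ∘ₗ S'))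
    (X.incl ∘ₗ antipode k) ∘ₗ (TensorProduct.comm k A X.inv).toLinearMap ∘ₗ
      LinearMap.lTensor A X.invProj ∘ₗ X.coactL.toLinearMap

section Boson

variable (Δ' : X.inv →ₗ[k] X.inv ⊗[k] X.inv) (ε' : X.inv →ₗ[k] k) (S' : X.inv →ₗ[k] X.inv)

theorem bosonComul_incl_mul_inv (a : A) (η : X.inv) :
    X.bosonComul Δ' (X.incl a * η) = X.comulIncl a * X.crossMap (Δ' η) :=
  X.conv_coactL_incl_mul X.comulIncl.toLinearMap (X.crossMap ∘ₗ Δ') a η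

theorem bosonComul_inv (η : X.inv) : X.bosonComul Δ' η = X.crossMap (Δ' η) := by
  have h := X.bosonComul_incl_mul_inv Δ' 1 η
  rwa [X.incl_one, one_mul, map_one, one_mul] at h

theorem bosonComul_incl_mul (a : A) (u : Ω) :
    X.bosonComul Δ' (X.incl a * u) = X.comulIncl a * X.bosonComul Δ' u := by
  refine X.hom_congr (f := X.bosonComul Δ' ∘ₗ LinearMap.mulLeft k (X.incl a))
    (g := LinearMap.mulLeft k (X.comulIncl a) ∘ₗ X.bosonComul Δ') ?_ u
  intro b η
  simp only [LinearMap.comp_apply, LinearMap.mulLeft_apply]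
  rw [← mul_assoc, ← X.incl_mul, bosonComul_incl_mul_inv, bosonComul_incl_mul_inv, map_mul,
    mul_assoc]

theorem bosonCounit_inv (η : X.inv) : X.bosonCounit ε' η = ε' η := by
  rw [bosonCounit, LinearMap.comp_apply, invProj_inv]

theorem bosonCounit_incl_mul (a : A) (u : Ω) :
    X.bosonCounit ε' (X.incl a * u) = counit (R := k) a * X.bosonCounit ε' u := by
  rw [bosonCounit, LinearMap.comp_apply, invProj_incl_mul, map_smul, smul_eq_mul]
  rfl

theorem bosonAntipode_incl_mul_inv (a : A) (η : X.inv) : X.bosonAntipode S' (X.incl a * η) =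
    X.untwistRight (X.inv.val.toLinearMap ∘ₗ S') η * X.incl (antipode k a) := by
  simp [bosonAntipode, lTensor_invProj_coactL, -map_mul]

theorem bosonAntipode_inv (η : X.inv) :
    X.bosonAntipode S' η = X.untwistRight (X.inv.val.toLinearMap ∘ₗ S') η := by
  have h := X.bosonAntipode_incl_mul_inv S' 1 η
  rwa [X.incl_one, one_mul, HopfAlgebra.antipode_one, X.incl_one, mul_one] at h

theorem bosonAntipode_incl_mul (a : A) (u : Ω) : X.bosonAntipode S' (X.incl a * u) =
    X.bosonAntipode S' u * X.incl (antipode k a) := by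
  refine X.hom_congr (f := X.bosonAntipode S' ∘ₗ LinearMap.mulLeft k (X.incl a))
    (g := LinearMap.mulRight k (X.incl (antipode k a)) ∘ₗ X.bosonAntipode S') ?_ u
  intro b η
  simp only [LinearMap.comp_apply, LinearMap.mulLeft_apply, LinearMap.mulRight_apply]
  rw [← mul_assoc, ← X.incl_mul, bosonAntipode_incl_mul_inv, bosonAntipode_incl_mul_inv,
    HopfAlgebra.antipode_mul_antidistrib, X.incl_mul, mul_assoc]

end Boson

section IsGradedBraidedSuperHopf

variable {X} {Δ' : X.inv →ₗ[k] X.inv ⊗[k] X.inv} {ε' : X.inv →ₗ[k] k} {S' : X.inv →ₗ[k] X.inv}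
  (H : IsGradedBraidedSuperHopf X.invGrading X.invActCoact Δ' ε' S')
include H

/-- Both iterated coproducts take left multiplication by a to left multiplication by the iterated
coproduct of a, so coassociativity of A reduces the claim to Λ. -/
theorem bosonComul_coassoc (u : Ω) : TensorProduct.assoc k Ω Ω Ω
    (LinearMap.rTensor Ω (X.bosonComul Δ') (X.bosonComul Δ' u)) =
      LinearMap.lTensor Ω (X.bosonComul Δ') (X.bosonComul Δ' u) := by
  let φ : A ⊗[k] (A ⊗[k] A) →ₐ[k] Ω ⊗[k] (Ω ⊗[k] Ω) :=
    Algebra.TensorProduct.map X.inclHom X.incl₂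
  have hl : ∀ (c : A ⊗[k] A) (t : Ω ⊗[k] Ω), LinearMap.lTensor Ω (X.bosonComul Δ')
      (X.incl₂ c * t) = φ (LinearMap.lTensor A (comul (R := k)) c) *
        LinearMap.lTensor Ω (X.bosonComul Δ') t := by
    intro c t
    induction c using TensorProduct.induction_on with
    | zero => simp
    | add x y hx hy => simp only [map_add, add_mul, hx, hy]
    | tmul a b =>
      exact tensor_congr (f := LinearMap.lTensor Ω (X.bosonComul Δ') ∘ₗ
          LinearMap.mulLeft k (X.incl₂ (a ⊗ₜ b)))
        (g := LinearMap.mulLeft k (φ (LinearMap.lTensor A (comul (R := k)) (a ⊗ₜ b))) ∘ₗ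
          LinearMap.lTensor Ω (X.bosonComul Δ'))
        (by intro u v; simp [φ, bosonComul_incl_mul, comulIncl_apply]) t
  have hr : ∀ (c : A ⊗[k] A) (t : Ω ⊗[k] Ω), TensorProduct.assoc k Ω Ω Ω
      (LinearMap.rTensor Ω (X.bosonComul Δ') (X.incl₂ c * t)) =
        φ (TensorProduct.assoc k A A A (LinearMap.rTensor A (comul (R := k)) c)) *
          TensorProduct.assoc k Ω Ω Ω (LinearMap.rTensor Ω (X.bosonComul Δ') t) := by
    intro c t
    induction c using TensorProduct.induction_on with
    | zero => simp
    | add x y hx hy => simp only [map_add, add_mul, hx, hy]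
    | tmul a b =>
      refine tensor_congr (f := (TensorProduct.assoc k Ω Ω Ω).toLinearMap ∘ₗ
          LinearMap.rTensor Ω (X.bosonComul Δ') ∘ₗ LinearMap.mulLeft k (X.incl₂ (a ⊗ₜ b)))
        (g := LinearMap.mulLeft k
            (φ (TensorProduct.assoc k A A A (LinearMap.rTensor A (comul (R := k)) (a ⊗ₜ b)))) ∘ₗ
          (TensorProduct.assoc k Ω Ω Ω).toLinearMap ∘ₗ LinearMap.rTensor Ω (X.bosonComul Δ'))
        ?_ t
      intro u v
      simp only [LinearMap.comp_apply, LinearMap.mulLeft_apply, incl₂_tmul,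
        Algebra.TensorProduct.tmul_mul_tmul, LinearMap.rTensor_tmul, bosonComul_incl_mul,
        comulIncl_apply, LinearEquiv.coe_coe]
      generalize X.bosonComul Δ' u = s
      generalize comul (R := k) a = c
      induction c using TensorProduct.induction_on with
      | zero => simp
      | add x y hx hy => simp only [map_add, add_mul, TensorProduct.add_tmul, hx, hy]
      | tmul c d =>
        exact tensor_congr (f := (TensorProduct.assoc k Ω Ω Ω).toLinearMap ∘ₗ
            (TensorProduct.mk k (Ω ⊗[k] Ω) Ω).flip (X.incl b * v) ∘ₗ
              LinearMap.mulLeft k (X.incl₂ (c ⊗ₜ d)))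
          (g := LinearMap.mulLeft k (φ (TensorProduct.assoc k A A A ((c ⊗ₜ d) ⊗ₜ b))) ∘ₗ
            (TensorProduct.assoc k Ω Ω Ω).toLinearMap ∘ₗ (TensorProduct.mk k (Ω ⊗[k] Ω) Ω).flip v)
          (by intro x y; simp [φ]) s
  refine X.hom_congr (f := (TensorProduct.assoc k Ω Ω Ω).toLinearMap ∘ₗ
      LinearMap.rTensor Ω (X.bosonComul Δ') ∘ₗ X.bosonComul Δ')
    (g := LinearMap.lTensor Ω (X.bosonComul Δ') ∘ₗ X.bosonComul Δ') ?_ u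
  intro a η
  simp only [LinearMap.comp_apply, LinearEquiv.coe_coe, bosonComul_incl_mul_inv, comulIncl_apply,
    hl, hr, Coalgebra.coassoc_apply]
  rw [X.rTensor_comul_crossMap (X.bosonComul_inv Δ') H.comul_hom.map_coact,
    X.lTensor_comul_crossMap (X.bosonComul_incl_mul Δ') (X.bosonComul_inv Δ'), H.hopf.coassoc]

theorem rTensor_bosonCounit (u : Ω) :
    LinearMap.rTensor Ω (X.bosonCounit ε') (X.bosonComul Δ' u) = 1 ⊗ₜ u := by
  have h1 : ∀ (c : A ⊗[k] A) (t : Ω ⊗[k] Ω), LinearMap.rTensor Ω (X.bosonCounit ε')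
      (X.incl₂ c * t) = LinearMap.lTensor k X.incl (LinearMap.rTensor A (counit (R := k)) c) *
        LinearMap.rTensor Ω (X.bosonCounit ε') t := by
    intro c t
    induction c using TensorProduct.induction_on with
    | zero => simp
    | add x y hx hy => simp only [map_add, add_mul, hx, hy]
    | tmul a b =>
      exact tensor_congr (f := LinearMap.rTensor Ω (X.bosonCounit ε') ∘ₗ
          LinearMap.mulLeft k (X.incl₂ (a ⊗ₜ b)))
        (g := LinearMap.mulLeft k (LinearMap.lTensor k X.incl
          (LinearMap.rTensor A (counit (R := k)) (a ⊗ₜ b))) ∘ₗ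
            LinearMap.rTensor Ω (X.bosonCounit ε'))
        (by intro u v; simp [bosonCounit_incl_mul]) t
  refine X.hom_congr (f := LinearMap.rTensor Ω (X.bosonCounit ε') ∘ₗ X.bosonComul Δ')
    (g := TensorProduct.mk k k Ω 1) ?_ u
  intro a η
  rw [LinearMap.comp_apply, bosonComul_incl_mul_inv, comulIncl_apply, h1,
    Coalgebra.rTensor_counit_comul,
    X.rTensor_crossMap (f := LinearMap.id) (X.bosonCounit_inv ε') H.counit_hom,
    H.hopf.rTensor_counit]
  simp

theorem lTensor_bosonCounit (u : Ω) :
    LinearMap.lTensor Ω (X.bosonCounit ε') (X.bosonComul Δ' u) = u ⊗ₜ 1 := by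
  have h1 : ∀ (c : A ⊗[k] A) (t : Ω ⊗[k] Ω), LinearMap.lTensor Ω (X.bosonCounit ε')
      (X.incl₂ c * t) = LinearMap.rTensor k X.incl (LinearMap.lTensor A (counit (R := k)) c) *
        LinearMap.lTensor Ω (X.bosonCounit ε') t := by
    intro c t
    induction c using TensorProduct.induction_on with
    | zero => simp
    | add x y hx hy => simp only [map_add, add_mul, hx, hy]
    | tmul a b =>
      exact tensor_congr (f := LinearMap.lTensor Ω (X.bosonCounit ε') ∘ₗ
          LinearMap.mulLeft k (X.incl₂ (a ⊗ₜ b)))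
        (g := LinearMap.mulLeft k (LinearMap.rTensor k X.incl
          (LinearMap.lTensor A (counit (R := k)) (a ⊗ₜ b))) ∘ₗ
            LinearMap.lTensor Ω (X.bosonCounit ε'))
        (by intro u v; simp [bosonCounit_incl_mul]) t
  refine X.hom_congr (f := LinearMap.lTensor Ω (X.bosonCounit ε') ∘ₗ X.bosonComul Δ')
    (g := (TensorProduct.mk k Ω k).flip 1) ?_ u
  intro a η
  rw [LinearMap.comp_apply, bosonComul_incl_mul_inv, comulIncl_apply, h1,
    Coalgebra.lTensor_counit_comul,
    X.lTensor_counit_crossMap (X.bosonCounit_inv ε') (X.bosonCounit_incl_mul ε'),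
    H.hopf.lTensor_counit]
  simp

theorem bosonComul_incl (a : A) : X.bosonComul Δ' (X.incl a) = X.comulIncl a := by
  have h := X.bosonComul_incl_mul_inv Δ' a 1
  rwa [Subalgebra.coe_one, mul_one, H.hopf.comul_one, crossMap_tmul, Subalgebra.coe_one, map_one,
    ← Algebra.TensorProduct.one_def, mul_one, mul_one] at h

/-- Rewriting ηa as a₁(η ◁ a₂), this is linearity of Δ' under ◁ combined with
`crossMap_mul_comulIncl`. -/
theorem bosonComul_inv_mul_incl (η : X.inv) (a : A) :
    X.bosonComul Δ' (η * X.incl a) = X.crossMap (Δ' η) * X.comulIncl a := by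
  rw [← conv_incl_act, crossMap_mul_comulIncl, conv_apply, conv_apply]
  refine tensor_congr (f := X.bosonComul Δ' ∘ₗ LinearMap.mul' k Ω ∘ₗ TensorProduct.map X.incl
      (X.inv.val.toLinearMap ∘ₗ X.invActCoact.act η))
    (g := LinearMap.mul' k (Ω ⊗[k] Ω) ∘ₗ TensorProduct.map X.comulIncl.toLinearMap
      (X.crossMap ∘ₗ (X.invActCoact.tensor X.invActCoact).act (Δ' η))) ?_ _
  intro b c
  simp only [LinearMap.comp_apply, TensorProduct.map_tmul, LinearMap.mul'_apply,
    AlgHom.toLinearMap_apply, Subalgebra.coe_val, bosonComul_incl_mul_inv, H.comul_hom.map_act]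

theorem bosonComul_mul_inv (u : Ω) (ξ : X.inv) :
    X.bosonComul Δ' (u * ξ) = superMul 𝒢 (X.bosonComul Δ' u) (X.crossMap (Δ' ξ)) := by
  refine X.hom_congr (f := X.bosonComul Δ' ∘ₗ LinearMap.mulRight k (ξ : Ω))
    (g := (superMul 𝒢).flip (X.crossMap (Δ' ξ)) ∘ₗ X.bosonComul Δ') ?_ u
  intro a η
  simp only [LinearMap.comp_apply, LinearMap.mulRight_apply, LinearMap.flip_apply]
  rw [mul_assoc, ← Subalgebra.coe_mul, bosonComul_incl_mul_inv, bosonComul_incl_mul_inv,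
    H.hopf.comul_mul, ← superMul_crossMap, comulIncl_apply, superMul_incl₂_mul]

theorem bosonComul_mul_incl (u : Ω) (a : A) :
    X.bosonComul Δ' (u * X.incl a) = X.bosonComul Δ' u * X.comulIncl a := by
  refine X.hom_congr (f := X.bosonComul Δ' ∘ₗ LinearMap.mulRight k (X.incl a))
    (g := LinearMap.mulRight k (X.comulIncl a) ∘ₗ X.bosonComul Δ') ?_ u
  intro b η
  simp only [LinearMap.comp_apply, LinearMap.mulRight_apply]
  rw [mul_assoc, bosonComul_incl_mul, bosonComul_inv_mul_incl H, bosonComul_incl_mul_inv, mul_assoc]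

/-- Writing v = aη reduces to right multiplication by η (multiplicativity of Δ' and of j) and by a;
balancedness then moves Δ(a) into the second argument. -/
theorem bosonComul_mul (u v : Ω) :
    X.bosonComul Δ' (u * v) = superMul 𝒢 (X.bosonComul Δ' u) (X.bosonComul Δ' v) := by
  refine X.hom_congr (f := X.bosonComul Δ' ∘ₗ LinearMap.mulLeft k u)
    (g := superMul 𝒢 (X.bosonComul Δ' u) ∘ₗ X.bosonComul Δ') ?_ v
  intro a η
  simp only [LinearMap.comp_apply, LinearMap.mulLeft_apply]
  rw [← mul_assoc, bosonComul_mul_inv H, bosonComul_mul_incl H, bosonComul_incl_mul_inv,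
    comulIncl_apply, superMul_mul_incl₂]

theorem bosonCounit_mul (u v : Ω) :
    X.bosonCounit ε' (u * v) = X.bosonCounit ε' u * X.bosonCounit ε' v := by
  have h1 : ∀ (η : X.inv) (a : A), X.bosonCounit ε' (η * X.incl a) =
      ε' η * counit (R := k) a := by
    intro η a
    rw [bosonCounit, LinearMap.comp_apply, ← act_def, H.counit_hom.map_act]
    rfl
  have h2 : ∀ (w : Ω) (ξ : X.inv), X.bosonCounit ε' (w * ξ) = X.bosonCounit ε' w * ε' ξ := by
    intro w ξ
    simp only [bosonCounit, LinearMap.comp_apply, invProj_mul_inv, H.hopf.counit_mul]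
  have h3 : ∀ (w : Ω) (a : A), X.bosonCounit ε' (w * X.incl a) =
      X.bosonCounit ε' w * counit (R := k) a := by
    intro w a
    rw [bosonCounit, LinearMap.comp_apply, invProj_mul]
    exact h1 (X.invProj w) a
  refine X.hom_congr (f := X.bosonCounit ε' ∘ₗ LinearMap.mulLeft k u)
    (g := LinearMap.mulLeft k (X.bosonCounit ε' u) ∘ₗ X.bosonCounit ε') ?_ v
  intro a η
  simp only [LinearMap.comp_apply, LinearMap.mulLeft_apply]
  rw [← mul_assoc, h2, h3, h2, mul_assoc]
  congr 2
  have := X.bosonCounit_incl_mul ε' a 1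
  rw [mul_one] at this
  rw [this, ← Subalgebra.coe_one X.inv, bosonCounit_inv, H.hopf.counit_one, mul_one]

theorem bosonAntipode_left (u : Ω) : LinearMap.mul' k Ω
    (LinearMap.rTensor Ω (X.bosonAntipode S') (X.bosonComul Δ' u)) =
      algebraMap k Ω (X.bosonCounit ε' u) := by
  refine X.hom_congr (f := LinearMap.mul' k Ω ∘ₗ LinearMap.rTensor Ω (X.bosonAntipode S') ∘ₗ
    X.bosonComul Δ') (g := Algebra.linearMap k Ω ∘ₗ X.bosonCounit ε') ?_ u
  intro a η
  -- On Λ the antipode is S'(x₀)S(x₁), and twisting by x₂ recovers S'(x).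
  have h1 : X.twistRight (X.bosonAntipode S' ∘ₗ X.inv.val.toLinearMap) =
      X.inv.val.toLinearMap ∘ₗ S' := by
    have : X.bosonAntipode S' ∘ₗ X.inv.val.toLinearMap =
        X.untwistRight (X.inv.val.toLinearMap ∘ₗ S') := LinearMap.ext (X.bosonAntipode_inv S')
    rw [this, twistRight_untwistRight]
  have h2 := tensor_congr (f := LinearMap.mul' k Ω ∘ₗ LinearMap.rTensor Ω (X.bosonAntipode S') ∘ₗ
      X.crossMap)
    (g := X.inv.val.toLinearMap ∘ₗ LinearMap.mul' k X.inv ∘ₗ LinearMap.rTensor X.inv S')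
    (by
      intro x y
      simp only [LinearMap.comp_apply, mul_rTensor_crossMap_tmul, h1]
      simp) (Δ' η)
  simp only [LinearMap.comp_apply, H.hopf.antipode_left] at h2
  simp only [LinearMap.comp_apply, bosonComul_incl_mul_inv,
    X.mul_rTensor_incl₂_mul (X.bosonAntipode_incl_mul S'), h2, bosonCounit_incl_mul,
    bosonCounit_inv]
  simp [Algebra.algebraMap_eq_smul_one, smul_smul]

/-- x₀S'(y₀)S(y₁)S(x₁) = x₀S'(y₀)S(x₁y₁). As S' is colinear and the coaction multiplicative, this is
(xS'(y))₀ S((xS'(y))₁), and xS'(y) contracts to a scalar on Δ'η. -/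
theorem bosonAntipode_right (u : Ω) : LinearMap.mul' k Ω
    (LinearMap.lTensor Ω (X.bosonAntipode S') (X.bosonComul Δ' u)) =
      algebraMap k Ω (X.bosonCounit ε' u) := by
  refine X.hom_congr (f := LinearMap.mul' k Ω ∘ₗ LinearMap.lTensor Ω (X.bosonAntipode S') ∘ₗ
    X.bosonComul Δ') (g := Algebra.linearMap k Ω ∘ₗ X.bosonCounit ε') ?_ u
  intro a η
  have h2 := tensor_congr (f := LinearMap.mul' k Ω ∘ₗ LinearMap.lTensor Ω (X.bosonAntipode S') ∘ₗ
      X.crossMap)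
    (g := X.untwistRight X.inv.val.toLinearMap ∘ₗ LinearMap.mul' k X.inv ∘ₗ
      LinearMap.lTensor X.inv S')
    (by
      intro x y
      simp only [LinearMap.comp_apply,
        X.mul_lTensor_crossMap_tmul (X.bosonAntipode_incl_mul S'), LinearMap.lTensor_tmul,
        LinearMap.mul'_apply, bosonAntipode_inv]
      simp only [untwistRight, conv_apply, coact_mul, H.antipode_hom.map_coact]
      generalize X.invActCoact.coact x = s
      generalize X.invActCoact.coact y = t
      induction s using TensorProduct.induction_on with
      | zero => simp
      | add s s' hs hs' => simp only [map_add, add_mul, hs, hs']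
      | tmul z a =>
        exact tensor_congr (f := LinearMap.mulRight k (X.incl (antipode k a)) ∘ₗ
            LinearMap.mulLeft k (z : Ω) ∘ₗ LinearMap.mul' k Ω ∘ₗ
              TensorProduct.map (X.inv.val.toLinearMap ∘ₗ S') (X.incl ∘ₗ antipode k))
          (g := LinearMap.mul' k Ω ∘ₗ
            TensorProduct.map X.inv.val.toLinearMap (X.incl ∘ₗ antipode k) ∘ₗ
              LinearMap.mulLeft k (z ⊗ₜ a) ∘ₗ LinearMap.rTensor A S')
          (by
            intro w b
            simp [HopfAlgebra.antipode_mul_antidistrib, X.incl_mul, mul_assoc]) t) (Δ' η)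
  simp only [LinearMap.comp_apply, H.hopf.antipode_right] at h2
  have h3 : X.untwistRight X.inv.val.toLinearMap (algebraMap k X.inv (ε' η)) =
      algebraMap k Ω (ε' η) := by
    rw [Algebra.algebraMap_eq_smul_one, map_smul, untwistRight, conv_apply, coact_one,
      Algebra.TensorProduct.one_def, Algebra.algebraMap_eq_smul_one]
    simp [X.incl_one]
  rw [h3] at h2
  simp only [LinearMap.comp_apply, bosonComul_incl_mul_inv,
    X.mul_lTensor_incl₂_mul (X.bosonAntipode_incl_mul S') a h2, bosonCounit_incl_mul,
    bosonCounit_inv]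
  rfl

theorem bosonComul_mem {n : ℕ} {u : Ω} (hu : u ∈ 𝒢 n) :
    X.bosonComul Δ' u ∈ tensorGrading 𝒢 n := by
  rw [bosonComul, conv_apply, AlgHom.toLinearMap_apply]
  obtain ⟨t, ht⟩ := X.coactL_mem n u hu
  rw [← ht]
  clear ht
  induction t using TensorProduct.induction_on with
  | zero => simp
  | add s t hs ht => simpa only [map_add] using add_mem hs ht
  | tmul a w =>
    exact X.incl₂_mul_mem (comul (R := k) a)
      (X.crossMap_mem (H.hopf.comul_mem n _ (X.invProj_mem w.2)))

theorem bosonAntipode_mem {n : ℕ} {u : Ω} (hu : u ∈ 𝒢 n) : X.bosonAntipode S' u ∈ 𝒢 n := by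
  have h1 : ∀ η ∈ X.invGrading n, X.untwistRight (X.inv.val.toLinearMap ∘ₗ S') η ∈ 𝒢 n := by
    intro η hη
    rw [untwistRight, conv_apply]
    obtain ⟨t, ht⟩ := X.coact_mem hη
    rw [← ht]
    clear ht
    induction t using TensorProduct.induction_on with
    | zero => simp
    | add s t hs ht => simpa only [map_add] using add_mem hs ht
    | tmul w a =>
      have := SetLike.mul_mem_graded (A := 𝒢) (H.hopf.antipode_mem n _ w.2)
        (X.incl_mem (antipode k a))
      simpa using this
  simp only [bosonAntipode, LinearMap.comp_apply, AlgHom.toLinearMap_apply]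
  obtain ⟨t, ht⟩ := X.coactL_mem n u hu
  rw [← ht]
  clear ht
  induction t using TensorProduct.induction_on with
  | zero => simp
  | add s t hs ht => simpa only [map_add] using add_mem hs ht
  | tmul a w =>
    have := SetLike.mul_mem_graded (A := 𝒢) (h1 _ (X.invProj_mem w.2)) (X.incl_mem (antipode k a))
    simpa using this

theorem isGradedHopf_boson : IsGradedHopf 𝒢 (superFlip 𝒢) (X.bosonComul Δ') (X.bosonCounit ε')
    (X.bosonAntipode S') where
  coassoc := bosonComul_coassoc H
  rTensor_counit := rTensor_bosonCounit H
  lTensor_counit := lTensor_bosonCounit H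
  comul_one := by
    rw [← X.incl_one, bosonComul_incl H, map_one, X.incl_one, Algebra.TensorProduct.one_def]
  comul_mul := bosonComul_mul H
  counit_one := by
    rw [← Subalgebra.coe_one X.inv, bosonCounit_inv, H.hopf.counit_one]
  counit_mul := bosonCounit_mul H
  antipode_left := bosonAntipode_left H
  antipode_right := bosonAntipode_right H
  comul_mem _ _ hv := bosonComul_mem H hv
  counit_mem n _ hv hn := H.hopf.counit_mem n _ (X.invProj_mem hv) hn
  antipode_mem _ _ hv := bosonAntipode_mem H hv

/-! ### The bosonised coproduct induces the coactions and is compatible with d -/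

theorem coactL_eq_boson (u : Ω) :
    X.coactL u = LinearMap.rTensor Ω X.proj (X.bosonComul Δ' u) := by
  refine X.hom_congr (f := X.coactL.toLinearMap)
    (g := LinearMap.rTensor Ω X.proj ∘ₗ X.bosonComul Δ') ?_ u
  intro a η
  rw [LinearMap.comp_apply, bosonComul_incl_mul_inv, comulIncl_apply, rTensor_proj_incl₂_mul,
    X.rTensor_crossMap (f := Algebra.linearMap k A)
      (X.proj_inv H.hopf.counit_one H.hopf.counit_mem) H.counit_hom, H.hopf.rTensor_counit,
    AlgHom.toLinearMap_apply, map_mul, coactL_incl, coactL_inv]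
  simp

theorem coactR_eq_boson (u : Ω) :
    X.coactR u = LinearMap.lTensor Ω X.proj (X.bosonComul Δ' u) := by
  refine X.hom_congr (f := X.coactR.toLinearMap)
    (g := LinearMap.lTensor Ω X.proj ∘ₗ X.bosonComul Δ') ?_ u
  intro a η
  rw [LinearMap.comp_apply, bosonComul_incl_mul_inv, comulIncl_apply, lTensor_proj_incl₂_mul,
    X.lTensor_proj_crossMap (X.proj_inv H.hopf.counit_one H.hopf.counit_mem),
    H.hopf.lTensor_counit, AlgHom.toLinearMap_apply, map_mul, coactR_incl, TensorProduct.rid_tmul,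
    one_smul]

/-- Δ(da) lies in Ω⁰ ⊗ Ω¹ + Ω¹ ⊗ Ω⁰, so it is recovered from its images under Π ⊗ id and id ⊗ Π.
These are Δ_L(da) and Δ_R(da), known since d is bicovariant. -/
theorem bosonComul_d_incl (a : A) : X.bosonComul Δ' (X.d (X.incl a)) =
    LinearMap.rTensor Ω (X.d ∘ₗ X.incl) (LinearMap.lTensor A X.incl (comul (R := k) a)) +
      LinearMap.lTensor Ω (X.d ∘ₗ X.incl) (LinearMap.rTensor A X.incl (comul (R := k) a)) := by
  have h1 : X.bosonComul Δ' (X.d (X.incl a)) ∈ tensorGrading 𝒢 1 :=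
    bosonComul_mem H (X.d_incl_mem a)
  -- In total degree 1 exactly one leg has degree 0, so the two projections sum to the identity;
  -- this fails in every other degree.
  have h2 : ∀ t ∈ tensorGrading 𝒢 1, (((LinearMap.id : Ω ⊗[k] Ω →ₗ[k] Ω ⊗[k] Ω) - (LinearMap.rTensor Ω X.incl ∘ₗ
      LinearMap.rTensor Ω X.proj + LinearMap.lTensor Ω X.incl ∘ₗ LinearMap.lTensor Ω X.proj)) : Ω ⊗[k] Ω →ₗ[k] Ω ⊗[k] Ω) t ∈
        (⊥ : Submodule k (Ω ⊗[k] Ω)) := by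
    intro t ht
    refine map_mem_of_mem_tensorGrading ?_ ht
    intro i j hij v hv w hw
    have h3 : i = 0 ∧ j = 1 ∨ i = 1 ∧ j = 0 := by omega
    rcases h3 with ⟨rfl, rfl⟩ | ⟨rfl, rfl⟩
    · obtain ⟨b, rfl⟩ := X.exists_incl_of_mem hv
      simp [proj_incl, X.proj_of_mem_ne one_ne_zero hw]
    · obtain ⟨b, rfl⟩ := X.exists_incl_of_mem hw
      simp [proj_incl, X.proj_of_mem_ne one_ne_zero hv]
  have h3 := (Submodule.mem_bot k).1 (h2 _ h1)
  rw [LinearMap.sub_apply, sub_eq_zero, LinearMap.id_apply] at h3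
  rw [h3, LinearMap.add_apply, LinearMap.comp_apply, LinearMap.comp_apply, ← coactL_eq_boson H,
    ← coactR_eq_boson H, coactL_d_incl, coactR_d_incl]
  exact tensor_congr
    (f := LinearMap.rTensor Ω X.incl ∘ₗ LinearMap.lTensor A (X.d ∘ₗ X.incl) +
      LinearMap.lTensor Ω X.incl ∘ₗ LinearMap.rTensor A (X.d ∘ₗ X.incl))
    (g := LinearMap.rTensor Ω (X.d ∘ₗ X.incl) ∘ₗ LinearMap.lTensor A X.incl +
      LinearMap.lTensor Ω (X.d ∘ₗ X.incl) ∘ₗ LinearMap.rTensor A X.incl)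
    (by intro b c; simp [add_comm]) _

/-- With d(aη) = da·η + a·dη, the first term is governed by Δ(da) and the second by the twisted
identity transported along j; their sum is the Leibniz rule for d on Ω ⊗ Ω. -/
theorem bosonComul_coderivation (hT : X.TwistedCoderivation Δ') (u : Ω) :
    X.bosonComul Δ' (X.d u) = X.dTensor (X.bosonComul Δ' u) := by
  refine X.hom_congr (f := X.bosonComul Δ' ∘ₗ X.d) (g := X.dTensor ∘ₗ X.bosonComul Δ') ?_ u
  intro a η
  simp only [LinearMap.comp_apply]
  rw [d_incl_mul, map_add, bosonComul_mul_inv H, bosonComul_d_incl H, d_inv,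
    bosonComul_incl_mul_inv, (X.twistedCoderivation_iff Δ').1 hT, ← dTensor_crossMap,
    bosonComul_incl_mul_inv, comulIncl_apply, dTensor_incl₂_mul, add_comm]

theorem isStrong_boson (hT : X.TwistedCoderivation Δ') :
    X.IsStrong (X.bosonComul Δ') (X.bosonCounit ε') (X.bosonAntipode S') where
  hopf := isGradedHopf_boson H
  comul_incl := bosonComul_incl H
  counit_incl a := by
    rw [bosonCounit, LinearMap.comp_apply, invProj_incl, map_smul, H.hopf.counit_one, smul_eq_mul,
      mul_one]
  coactL_eq := coactL_eq_boson H
  coactR_eq := coactR_eq_boson H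
  coderivation := bosonComul_coderivation H hT

end IsGradedBraidedSuperHopf

end BicovariantDGA

end StrongBicov

end

theorem theorem3p6 {k A Ω : Type*} [Field k] (hchar : (2 : k) ≠ 0)
    [Ring A] [HopfAlgebra k A] (hS : Function.Bijective (HopfAlgebra.antipode k (A := A)))
    [Ring Ω] [Algebra k Ω] (𝒢 : ℕ → Submodule k Ω) [GradedAlgebra 𝒢]
    (X : StrongBicov.BicovariantDGA k A 𝒢) :
    X.StronglyBicovariant ↔
      ∃ (Δ : X.inv →ₗ[k] X.inv ⊗[k] X.inv) (ε : X.inv →ₗ[k] k) (S : X.inv →ₗ[k] X.inv),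
        StrongBicov.IsGradedBraidedSuperHopf X.invGrading X.invActCoact Δ ε S ∧
          X.TwistedCoderivation Δ := by
  constructor
  · rintro ⟨Δ, ε, S, h⟩
    exact ⟨_, _, _, h.isGradedBraidedSuperHopf, h.twistedCoderivation⟩
  · rintro ⟨Δ, ε, S, H, hT⟩
    exact ⟨_, _, _, StrongBicov.BicovariantDGA.isStrong_boson H hT⟩
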